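/- Let $N\ge 1$, let $\Omega,D\subset\mathbb R^N$ be bounded open sets with $\overline\Omega\subset D$, let $2\le p<\infty$ and $1/p+1/q=1$. Let $W_0^{1,p}(\Omega)$ be the closure of $C_0^\infty(\Omega)$ in the norm $\|y\|=\big(\int_\Omega\sum_{i}|\partial_i y|^p\,dx+\int_\Omega|y|^p\,dx\big)^{1/p}$ and $W^{-1,q}(\Omega)$ its dual; likewise for $D$. Extension by zero embeds $W_0^{1,p}(\Omega)$ in $W_0^{1,p}(D)$. For $\eta\in\mathbb R^N$ put $[\eta^{p-2}]=\mathrm{diag}(|\eta_1|^{p-2},\dots,|\eta_N|^{p-2})$ and $|\eta|_p^p=\sum_k|\eta_k|^p$. *Controls.* Let $0<\alpha\le\beta<\infty$ and let $M_p^{\alpha,\beta}(D)$ be the set of symmetric $\mathcal U=[a_{ij}]\in L^\infty(D;\mathbb R^{N\times N})$ such that, for a.e. $x\in D$, $|a_{ij}(x)|\le\beta$ for all $i,j$, and for all $\zeta,\eta\in\mathbb R^N$ $$\big(\mathcal U(x)([\zeta^{p-2}]\zeta-[\eta^{p-2}]\eta),\zeta-\eta\big)\ge 0,\qquad \big(\mathcal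 U(x)[\zeta^{p-2}]\zeta,\zeta\big)\ge\alpha|\zeta|_p^p .$$ Let $\xi_1,\xi_2\in L^\infty(D)$ with $0\le\xi_1\le\xi_2$ a.e., and let $Q_1,\dots,Q_N$ be nonempty compact convex subsets of $W^{-1,q}(D)$. Let $U_b$ be the set of $\mathcal U\in M_p^{\alpha,\beta}(D)$ with $\xi_1\le a_{ij}\le\xi_2$ a.e. in $D$ for all $i,j$, and $U_{sol}$ the set of $\mathcal U=[u_1,\dots,u_N]\in M_p^{\alpha,\beta}(D)$ (columns $u_i$) with $\mathrm{div}\,u_i\in Q_i$ for all $i$, where $\langle\mathrm{div}\,u,\varphi\rangle=-\int_D(u,\nabla\varphi)\,dx$ for $\varphi\in W_0^{1,p}(D)$. Suppose that $U_{ad}=U_b\cap U_{sol}$ is nonempty. *Operators.* Let $f\in W^{-1,q}(D)$ and $g,z_d\in L^p(D)$, and write $\langle w,z\rangle=\int_\Omega wz\,dx$ for $w\in L^q(\Omega)$, $z\in L^p(\Omega)$. Let $B:L^q(\Omega)\to L^p(\Omega)$ be linear, continuous and positive ($\langle w,Bw\rangle\ge 0$ for all $w$), with a right inverse $B_r^{-1}$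 (that is, $BB_r^{-1}h=h$) defined on a subset of $L^p(\Omega)$ that contains $g|_\Omega$. Let $F:W_0^{1,p}(\Omega)\times L^p(\Omega)\to L^q(\Omega)$ satisfy: 1. (uniformly semi-bounded variation) for every bounded $Y_0\subset W_0^{1,p}(\Omega)$ there are a seminorm $|||\cdot|||$ on $L^p(\Omega)$ for which the unit ball of $L^p(\Omega)$ is totally bounded, and functions $C_y:\mathbb R_+\times\mathbb R_+\to\mathbb R$ ($y\in Y_0$), continuous and with $C_y(r,t)/t\to 0$ as $t\to 0+$ for each $r>0$, such that for all $R>0$, $y\in Y_0$ and $\|z_1\|,\|z_2\|\le R$ $$\langle F(y,z_1)-F(y,z_2),z_1-z_2\rangle\ge-\inf_{y'\in Y_0}C_{y'}(R,|||z_1-z_2|||);$$ 2. (radial continuity) for all $y\in W_0^{1,p}(\Omega)$ and $z_1,z_2\in L^p(\Omega)$ there is $\varepsilon>0$ such that $\tau\mapsto\langle F(y,z_1+\tau z_2),z_2\rangle$ is continuous on $[0,\varepsilon]$; 3. (coercivity) for every bounded $Y_0\subset W_0^{1,p}(\Omega)$ there is $\lambda>0$ such that $\langle F(y,z)-B_r^{-1}(g|_\Omega),z\rangle\ge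 0$ whenever $y\in Y_0$ and $\|z\|_{L^p(\Omega)}>\lambda$; 4. (compactness in $y$) if $y_k\to y_0$ weakly in $W_0^{1,p}(\Omega)$, then $F(y_k,z)\to F(y_0,z)$ strongly in $L^q(\Omega)$ for every $z\in L^p(\Omega)$. Let $\Xi_{sol}$ be the set of all $(\mathcal U,y,z)\in U_{ad}\times W_0^{1,p}(\Omega)\times L^p(\Omega)$ such that $$\int_\Omega\big(\mathcal U[(\nabla y)^{p-2}]\nabla y,\nabla v\big)\,dx+\int_\Omega|y|^{p-2}y\,v\,dx=\langle f,v\rangle\quad\text{for all }v\in W_0^{1,p}(\Omega)$$ and $z+BF(y,z)=g$ in $\Omega$ in the sense of distributions. Then there is $(\mathcal U^{opt},y^{opt},z^{opt})\in\Xi_{sol}$ with $$\int_\Omega|z^{opt}-z_d|^p\,dx=\inf_{(\mathcal U,y,z)\in\Xi_{sol}}\int_\Omega|z-z_d|^p\,dx .$$ -/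

import Mathlib

open MeasureTheory Set Filter Topology
open scoped ENNReal

noncomputable section

namespace HammersteinOCP

/-- The Euclidean space `ℝ^N`. -/
abbrev Space (N : ℕ) := EuclideanSpace ℝ (Fin N)

/-- The Lebesgue space `L^r(Ω)`. -/
abbrev LpOn {N : ℕ} (r : ℝ≥0∞) (Ω : Set (Space N)) := Lp ℝ r (volume.restrict Ω)

/-- The partial derivative `∂φ/∂x_i`. -/
def partialDeriv {N : ℕ} (i : Fin N) (φ : Space N → ℝ) (x : Space N) : ℝ :=
  fderiv ℝ φ x (EuclideanSpace.single i 1)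

/-- `φ ∈ C_0^∞(Ω)`. -/
structure IsTestFunction {N : ℕ} (Ω : Set (Space N)) (φ : Space N → ℝ) : Prop where
  smooth : ContDiff ℝ (⊤ : ℕ∞) φ
  compact : HasCompactSupport φ
  support : tsupport φ ⊆ Ω

/-! ### Sobolev spaces

An element of `W_0^{1,p}(Ω)` is represented by its extension by zero to `ℝ^N`, together with the
extension by zero of its weak gradient: the component `none` is the function, the component
`some i` is its `i`-th weak partial derivative. -/

/-- Tuples `(y, v_1, …, v_N)` in `L^p(ℝ^N)^{N+1}`, normed by
`(‖y‖_p^p + ∑ i, ‖v_i‖_p^p)^{1/p}`. -/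
abbrev JetSpace (N : ℕ) (p : ℝ≥0∞) :=
  PiLp p (fun _ : Option (Fin N) => Lp ℝ p (volume : Measure (Space N)))

/-- The tuples `(φ, ∂_1 φ, …, ∂_N φ)` with `φ ∈ C_0^∞(Ω)`. -/
def testJets {N : ℕ} (p : ℝ≥0∞) [Fact (1 ≤ p)] (Ω : Set (Space N)) :
    Submodule ℝ (JetSpace N p) where
  carrier := {w | ∃ φ : Space N → ℝ, IsTestFunction Ω φ ∧
    (w none : Space N → ℝ) =ᵐ[volume] φ ∧
    ∀ i : Fin N, (w (some i) : Space N → ℝ) =ᵐ[volume] partialDeriv i φ}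
  zero_mem' := by
    refine ⟨0, ⟨contDiff_const, HasCompactSupport.zero, by simp [tsupport]⟩, ?_, fun i => ?_⟩
    · exact Lp.coeFn_zero ℝ p volume
    · refine (Lp.coeFn_zero ℝ p volume).trans (Eventually.of_forall fun x => ?_)
      simp [partialDeriv]
  add_mem' := by
    rintro a b ⟨φ, hφ, h1, h2⟩ ⟨ψ, hψ, h3, h4⟩
    refine ⟨φ + ψ, ⟨hφ.smooth.add hψ.smooth, hφ.compact.add hψ.compact, ?_⟩, ?_, fun i => ?_⟩
    · exact (tsupport_add φ ψ).trans (union_subset hφ.support hψ.support)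
    · exact (Lp.coeFn_add _ _).trans (h1.add h3)
    · refine (Lp.coeFn_add _ _).trans (((h2 i).add (h4 i)).trans (Eventually.of_forall fun x => ?_))
      simp [partialDeriv, fderiv_add (hφ.smooth.differentiable (by simp) x)
        (hψ.smooth.differentiable (by simp) x)]
  smul_mem' := by
    rintro c a ⟨φ, hφ, h1, h2⟩
    refine ⟨c • φ, ⟨hφ.smooth.const_smul c, hφ.compact.smul_left (f := fun _ => c), ?_⟩, ?_,
      fun i => ?_⟩
    · exact (tsupport_smul_subset_right (fun _ => c) φ).trans hφ.support
    · exact (Lp.coeFn_smul _ _).trans (h1.const_smul c)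
    · refine (Lp.coeFn_smul _ _).trans (((h2 i).const_smul c).trans
        (Eventually.of_forall fun x => ?_))
      simp [partialDeriv, fderiv_const_smul (hφ.smooth.differentiable (by simp) x)]

/-- `W_0^{1,p}(Ω)`: the closure of `C_0^∞(Ω)` in the norm
`(∑ i, ∫ |∂y/∂x_i|^p + ∫ |y|^p)^{1/p}`. -/
def W0 {N : ℕ} (p : ℝ≥0∞) [Fact (1 ≤ p)] (Ω : Set (Space N)) : Submodule ℝ (JetSpace N p) :=
  (testJets p Ω).topologicalClosure

/-- The function underlying an element of `W_0^{1,p}(Ω)`. -/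
def stateFun {N : ℕ} {p : ℝ≥0∞} [Fact (1 ≤ p)] {Ω : Set (Space N)} (y : W0 p Ω) : Space N → ℝ :=
  (y : JetSpace N p) none

/-- The `i`-th weak partial derivative of an element of `W_0^{1,p}(Ω)`. -/
def stateGrad {N : ℕ} {p : ℝ≥0∞} [Fact (1 ≤ p)] {Ω : Set (Space N)} (y : W0 p Ω) (i : Fin N) :
    Space N → ℝ :=
  (y : JetSpace N p) (some i)

/-- Extension by zero embeds `W_0^{1,p}(Ω)` into `W_0^{1,p}(D)` when `Ω ⊆ D`. -/
theorem W0_mono {N : ℕ} (p : ℝ≥0∞) [Fact (1 ≤ p)] {Ω D : Set (Space N)} (h : Ω ⊆ D) :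
    W0 p Ω ≤ W0 p D := by
  refine Submodule.topologicalClosure_mono ?_
  rintro w ⟨φ, hφ, h1⟩
  exact ⟨φ, ⟨hφ.smooth, hφ.compact, hφ.support.trans h⟩, h1⟩

/-- The gradient component is the weak gradient of the function component. -/
theorem integral_stateGrad {N : ℕ} {p q : ℝ≥0∞} [Fact (1 ≤ p)] [Fact (1 ≤ q)]
    [p.HolderConjugate q] {Ω : Set (Space N)} (y : W0 p Ω) (i : Fin N) {φ : Space N → ℝ}
    (hφ : IsTestFunction univ φ) :
    ∫ x, stateFun y x * partialDeriv i φ x = - ∫ x, stateGrad y i x * φ x := by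
  have hd : Continuous (partialDeriv i φ) :=
    (hφ.smooth.continuous_fderiv (by simp)).clm_apply continuous_const
  have hdc : HasCompactSupport (partialDeriv i φ) :=
    hφ.compact.fderiv_apply (𝕜 := ℝ) (EuclideanSpace.single i 1)
  have m1 : MemLp φ q (volume : Measure (Space N)) :=
    hφ.smooth.continuous.memLp_of_hasCompactSupport hφ.compact
  have m2 : MemLp (partialDeriv i φ) q (volume : Measure (Space N)) :=
    hd.memLp_of_hasCompactSupport hdc
  have key : ∀ (f : Lp ℝ p (volume : Measure (Space N))) (h : Space N → ℝ) (hh : MemLp h q volume),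
      ∫ x, f x * h x = (ContinuousLinearMap.mul ℝ ℝ).lpPairing volume p q f hh.toLp := by
    intro f h hh
    rw [ContinuousLinearMap.lpPairing_eq_integral]
    refine integral_congr_ae ?_
    filter_upwards [hh.coeFn_toLp] with x hx
    simp [hx]
  suffices H : ∀ w ∈ W0 p Ω, (∫ x, w none x * partialDeriv i φ x) + ∫ x, w (some i) x * φ x = 0 by
    have := H y y.2
    unfold stateFun stateGrad
    linarith
  intro w hw
  have hcl : IsClosed {w : JetSpace N p |
      (∫ x, w none x * partialDeriv i φ x) + ∫ x, w (some i) x * φ x = 0} := by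
    refine isClosed_eq ?_ continuous_const
    simp only [key _ _ m1, key _ _ m2]
    fun_prop
  refine closure_minimal ?_ hcl hw
  rintro w ⟨ψ, hψ, h1, h2⟩
  have e1 : ∫ x, w none x * partialDeriv i φ x = ∫ x, ψ x * partialDeriv i φ x := by
    refine integral_congr_ae ?_
    filter_upwards [h1] with x hx
    rw [hx]
  have e2 : ∫ x, w (some i) x * φ x = ∫ x, partialDeriv i ψ x * φ x := by
    refine integral_congr_ae ?_
    filter_upwards [h2 i] with x hx
    rw [hx]
  have hdψ : Continuous (partialDeriv i ψ) :=
    (hψ.smooth.continuous_fderiv (by simp)).clm_apply continuous_const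
  have := integral_mul_fderiv_eq_neg_fderiv_mul_of_integrable (μ := (volume : Measure (Space N)))
    (f := ψ) (g := φ) (v := EuclideanSpace.single i 1)
    ((hdψ.mul hφ.smooth.continuous).integrable_of_hasCompactSupport hφ.compact.mul_left)
    ((hψ.smooth.continuous.mul hd).integrable_of_hasCompactSupport hdc.mul_left)
    ((hψ.smooth.continuous.mul hφ.smooth.continuous).integrable_of_hasCompactSupport
      hφ.compact.mul_left)
    (fun x _ => hψ.smooth.differentiable (by simp) x) (fun x _ => hφ.smooth.differentiable (by simp) x)
  show _ + _ = (0 : ℝ)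
  rw [e1, e2]
  unfold partialDeriv
  linarith

/-- `W^{-1,q}(Ω)`, the dual space of `W_0^{1,p}(Ω)`. -/
abbrev WDual {N : ℕ} (p : ℝ≥0∞) [Fact (1 ≤ p)] (Ω : Set (Space N)) := StrongDual ℝ (W0 p Ω)

/-- Weak convergence of a sequence in a normed space. -/
def WeaklyConverges {E : Type*} [NormedAddCommGroup E] [NormedSpace ℝ E] (u : ℕ → E) (a : E) :
    Prop :=
  ∀ ℓ : StrongDual ℝ E, Tendsto (fun k => ℓ (u k)) atTop (𝓝 (ℓ a))

/-! ### Admissible controls -/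

/-- `L^∞(D; ℝ^{N×N})`. -/
abbrev Control {N : ℕ} (D : Set (Space N)) := Matrix (Fin N) (Fin N) (LpOn ∞ D)

/-- The scalar function `t ↦ |t|^{p-2} t`. -/
def signedPow (p : ℝ≥0∞) (t : ℝ) : ℝ := |t| ^ (p.toReal - 2) * t

/-- The class `M_p^{α,β}(D)`: symmetric matrices in `L^∞(D; ℝ^{N×N})` with the conditions of growth,
monotonicity and strong coercivity. -/
structure MemM {N : ℕ} (p : ℝ≥0∞) (α β : ℝ) {D : Set (Space N)} (U : Control D) : Prop where
  symm : U.IsSymm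
  growth : ∀ i j, ∀ᵐ x ∂(volume.restrict D), |U i j x| ≤ β
  monotone : ∀ᵐ x ∂(volume.restrict D), ∀ ζ η : Fin N → ℝ,
    0 ≤ ∑ i, ∑ j, U i j x * (signedPow p (ζ j) - signedPow p (η j)) * (ζ i - η i)
  coercive : ∀ᵐ x ∂(volume.restrict D), ∀ ζ : Fin N → ℝ,
    α * ∑ k, |ζ k| ^ p.toReal ≤ ∑ i, ∑ j, U i j x * signedPow p (ζ j) * ζ i

/-- The set `U_b`: matrices in `M_p^{α,β}(D)` with all entries between `ξ₁` and `ξ₂`. -/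
def Ub {N : ℕ} (p : ℝ≥0∞) (α β : ℝ) {D : Set (Space N)} (ξ₁ ξ₂ : LpOn ∞ D) : Set (Control D) :=
  {U | MemM p α β U ∧ ∀ i j, ∀ᵐ x ∂(volume.restrict D), ξ₁ x ≤ U i j x ∧ U i j x ≤ ξ₂ x}

/-- `ℓ ∈ W^{-1,q}(D)` is the divergence of the vector field `u`:
`⟨ℓ, φ⟩ = - ∫_D (u, ∇φ)` for all `φ ∈ W_0^{1,p}(D)`. -/
def IsDivergence {N : ℕ} {p : ℝ≥0∞} [Fact (1 ≤ p)] {D : Set (Space N)} (u : Fin N → LpOn ∞ D)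
    (ℓ : WDual p D) : Prop :=
  ∀ φ : W0 p D, ℓ φ = - ∫ x in D, ∑ k, u k x * stateGrad φ k x

/-- The set `U_sol`: matrices in `M_p^{α,β}(D)` whose `i`-th column has its divergence in `Q i`. -/
def Usol {N : ℕ} (p : ℝ≥0∞) [Fact (1 ≤ p)] (α β : ℝ) {D : Set (Space N)}
    (Q : Fin N → Set (WDual p D)) : Set (Control D) :=
  {U | MemM p α β U ∧ ∀ i, ∃ ℓ ∈ Q i, IsDivergence (fun k => U k i) ℓ}

/-! ### Operators of Hammerstein type -/

/-- The pairing `⟨w, z⟩` of `w ∈ L^q(Ω)` and `z ∈ L^p(Ω)`. -/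
def pairing {N : ℕ} {p q : ℝ≥0∞} {Ω : Set (Space N)} (w : LpOn q Ω) (z : LpOn p Ω) : ℝ :=
  ∫ x in Ω, w x * z x

/-- Radial continuity of `G : L^p(Ω) → L^q(Ω)`. -/
def RadiallyContinuous {N : ℕ} {p q : ℝ≥0∞} {Ω : Set (Space N)} (G : LpOn p Ω → LpOn q Ω) : Prop :=
  ∀ z₁ z₂ : LpOn p Ω, ∃ ε > (0 : ℝ),
    ContinuousOn (fun τ : ℝ => pairing (G (z₁ + τ • z₂)) z₂) (Icc 0 ε)

/-- A seminorm that is compact with respect to the norm: bounded sets are totally bounded for the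
seminorm. -/
def IsCompactSeminorm {Z : Type*} [NormedAddCommGroup Z] [NormedSpace ℝ Z] (s : Seminorm ℝ Z) :
    Prop :=
  ∀ ε > (0 : ℝ), ∃ t : Set Z, t.Finite ∧ ∀ z : Z, ‖z‖ ≤ 1 → ∃ w ∈ t, s (z - w) < ε

/-- Uniformly semi-bounded variation. The bound by `- inf_{y' ∈ Y₀} C_{y'}` is written as a bound by
`- C_{y'}` for every `y' ∈ Y₀`. -/
def HasUSBV {N : ℕ} {p q : ℝ≥0∞} [Fact (1 ≤ p)] {Ω : Set (Space N)}
    (F : W0 p Ω → LpOn p Ω → LpOn q Ω) : Prop :=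
  ∀ Y₀ : Set (W0 p Ω), Bornology.IsBounded Y₀ →
    ∃ (s : Seminorm ℝ (LpOn p Ω)) (C : W0 p Ω → ℝ → ℝ → ℝ),
      IsCompactSeminorm s ∧
      (∀ y ∈ Y₀, ContinuousOn (fun a : ℝ × ℝ => C y a.1 a.2) (Ici 0 ×ˢ Ici 0) ∧
        ∀ r > (0 : ℝ), Tendsto (fun t => C y r t / t) (𝓝[>] 0) (𝓝 0)) ∧
      ∀ R > (0 : ℝ), ∀ z₁ z₂ : LpOn p Ω, ‖z₁‖ ≤ R → ‖z₂‖ ≤ R → ∀ y ∈ Y₀, ∀ y' ∈ Y₀,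
        - C y' R (s (z₁ - z₂)) ≤ pairing (F y z₁ - F y z₂) (z₁ - z₂)

/-- Compactness of `F` in its first argument: weak convergence in `W_0^{1,p}(Ω)` is mapped to strong
convergence in `L^q(Ω)`. -/
def CompactInState {N : ℕ} {p q : ℝ≥0∞} [Fact (1 ≤ p)] [Fact (1 ≤ q)] {Ω : Set (Space N)}
    (F : W0 p Ω → LpOn p Ω → LpOn q Ω) : Prop :=
  ∀ (z : LpOn p Ω) (y : ℕ → W0 p Ω) (y₀ : W0 p Ω), WeaklyConverges y y₀ →
    Tendsto (fun k => F (y k) z) atTop (𝓝 (F y₀ z))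

/-! ### The optimal control problem -/

/-- Restriction `L^p(D) → L^p(Ω)` for `Ω ⊆ D`. -/
def restrictLp {N : ℕ} {p : ℝ≥0∞} {Ω D : Set (Space N)} (h : Ω ⊆ D) (g : LpOn p D) : LpOn p Ω :=
  ((Lp.memLp g).mono_measure (Measure.restrict_mono h le_rfl)).toLp g

/-- `y ∈ W_0^{1,p}(Ω)` is the weak solution of
`-div(U [(∇y)^{p-2}] ∇y) + |y|^{p-2} y = f` in `Ω`, where `f ∈ W^{-1,q}(D)`. -/
def IsWeakSolution {N : ℕ} {p : ℝ≥0∞} [Fact (1 ≤ p)] {Ω D : Set (Space N)} (h : Ω ⊆ D)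
    (f : WDual p D) (U : Control D) (y : W0 p Ω) : Prop :=
  ∀ v : W0 p Ω,
    (∫ x in Ω, ∑ i, ∑ j, U i j x * signedPow p (stateGrad y j x) * stateGrad v i x)
      + ∫ x in Ω, signedPow p (stateFun y x) * stateFun v x = f (Submodule.inclusion (W0_mono p h) v)

/-- `z + B F(y, z) = g` in `Ω`, in the sense of distributions. -/
def SolvesHammerstein {N : ℕ} {p q : ℝ≥0∞} [Fact (1 ≤ p)] [Fact (1 ≤ q)] {Ω D : Set (Space N)}
    (B : LpOn q Ω →L[ℝ] LpOn p Ω) (F : W0 p Ω → LpOn p Ω → LpOn q Ω) (g : LpOn p D)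
    (y : W0 p Ω) (z : LpOn p Ω) : Prop :=
  ∀ φ : Space N → ℝ, IsTestFunction Ω φ →
    (∫ x in Ω, z x * φ x) + ∫ x in Ω, B (F y z) x * φ x = ∫ x in Ω, g x * φ x

/-- The set `Ξ_sol` of admissible triplets `(U, y, z)`, for a set `Uad` of admissible controls. -/
def admissible {N : ℕ} {p q : ℝ≥0∞} [Fact (1 ≤ p)] [Fact (1 ≤ q)] {Ω D : Set (Space N)}
    (h : Ω ⊆ D) (Uad : Set (Control D)) (B : LpOn q Ω →L[ℝ] LpOn p Ω)
    (F : W0 p Ω → LpOn p Ω → LpOn q Ω) (f : WDual p D) (g : LpOn p D) :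
    Set (Control D × W0 p Ω × LpOn p Ω) :=
  {t | t.1 ∈ Uad ∧ IsWeakSolution h f t.1 t.2.1 ∧ SolvesHammerstein B F g t.2.1 t.2.2}

/-- The cost functional `I_Ω(U, y, z) = ∫_Ω |z - z_d|^p dx`. -/
def cost {N : ℕ} {p : ℝ≥0∞} [Fact (1 ≤ p)] {Ω D : Set (Space N)} (zd : LpOn p D)
    (t : Control D × W0 p Ω × LpOn p Ω) : ℝ :=
  ∫ x in Ω, |t.2.2 x - zd x| ^ p.toReal

end HammersteinOCP

end

namespace HammersteinOCP

/-! The direct method. The state equation and, for a fixed state, the Hammerstein equation are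
solved by Galerkin approximation and Minty's trick: Brouwer's theorem gives a solution against
finitely many test elements, and the semi-bounded variation of `F` replaces monotonicity, because a
compact seminorm turns weak convergence into convergence. Since `F` is defined on all of `L^p(Ω)`
but need not be continuous, the equation `z + B F(y, z) = g` is read as the inclusion
`-F(y, z) ∈ B⁻¹ (z - g)`: the graph of the positive operator `B` is maximal monotone, and
approximations and weak limits of solutions only have to satisfy the variational inequality that
characterises this graph.

Along a minimizing sequence the controls converge weakly, their column divergences strongly (the
sets `Q_i` are compact) and the states weakly. The flux tested against `∇(y_k - v)` is then a
product of two weakly convergent sequences, one with precompact divergence and one of gradients, and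
the div-curl lemma together with Rellich's theorem passes to the limit in it; Minty's trick
identifies the limit equation. The norm of `z - z_d` is weakly lower semicontinuous. -/

/-! ### Zeros of continuous vector fields in finite dimension -/

section Brouwer

open Polynomial

theorem exists_eval_one_eq_sum (d : ℕ) {δ : ℝ} (hδ : 0 < δ) :
    ∃ t c : ℕ → ℝ, (∀ k, t k ∈ Icc 0 δ) ∧ ∀ P : ℝ[X], P.natDegree ≤ d →
      P.eval 1 = ∑ k ∈ Finset.range (d + 1), c k * P.eval (t k) := by
  let t : ℕ → ℝ := fun k => δ / (k + 1)
  have ht : Function.Injective t := fun a b hab => by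
    have h := mul_left_cancel₀ hδ.ne' ((div_eq_div_iff (by positivity) (by positivity)).1 hab)
    exact_mod_cast (add_right_cancel h).symm
  refine ⟨t, fun k => (Lagrange.basis (Finset.range (d + 1)) t k).eval 1,
    fun k => ⟨by positivity, div_le_self hδ.le (by simp)⟩, fun P hP => ?_⟩
  have hdeg : P.degree < (Finset.range (d + 1)).card := by
    rw [Finset.card_range]
    exact degree_le_natDegree.trans_lt (by exact_mod_cast Nat.lt_succ_of_le hP)
  conv_lhs => rw [Lagrange.eq_interpolate (v := t) ht.injOn hdeg]
  simp only [Lagrange.interpolate_apply, eval_finsetSum, eval_mul, eval_C, mul_comm]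

theorem integral_eval_one_eq {α : Type*} [MeasurableSpace α] {μ : Measure α} {F : α → ℝ[X]}
    {d : ℕ} (hd : ∀ x, (F x).natDegree ≤ d) (hF : ∀ s, Integrable (fun x => (F x).eval s) μ)
    {δ V : ℝ} (hδ : 0 < δ) (hV : ∀ s ∈ Icc 0 δ, ∫ x, (F x).eval s ∂μ = V) :
    ∫ x, (F x).eval 1 ∂μ = V := by
  obtain ⟨t, c, ht, hP⟩ := exists_eval_one_eq_sum d hδ
  have hc : ∑ k ∈ Finset.range (d + 1), c k = 1 := by simpa using (hP 1 (by simp)).symm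
  simp only [fun x => hP (F x) (hd x)]
  rw [integral_finsetSum _ fun k _ => (hF (t k)).const_mul _]
  simp only [integral_const_mul, fun k => hV (t k) (ht k), ← Finset.sum_mul, hc, one_mul]

variable {E : Type*} [NormedAddCommGroup E]

section NormedSpace

variable [NormedSpace ℝ E]

theorem exists_polynomial_eval_eq_det [FiniteDimensional ℝ E] (A : E →L[ℝ] E) :
    ∃ P : ℝ[X], P.natDegree ≤ Module.finrank ℝ E ∧
      ∀ s : ℝ, P.eval s = (ContinuousLinearMap.id ℝ E + s • A).det := by
  let b := Module.finBasis ℝ E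
  let M := LinearMap.toMatrix b b (A : E →ₗ[ℝ] E)
  refine ⟨((X : ℝ[X]) • M.map C + (1 : Matrix _ _ ℝ).map C).det, ?_, fun s => ?_⟩
  · simpa using natDegree_det_X_add_C_le M 1
  · have hdet : (ContinuousLinearMap.id ℝ E + s • A).det = (1 + s • M).det := by
      rw [ContinuousLinearMap.det, ← LinearMap.det_toMatrix b]
      simp [M]
    rw [hdet, ← coe_evalRingHom, RingHom.map_det]
    congr 1
    ext i j
    by_cases hij : i = j
    · subst hij
      simp [add_comm, mul_comm s]
    · simp [hij, mul_comm s]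

theorem det_id_add_ne_zero_of_norm_lt_one [CompleteSpace E] {A : E →L[ℝ] E} (hA : ‖A‖ < 1) :
    (ContinuousLinearMap.id ℝ E + A).det ≠ 0 := by
  have hunit : IsUnit (1 - -A) := isUnit_one_sub_of_norm_lt_one (by rwa [norm_neg])
  rw [sub_neg_eq_add] at hunit
  exact ((hunit.map ContinuousLinearMap.toLinearMapRingHom).map LinearMap.det).ne_zero

theorem det_id_add_pos_of_norm_lt_one [FiniteDimensional ℝ E] {A : E →L[ℝ] E} (hA : ‖A‖ < 1) :
    0 < (ContinuousLinearMap.id ℝ E + A).det := by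
  have : CompleteSpace E := FiniteDimensional.complete ℝ E
  by_contra! hle
  have hcont : Continuous fun t : ℝ => (ContinuousLinearMap.id ℝ E + t • A).det :=
    ContinuousLinearMap.continuous_det.comp (by fun_prop)
  obtain ⟨t, ht, h0⟩ : (0 : ℝ) ∈ (fun t : ℝ => (ContinuousLinearMap.id ℝ E + t • A).det) ''
      Icc 0 1 :=
    intermediate_value_Icc' zero_le_one hcont.continuousOn
      ⟨by simpa using hle, by simp [ContinuousLinearMap.det]⟩
  refine det_id_add_ne_zero_of_norm_lt_one ?_ h0
  rw [norm_smul, Real.norm_of_nonneg ht.1]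
  exact (mul_le_of_le_one_left (norm_nonneg _) ht.2).trans_lt hA

theorem bijective_id_add_of_lipschitzWith [CompleteSpace E] {h : E → E} {c : NNReal}
    (hh : LipschitzWith c h) (hc : c < 1) : Function.Bijective fun x => x + h x := by
  have happ : ApproximatesLinearOn (fun x => x + h x)
      (ContinuousLinearEquiv.refl ℝ E : E →L[ℝ] E) univ c := fun x _ y _ => by
    have hxy : x + h x - (y + h y) - (x - y) = h x - h y := by abel
    simpa [hxy] using hh.norm_sub_le x y
  have hlt : Subsingleton E ∨ c < ‖((ContinuousLinearEquiv.refl ℝ E).symm : E →L[ℝ] E)‖₊⁻¹ := by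
    rcases subsingleton_or_nontrivial E with hE | hE
    · exact .inl hE
    · refine .inr ?_
      have h1 : ‖((ContinuousLinearEquiv.refl ℝ E).symm : E →L[ℝ] E)‖₊ = 1 :=
        ContinuousLinearMap.nnnorm_id
      rwa [h1, inv_one]
  exact ⟨injOn_univ.1 (injOn_iff_injective.2 (happ.injective hlt)), happ.surjective hlt⟩

end NormedSpace

theorem image_eq_of_bijective_of_forall_notMem {α : Type*} {G : α → α}
    (hG : Function.Bijective G) {K : Set α} (hK : ∀ x ∉ K, G x = x) : G '' K = K := by
  have hcompl : G '' Kᶜ = Kᶜ := (image_congr (g := id) hK).trans (image_id _)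
  rw [← compl_inj_iff, ← image_compl_eq hG, hcompl]

variable [InnerProductSpace ℝ E] [FiniteDimensional ℝ E]

theorem exists_polynomial_eval_eq_pow_mul_det (M : ℝ) (k : ℕ) (x v : E) (A : E →L[ℝ] E) :
    ∃ P : ℝ[X], P.natDegree ≤ 2 * k + Module.finrank ℝ E ∧ ∀ s : ℝ, P.eval s =
      (M ^ 2 - ‖x + s • v‖ ^ 2) ^ k * (ContinuousLinearMap.id ℝ E + s • A).det := by
  obtain ⟨P, hdeg, hP⟩ := exists_polynomial_eval_eq_det A
  let Q : ℝ[X] := C (-‖v‖ ^ 2) * X ^ 2 + C (-2 * inner ℝ x v) * X + C (M ^ 2 - ‖x‖ ^ 2)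
  refine ⟨Q ^ k * P, ?_, fun s => ?_⟩
  · refine natDegree_mul_le.trans (add_le_add ?_ hdeg)
    rw [mul_comm]
    exact natDegree_pow_le_of_le k natDegree_quadratic_le
  · rw [eval_mul, hP, eval_pow, norm_add_sq_real, norm_smul, mul_pow, Real.norm_eq_abs, sq_abs,
      inner_smul_right]
    simp only [Q, eval_add, eval_mul, eval_C, eval_pow, eval_X]
    ring

variable [MeasurableSpace E] [BorelSpace E]

theorem integral_comp_id_add_mul_det_of_lipschitzWith {h : E → E} (hh : Differentiable ℝ h)
    {c : NNReal} (hlip : LipschitzWith c h) (hc : c < 1) {K : Set E} (hK : MeasurableSet K)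
    (hsupp : ∀ x ∉ K, h x = 0) (q : E → ℝ) :
    ∫ x in K, q (x + h x) * (ContinuousLinearMap.id ℝ E + fderiv ℝ h x).det = ∫ x in K, q x := by
  have hbij := bijective_id_add_of_lipschitzWith hlip hc
  have harea := integral_image_eq_integral_abs_det_fderiv_smul volume hK
    (fun x _ => ((hasFDerivAt_id x).add (hh x).hasFDerivAt).hasFDerivWithinAt) hbij.injective.injOn
    q
  have himage : (id + h) '' K = K :=
    image_eq_of_bijective_of_forall_notMem hbij fun x hx => by simp [hsupp x hx]
  rw [himage] at harea
  rw [harea]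
  refine integral_congr_ae (Eventually.of_forall fun x => ?_)
  have hnorm : ‖fderiv ℝ h x‖ < 1 :=
    (norm_fderiv_le_of_lipschitz ℝ hlip).trans_lt (by exact_mod_cast hc)
  simp [abs_of_pos (det_id_add_pos_of_norm_lt_one hnorm), mul_comm]

/-- The weight is polynomial, so the left side is polynomial in `s` when `h` is replaced by
`s • h`; the identity for small `s`, a change of variables, therefore persists up to `s = 1`. -/
theorem integral_pow_mul_det_id_add_fderiv {h : E → E} (hh : ContDiff ℝ 1 h) {K : Set E}
    (hK : IsCompact K) (hsupp : ∀ x ∉ K, h x = 0) (M : ℝ) (k : ℕ) :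
    ∫ x in K, (M ^ 2 - ‖x + h x‖ ^ 2) ^ k * (ContinuousLinearMap.id ℝ E + fderiv ℝ h x).det =
      ∫ x in K, (M ^ 2 - ‖x‖ ^ 2) ^ k := by
  have hd : Differentiable ℝ h := hh.differentiable one_ne_zero
  have : Continuous (fderiv ℝ h) := hh.continuous_fderiv one_ne_zero
  obtain ⟨c, hc⟩ := ContDiff.lipschitzWith_of_hasCompactSupport
    (HasCompactSupport.intro hK hsupp) hh one_ne_zero
  choose F hdeg hF using fun x =>
    exists_polynomial_eval_eq_pow_mul_det M k x (h x) (fderiv ℝ h x)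
  have hint (s : ℝ) : IntegrableOn (fun x => (F x).eval s) K := by
    simp only [hF]
    refine ContinuousOn.integrableOn_compact hK (Continuous.continuousOn ?_)
    have hcont := hd.continuous
    exact Continuous.mul (by fun_prop) (ContinuousLinearMap.continuous_det.comp (by fun_prop))
  have hsmall (s : ℝ) (hs : s ∈ Icc 0 ((c : ℝ) + 1)⁻¹) :
      ∫ x in K, (F x).eval s = ∫ x in K, (M ^ 2 - ‖x‖ ^ 2) ^ k := by
    have hlip : LipschitzWith (‖s‖₊ * c) fun x => s • h x := (lipschitzWith_smul s).comp hc
    have hlt : ‖s‖₊ * c < 1 := by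
      rw [← NNReal.coe_lt_coe, NNReal.coe_mul, coe_nnnorm, Real.norm_of_nonneg hs.1]
      calc s * c ≤ ((c : ℝ) + 1)⁻¹ * c := by gcongr; exact hs.2
        _ < 1 := by rw [inv_mul_lt_one₀ (by positivity)]; linarith
    rw [← integral_comp_id_add_mul_det_of_lipschitzWith (hd.const_smul s) hlip hlt hK.measurableSet
      (fun x hx => by simp [hsupp x hx]) fun y => (M ^ 2 - ‖y‖ ^ 2) ^ k]
    simp only [hF, Pi.smul_apply, fderiv_const_smul (hd _)]
  have hone := integral_eval_one_eq hdeg hint (by positivity) hsmall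
  simpa only [hF, one_smul] using hone

theorem pow_mul_volume_ball_le_integral {M ρ R : ℝ} (hρR : ρ ≤ R) (hRM : R ≤ M) (k : ℕ) :
    (M ^ 2 - ρ ^ 2) ^ k * volume.real (Metric.ball (0 : E) ρ) ≤
      ∫ x in Metric.closedBall (0 : E) R, (M ^ 2 - ‖x‖ ^ 2) ^ k := by
  rcases le_or_gt ρ 0 with hρ | hρ
  · rw [Metric.ball_eq_empty.2 hρ, measureReal_empty, mul_zero]
    refine setIntegral_nonneg Metric.isClosed_closedBall.measurableSet fun x hx => ?_
    exact pow_nonneg (sub_nonneg.2 (by gcongr; exact (mem_closedBall_zero_iff.1 hx).trans hRM)) k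
  have hint : IntegrableOn (fun x : E => (M ^ 2 - ‖x‖ ^ 2) ^ k) (Metric.closedBall 0 R) :=
    ContinuousOn.integrableOn_compact (isCompact_closedBall _ _) (by fun_prop)
  have hsub : Metric.ball (0 : E) ρ ⊆ Metric.closedBall 0 R :=
    Metric.ball_subset_closedBall.trans (Metric.closedBall_subset_closedBall hρR)
  calc (M ^ 2 - ρ ^ 2) ^ k * volume.real (Metric.ball (0 : E) ρ)
      = ∫ _ in Metric.ball (0 : E) ρ, (M ^ 2 - ρ ^ 2) ^ k := by simp [mul_comm]
    _ ≤ ∫ x in Metric.ball (0 : E) ρ, (M ^ 2 - ‖x‖ ^ 2) ^ k := by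
      refine setIntegral_mono_on (integrableOn_const measure_ball_lt_top.ne) (hint.mono_set hsub)
        Metric.isOpen_ball.measurableSet fun x hx => ?_
      have hxρ := (mem_ball_zero_iff.1 hx).le
      have hρM : 0 ≤ M ^ 2 - ρ ^ 2 := sub_nonneg.2 (by gcongr; exact hρR.trans hRM)
      gcongr
    _ ≤ ∫ x in Metric.closedBall (0 : E) R, (M ^ 2 - ‖x‖ ^ 2) ^ k := by
      refine setIntegral_mono_set hint (ae_restrict_of_forall_mem
        Metric.isClosed_closedBall.measurableSet fun x hx => ?_) hsub.eventuallyLE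
      have hxM : ‖x‖ ≤ M := (mem_closedBall_zero_iff.1 hx).trans hRM
      exact pow_nonneg (sub_nonneg.2 (by gcongr)) k

theorem pow_mul_volume_ball_le_of_eq_self {r : E → E} (hr : ContDiff ℝ 1 r) {ρ c R M : ℝ}
    (hself : ∀ x, R < ‖x‖ → r x = x) (hρR : ρ ≤ R) (hRM : R ≤ M) (hc0 : 0 ≤ c)
    (hc : ∀ x, ‖x‖ ≤ R → c ≤ ‖r x‖) (hM : ∀ x, ‖x‖ ≤ R → ‖r x‖ ≤ M) (k : ℕ) :
    (M ^ 2 - ρ ^ 2) ^ k * volume.real (Metric.ball (0 : E) ρ) ≤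
      (M ^ 2 - c ^ 2) ^ k * ∫ x in Metric.closedBall (0 : E) R, |(fderiv ℝ r x).det| := by
  let K := Metric.closedBall (0 : E) R
  have hK : IsCompact K := isCompact_closedBall _ _
  have hdet : Continuous fun x => (fderiv ℝ r x).det :=
    ContinuousLinearMap.continuous_det.comp (hr.continuous_fderiv one_ne_zero)
  have hcont := hr.continuous
  have hint {φ : E → ℝ} (hφ : Continuous φ) : IntegrableOn φ K :=
    hφ.continuousOn.integrableOn_compact hK
  have hfderiv (x : E) : fderiv ℝ (r - id) x = fderiv ℝ r x - .id ℝ E :=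
    ((hr.differentiable one_ne_zero x).hasFDerivAt.sub (hasFDerivAt_id x)).fderiv
  have hdegree := integral_pow_mul_det_id_add_fderiv (h := r - id) (hr.sub contDiff_id) hK
    (fun x hx => by simp [hself x (by simpa [K] using hx)]) M k
  simp only [hfderiv, add_sub_cancel, Pi.sub_apply, id] at hdegree
  refine (pow_mul_volume_ball_le_integral hρR hRM k).trans ?_
  rw [← integral_const_mul, ← hdegree]
  refine setIntegral_mono_on (hint (by fun_prop)) (hint (by fun_prop)) hK.measurableSet
    fun x hx => ?_
  have hx : ‖x‖ ≤ R := mem_closedBall_zero_iff.1 hx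
  have hpos : 0 ≤ M ^ 2 - ‖r x‖ ^ 2 := sub_nonneg.2 (by gcongr; exact hM x hx)
  have hle : M ^ 2 - ‖r x‖ ^ 2 ≤ M ^ 2 - c ^ 2 := by gcongr; exact hc x hx
  calc (M ^ 2 - ‖r x‖ ^ 2) ^ k * (fderiv ℝ r x).det
      ≤ (M ^ 2 - ‖r x‖ ^ 2) ^ k * |(fderiv ℝ r x).det| := by gcongr; exact le_abs_self _
    _ ≤ (M ^ 2 - c ^ 2) ^ k * |(fderiv ℝ r x).det| := by gcongr

/-- If `r` omits the ball of radius `c`, then the weights `(M ^ 2 - ‖r x‖ ^ 2) ^ k` are of lower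
exponential order, as `k → ∞`, than the weights `(M ^ 2 - ‖x‖ ^ 2) ^ k` near the origin. -/
theorem exists_eq_zero_of_contDiff_of_eq_self {r : E → E} (hr : ContDiff ℝ 1 r) {R : ℝ}
    (hR : 0 < R) (hself : ∀ x, R < ‖x‖ → r x = x) : ∃ x, r x = 0 := by
  by_contra! hne
  have hK : IsCompact (Metric.closedBall (0 : E) R) := isCompact_closedBall _ _
  obtain ⟨c, hc0, hcR, hc⟩ : ∃ c > 0, c ≤ R ∧ ∀ x, ‖x‖ ≤ R → c ≤ ‖r x‖ := by
    obtain ⟨x₀, -, hx₀⟩ := hK.exists_isMinOn ⟨0, by simp [hR.le]⟩ hr.continuous.norm.continuousOn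
    exact ⟨min ‖r x₀‖ R, lt_min (norm_pos_iff.2 (hne x₀)) hR, min_le_right _ _,
      fun x hx => (min_le_left _ _).trans (hx₀ (mem_closedBall_zero_iff.2 hx))⟩
  obtain ⟨M, hRM, hM⟩ : ∃ M, R ≤ M ∧ ∀ x, ‖x‖ ≤ R → ‖r x‖ ≤ M := by
    obtain ⟨B, hB⟩ := hK.exists_bound_of_continuousOn hr.continuous.continuousOn
    exact ⟨max R B, le_max_left _ _,
      fun x hx => (hB x (mem_closedBall_zero_iff.2 hx)).trans (le_max_right _ _)⟩
  let a := M ^ 2 - c ^ 2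
  let b := M ^ 2 - (c / 2) ^ 2
  let D := ∫ x in Metric.closedBall (0 : E) R, |(fderiv ℝ r x).det|
  have ha : 0 ≤ a := sub_nonneg.2 (by gcongr; exact hcR.trans hRM)
  have hab : a < b := sub_lt_sub_left (by gcongr; linarith) _
  have hb : 0 < b := ha.trans_lt hab
  have hbound (k : ℕ) : volume.real (Metric.ball (0 : E) (c / 2)) ≤ (a / b) ^ k * D := by
    rw [div_pow, div_mul_eq_mul_div, le_div_iff₀ (pow_pos hb k), mul_comm]
    exact pow_mul_volume_ball_le_of_eq_self hr hself (by linarith) hRM hc0.le hc hM k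
  have hlim : Tendsto (fun k => (a / b) ^ k * D) atTop (𝓝 0) := by
    simpa using (tendsto_pow_atTop_nhds_zero_of_lt_one (div_nonneg ha hb.le)
      ((div_lt_one hb).2 hab)).mul_const D
  have hvol : 0 < volume.real (Metric.ball (0 : E) (c / 2)) :=
    ENNReal.toReal_pos (Metric.measure_ball_pos _ _ (half_pos hc0)).ne' measure_ball_lt_top.ne
  exact hvol.not_ge (ge_of_tendsto' hlim hbound)

theorem exists_eq_zero_of_continuous_of_eq_self {r : E → E} (hr : Continuous r) {R : ℝ}
    (hR : 0 < R) (hself : ∀ x, R ≤ ‖x‖ → r x = x) : ∃ x, r x = 0 := by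
  by_contra! hne
  obtain ⟨ε, hε, hεr⟩ : ∃ ε > 0, ∀ x, ε ≤ ‖r x‖ := by
    obtain ⟨x₀, -, hx₀⟩ := (isCompact_closedBall (0 : E) R).exists_isMinOn ⟨0, by simp [hR.le]⟩
      hr.norm.continuousOn
    refine ⟨min ‖r x₀‖ R, lt_min (norm_pos_iff.2 (hne x₀)) hR, fun x => ?_⟩
    rcases le_or_gt ‖x‖ R with hx | hx
    · exact (min_le_left _ _).trans (hx₀ (by simpa using hx))
    · exact (min_le_right _ _).trans (by rw [hself x hx.le]; exact hx.le)
  obtain ⟨e, he, hdist, hsupp⟩ := (hr.sub continuous_id).exists_contDiff_approx 1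
    (ε := fun _ => ε) continuous_const fun _ => hε
  obtain ⟨x, hx⟩ : ∃ x, x + e x = 0 :=
    exists_eq_zero_of_contDiff_of_eq_self (contDiff_id.add he) hR fun x hx => by
      have : e x = 0 := by
        by_contra h
        exact hsupp h (by simp [hself x hx.le])
      simp [this]
  refine (hεr x).not_gt ?_
  have hrx : r x = (r x - x) - e x := by rw [eq_neg_of_add_eq_zero_right hx]; abel
  rw [hrx, ← dist_eq_norm, dist_comm]
  exact hdist x

/-- The field is deformed to the identity outside a ball by convex combinations, which keep pointing
outwards and so create no zero. -/
theorem exists_eq_zero_of_inner_pos {T : E → E} (hT : Continuous T) {R : ℝ} (hR0 : 0 < R)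
    (hR : ∀ x, R ≤ ‖x‖ → 0 < inner ℝ (T x) x) : ∃ x, T x = 0 := by
  let l : E → ℝ := fun x => max 0 (min 1 ((‖x‖ - R) / R))
  have hl0 (x : E) : 0 ≤ l x := le_max_left _ _
  have hl1 (x : E) : l x ≤ 1 := max_le zero_le_one (min_le_left _ _)
  have hinner (x : E) (hx : ‖x‖ ≤ R) : l x = 0 :=
    max_eq_left ((min_le_right _ _).trans
      (div_nonpos_of_nonpos_of_nonneg (sub_nonpos.2 hx) hR0.le))
  have houter (x : E) (hx : 2 * R ≤ ‖x‖) : l x = 1 := by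
    have : 1 ≤ (‖x‖ - R) / R := by rw [le_div_iff₀ hR0]; linarith
    simp [l, min_eq_left this]
  obtain ⟨x, hx⟩ := exists_eq_zero_of_continuous_of_eq_self
    (r := fun x => (1 - l x) • T x + l x • x) (by fun_prop) (by positivity : 0 < 2 * R)
    fun x hx => by simp [houter x hx]
  refine ⟨x, ?_⟩
  rcases le_or_gt ‖x‖ R with h | h
  · simpa [hinner x h] using hx
  · have hTx := hR x h.le
    have hxx : 0 < inner ℝ x x := real_inner_self_pos.2 (norm_pos_iff.1 (hR0.trans h))
    have h0 : (1 - l x) * inner ℝ (T x) x + l x * inner ℝ x x = 0 := by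
      rw [← real_inner_smul_left, ← real_inner_smul_left, ← inner_add_left, hx, inner_zero_left]
    rcases (hl1 x).lt_or_eq with hlt | heq
    · nlinarith [mul_pos (sub_pos.2 hlt) hTx, mul_nonneg (hl0 x) hxx.le]
    · simp only [heq, sub_self, zero_mul, one_mul, zero_add] at h0
      exact absurd h0 hxx.ne'

end Brouwer

/-! ### Clarkson's inequality and weak compactness -/

section WeakCompactness

/-- Clarkson's inequality with exponent `r`, a quantitative form of uniform convexity. -/
def ClarksonInequality (X : Type*) [NormedAddCommGroup X] [NormedSpace ℝ X] (r : ℝ) : Prop :=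
  ∀ f g : X, ‖(2⁻¹ : ℝ) • (f + g)‖ ^ r + ‖(2⁻¹ : ℝ) • (f - g)‖ ^ r ≤ (‖f‖ ^ r + ‖g‖ ^ r) / 2

variable {X : Type*} [NormedAddCommGroup X] [NormedSpace ℝ X] {r : ℝ}

theorem ClarksonInequality.submodule (h : ClarksonInequality X r) (S : Submodule ℝ X) :
    ClarksonInequality S r := fun f g => h (f : X) (g : X)

/-- Used with `a n` the values of a functional along a minimising sequence and `m n` lower bounds
for the functional at midpoints. -/
theorem cauchySeq_of_add_norm_rpow_le (hr : 0 < r) {u : ℕ → X} {a m : ℕ → ℝ} {L : ℝ}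
    (ha : Tendsto a atTop (𝓝 L)) (hm : Tendsto m atTop (𝓝 L))
    (h : ∀ n, ∀ k ≥ n, m n + ‖(2⁻¹ : ℝ) • (u k - u n)‖ ^ r ≤ (a k + a n) / 2) : CauchySeq u := by
  refine Metric.cauchySeq_iff'.2 fun ε hε => ?_
  have hη : 0 < (ε / 2) ^ r / 2 := by positivity
  obtain ⟨n, hn⟩ := eventually_atTop.1 ((ha.eventually (gt_mem_nhds (lt_add_of_pos_right L hη))).and
    (hm.eventually (lt_mem_nhds (sub_lt_self L hη))))
  refine ⟨n, fun k hk => ?_⟩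
  have hpow : ‖(2⁻¹ : ℝ) • (u k - u n)‖ ^ r < (ε / 2) ^ r := by
    linarith [h n k hk, (hn k hk).1, (hn n le_rfl).1, (hn n le_rfl).2]
  have hnorm := (Real.rpow_lt_rpow_iff (norm_nonneg _) (by positivity) hr).1 hpow
  rw [norm_smul, Real.norm_of_nonneg (by norm_num)] at hnorm
  rw [dist_eq_norm]
  linarith

/-- Almost minimal elements of the sets form a Cauchy sequence. -/
theorem ClarksonInequality.nonempty_iInter [CompleteSpace X] (hr : 0 < r)
    (h : ClarksonInequality X r) {K : ℕ → Set X} (hanti : Antitone K)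
    (hclosed : ∀ n, IsClosed (K n)) (hconv : ∀ n, Convex ℝ (K n)) {C : ℝ}
    (hC : ∀ n, ∃ x ∈ K n, ‖x‖ ≤ C) : (⋂ n, K n).Nonempty := by
  let d : ℕ → ℝ := fun n => Metric.infDist 0 (K n)
  have hne (n : ℕ) : (K n).Nonempty := (hC n).imp fun _ hx => hx.1
  have hdle (n : ℕ) (x : X) (hx : x ∈ K n) : d n ≤ ‖x‖ := by
    simpa using Metric.infDist_le_dist_of_mem (x := (0 : X)) hx
  have hbdd : BddAbove (range d) := by
    refine ⟨C, forall_mem_range.2 fun n => ?_⟩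
    obtain ⟨x, hx, hxC⟩ := hC n
    exact (hdle n x hx).trans hxC
  have hd : Tendsto d atTop (𝓝 (⨆ n, d n)) := tendsto_atTop_ciSup
    (fun m n hmn => Metric.infDist_le_infDist_of_subset (hanti hmn) (hne n)) hbdd
  have hex (n : ℕ) : ∃ x ∈ K n, ‖x‖ < d n + 1 / ((n : ℝ) + 1) := by
    have hlt : d n < d n + 1 / ((n : ℝ) + 1) := lt_add_of_pos_right _ Nat.one_div_pos_of_nat
    simpa only [dist_zero_left] using (Metric.infDist_lt_iff (hne n)).1 hlt
  choose u huK hu using hex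
  have hnorm : Tendsto (fun n => ‖u n‖) atTop (𝓝 (⨆ n, d n)) := by
    refine tendsto_of_tendsto_of_tendsto_of_le_of_le hd (h := fun n => d n + 1 / ((n : ℝ) + 1)) ?_
      (fun n => hdle n _ (huK n)) fun n => (hu n).le
    simpa using hd.add (tendsto_one_div_add_atTop_nhds_zero_nat (𝕜 := ℝ))
  have hcauchy : CauchySeq u := by
    refine cauchySeq_of_add_norm_rpow_le hr (hnorm.rpow_const (Or.inr hr.le))
      (hd.rpow_const (Or.inr hr.le)) fun n k hk => ?_
    have hmid : (2⁻¹ : ℝ) • (u k + u n) ∈ K n := by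
      rw [smul_add]
      exact hconv n (hanti hk (huK k)) (huK n) (by norm_num) (by norm_num) (by norm_num)
    have hpow : d n ^ r ≤ ‖(2⁻¹ : ℝ) • (u k + u n)‖ ^ r :=
      Real.rpow_le_rpow Metric.infDist_nonneg (hdle n _ hmid) hr.le
    linarith [h (u k) (u n)]
  obtain ⟨a, ha⟩ := cauchySeq_tendsto_of_complete hcauchy
  refine ⟨a, mem_iInter.2 fun n => (hclosed n).mem_of_tendsto ha ?_⟩
  filter_upwards [eventually_ge_atTop n] with m hm
  exact hanti hm (huK m)

theorem bddBelow_range_norm_rpow_sub (hr : 1 < r) (ℓ : StrongDual ℝ X) :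
    BddBelow (range fun f : X => ‖f‖ ^ r - r * ℓ f) := by
  have hconj : r.HolderConjugate (Real.conjExponent r) := .conjExponent hr
  refine ⟨-(r * (‖ℓ‖ ^ Real.conjExponent r / Real.conjExponent r)), forall_mem_range.2 fun f => ?_⟩
  have hyoung := Real.young_inequality_of_nonneg (norm_nonneg f) (norm_nonneg ℓ) hconj
  have hle : ℓ f ≤ ‖f‖ * ‖ℓ‖ := (le_abs_self _).trans ((ℓ.le_opNorm f).trans (mul_comm _ _).le)
  have hmul := mul_le_mul_of_nonneg_left (hle.trans hyoung) (by linarith : 0 ≤ r)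
  rw [mul_add, mul_div_cancel₀ _ (by linarith)] at hmul
  linarith

theorem ClarksonInequality.exists_forall_norm_rpow_sub_le [CompleteSpace X] (hr : 1 < r)
    (h : ClarksonInequality X r) (ℓ : StrongDual ℝ X) :
    ∃ f : X, ∀ g : X, ‖f‖ ^ r - r * ℓ f ≤ ‖g‖ ^ r - r * ℓ g := by
  let J : X → ℝ := fun f => ‖f‖ ^ r - r * ℓ f
  have hbdd : BddBelow (range J) := bddBelow_range_norm_rpow_sub hr ℓ
  have hJ : Continuous J :=
    (continuous_norm.rpow_const fun _ => Or.inr (by linarith)).sub (ℓ.continuous.const_mul r)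
  obtain ⟨v, -, hv, hmem⟩ := exists_seq_tendsto_sInf (range_nonempty J) hbdd
  choose u hu using hmem
  have hmin (g : X) : sInf (range J) ≤ J g := csInf_le hbdd (mem_range_self g)
  have hcauchy : CauchySeq u := by
    refine cauchySeq_of_add_norm_rpow_le (by linarith : 0 < r) hv tendsto_const_nhds
      fun n k _ => ?_
    have hmid := hmin ((2⁻¹ : ℝ) • (u k + u n))
    have hlin : ℓ ((2⁻¹ : ℝ) • (u k + u n)) = 2⁻¹ * (ℓ (u k) + ℓ (u n)) := by simp [mul_add]
    simp only [J, hlin, ← hu] at hmid ⊢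
    linarith [h (u k) (u n)]
  obtain ⟨f, hf⟩ := cauchySeq_tendsto_of_complete hcauchy
  refine ⟨f, fun g => (tendsto_nhds_unique ((hJ.tendsto f).comp hf) ?_).trans_le (hmin g)⟩
  simpa only [Function.comp_def, hu] using hv

theorem exists_tendsto_apply_subseq [TopologicalSpace.SeparableSpace X] {φ : ℕ → StrongDual ℝ X}
    {C : ℝ} (hφ : ∀ n, ‖φ n‖ ≤ C) :
    ∃ (a : StrongDual ℝ X) (k : ℕ → ℕ), StrictMono k ∧
      ∀ x, Tendsto (fun n => φ (k n) x) atTop (𝓝 (a x)) := by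
  obtain ⟨a, -, k, hk, ha⟩ := WeakDual.isSeqCompact_closedBall ℝ X 0 C
    (x := fun n => StrongDual.toWeakDual (φ n)) (fun n => by simpa using hφ n)
  exact ⟨WeakDual.toStrongDual a, k, hk, fun x => ((WeakDual.eval_continuous x).tendsto a).comp ha⟩

/-- A subsequence converges weak-* in the bidual, and the intersection of the closed convex hulls of
its tails represents the limit. -/
theorem ClarksonInequality.exists_weaklyConverges_subseq [CompleteSpace X]
    [TopologicalSpace.SeparableSpace (StrongDual ℝ X)] (hr : 0 < r) (h : ClarksonInequality X r)
    {x : ℕ → X} {C : ℝ} (hx : ∀ n, ‖x n‖ ≤ C) :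
    ∃ (a : X) (k : ℕ → ℕ), StrictMono k ∧ WeaklyConverges (fun n => x (k n)) a := by
  obtain ⟨Λ, k, hk, hΛ⟩ := exists_tendsto_apply_subseq
    (φ := fun n => NormedSpace.inclusionInDoubleDual ℝ X (x n)) fun n =>
      (NormedSpace.double_dual_bound ℝ X (x n)).trans (hx n)
  let K : ℕ → Set X := fun n => closure (convexHull ℝ ((fun m => x (k m)) '' Ici n))
  obtain ⟨a, ha⟩ := h.nonempty_iInter hr (K := K) (C := C)
    (fun m n hmn => closure_mono (convexHull_mono (image_mono (Ici_subset_Ici.2 hmn))))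
    (fun n => isClosed_closure) (fun n => (convex_convexHull ℝ _).closure)
    fun n => ⟨x (k n), subset_closure (subset_convexHull ℝ _ ⟨n, self_mem_Ici, rfl⟩), hx _⟩
  rw [mem_iInter] at ha
  refine ⟨a, k, hk, fun ℓ => ?_⟩
  have hℓ : Tendsto (fun n => ℓ (x (k n))) atTop (𝓝 (Λ ℓ)) := hΛ ℓ
  suffices ℓ a = Λ ℓ by rwa [this]
  refine eq_of_forall_dist_le fun ε hε => ?_
  obtain ⟨n, hn⟩ := eventually_atTop.1 (hℓ.eventually (Metric.closedBall_mem_nhds (Λ ℓ) hε))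
  have hsub : K n ⊆ ℓ ⁻¹' Metric.closedBall (Λ ℓ) ε :=
    closure_minimal (convexHull_min (image_subset_iff.2 hn)
      ((convex_closedBall (Λ ℓ) ε).linear_preimage ℓ.toLinearMap))
      (Metric.isClosed_closedBall.preimage ℓ.continuous)
  exact hsub (ha n)

namespace WeaklyConverges

variable {u : ℕ → X} {a : X}

theorem of_tendsto (h : Tendsto u atTop (𝓝 a)) : WeaklyConverges u a :=
  fun ℓ => (ℓ.continuous.tendsto a).comp h

theorem comp_strictMono (h : WeaklyConverges u a) {k : ℕ → ℕ} (hk : StrictMono k) :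
    WeaklyConverges (fun n => u (k n)) a :=
  fun ℓ => (h ℓ).comp hk.tendsto_atTop

theorem map {Y : Type*} [NormedAddCommGroup Y] [NormedSpace ℝ Y] (h : WeaklyConverges u a)
    (L : X →L[ℝ] Y) : WeaklyConverges (fun n => L (u n)) (L a) :=
  fun ℓ => h (ℓ.comp L)

theorem sub_const (h : WeaklyConverges u a) (b : X) : WeaklyConverges (fun n => u n - b) (a - b) :=
  fun ℓ => by simpa only [map_sub] using (h ℓ).sub_const (ℓ b)

theorem norm_le_of_tendsto (h : WeaklyConverges u a) {b : ℕ → ℝ} {c : ℝ} (hb : ∀ n, ‖u n‖ ≤ b n)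
    (hc : Tendsto b atTop (𝓝 c)) : ‖a‖ ≤ c := by
  obtain ⟨ℓ, hℓ, hℓa⟩ := exists_dual_vector'' ℝ a
  have hnorm : ℓ a = ‖a‖ := by simpa using hℓa
  rw [← hnorm]
  refine le_of_tendsto_of_tendsto' (h ℓ) hc fun n => ?_
  calc ℓ (u n) ≤ ‖ℓ‖ * ‖u n‖ := (le_abs_self _).trans (ℓ.le_opNorm _)
    _ ≤ ‖u n‖ := mul_le_of_le_one_left (norm_nonneg _) hℓ
    _ ≤ b n := hb n

theorem exists_norm_le (h : WeaklyConverges u a) : ∃ C, ∀ n, ‖u n‖ ≤ C := by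
  obtain ⟨C, hC⟩ := banach_steinhaus (g := fun n => NormedSpace.inclusionInDoubleDual ℝ X (u n))
    fun ℓ => by
      obtain ⟨M, hM⟩ := (Metric.isBounded_range_of_tendsto _ (h ℓ)).exists_norm_le
      exact ⟨M, fun n => hM _ ⟨n, rfl⟩⟩
  exact ⟨C, fun n => ((NormedSpace.inclusionInDoubleDualLi ℝ).norm_map (u n)).symm.trans_le (hC n)⟩

theorem tendsto_apply (h : WeaklyConverges u a) {φ : ℕ → StrongDual ℝ X} {ψ : StrongDual ℝ X}
    (hφ : Tendsto φ atTop (𝓝 ψ)) : Tendsto (fun n => φ n (u n)) atTop (𝓝 (ψ a)) := by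
  obtain ⟨C, hC⟩ := h.exists_norm_le
  have hzero : Tendsto (fun n => ‖φ n - ψ‖ * C) atTop (𝓝 0) := by
    simpa only [zero_mul] using (tendsto_iff_norm_sub_tendsto_zero.1 hφ).mul_const C
  have hsub : Tendsto (fun n => (φ n - ψ) (u n)) atTop (𝓝 0) :=
    squeeze_zero_norm (fun n => (φ n - ψ).le_opNorm_of_le (hC n)) hzero
  simpa using hsub.add (h ψ)

theorem of_subseq (h : ∀ k : ℕ → ℕ, StrictMono k → ∃ m : ℕ → ℕ, StrictMono m ∧
    WeaklyConverges (fun n => u (k (m n))) a) : WeaklyConverges u a := fun ℓ => by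
  refine tendsto_of_subseq_tendsto fun ns hns => ?_
  obtain ⟨k, -, hk⟩ := strictMono_subseq_of_tendsto_atTop hns
  obtain ⟨m, -, hw⟩ := h (ns ∘ k) hk
  exact ⟨k ∘ m, hw ℓ⟩

end WeaklyConverges

end WeakCompactness

/-! ### The function `t ↦ |t|^{p-2} t` -/

section SignedPow

variable {p q : ℝ≥0∞}

theorem ne_top_of_one_lt_toReal (hp : 1 < p.toReal) : p ≠ ∞ :=
  (ENNReal.toReal_pos_iff.1 (zero_lt_one.trans hp)).2.ne

theorem ne_zero_of_one_lt_toReal (hp : 1 < p.toReal) : p ≠ 0 :=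
  (ENNReal.toReal_pos_iff.1 (zero_lt_one.trans hp)).1.ne'

theorem conjExponent_ne_top [p.HolderConjugate q] (hp : 1 < p.toReal) : q ≠ ∞ := by
  rw [Ne, ENNReal.HolderConjugate.eq_top_iff_eq_one q p]
  rintro rfl
  exact absurd hp (by simp)

theorem holderConjugate_toReal [p.HolderConjugate q] (hp : 1 < p.toReal) :
    p.toReal.HolderConjugate q.toReal := by
  refine Real.holderConjugate_iff.2 ⟨hp, ?_⟩
  rw [← ENNReal.toReal_inv, ← ENNReal.toReal_inv, ← ENNReal.toReal_add,
    ENNReal.HolderConjugate.inv_add_inv_eq_one p q, ENNReal.toReal_one]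
  · simpa using ENNReal.HolderConjugate.ne_zero p q
  · simpa using ENNReal.HolderConjugate.ne_zero q p

theorem abs_signedPow (hp : 1 < p.toReal) (t : ℝ) : |signedPow p t| = |t| ^ (p.toReal - 1) := by
  rw [signedPow, abs_mul, abs_of_nonneg (by positivity)]
  rcases eq_or_ne t 0 with rfl | ht
  · rw [abs_zero, mul_zero, Real.zero_rpow (by linarith)]
  · rw [← Real.rpow_add_one (abs_ne_zero.2 ht)]
    ring_nf

theorem signedPow_mul_self (hp : 1 < p.toReal) (t : ℝ) : signedPow p t * t = |t| ^ p.toReal := by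
  rcases eq_or_ne t 0 with rfl | ht
  · rw [abs_zero, mul_zero, Real.zero_rpow (by linarith)]
  · rw [signedPow, mul_assoc, ← abs_mul_abs_self t, ← mul_assoc,
      ← Real.rpow_add_one (abs_ne_zero.2 ht), ← Real.rpow_add_one (abs_ne_zero.2 ht)]
    ring_nf

/-- For `p < 2` the factor `|t|^{p-2}` is discontinuous at `0`, so continuity is read off positive
and negative parts. -/
theorem continuous_signedPow (hp : 1 < p.toReal) : Continuous (signedPow p) := by
  have heq (t : ℝ) : signedPow p t = max t 0 ^ (p.toReal - 1) - max (-t) 0 ^ (p.toReal - 1) := by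
    have h0 : (0 : ℝ) ^ (p.toReal - 1) = 0 := Real.zero_rpow (by linarith)
    rcases le_total 0 t with ht | ht
    · have hpos : 0 ≤ signedPow p t := mul_nonneg (by positivity) ht
      rw [max_eq_left ht, max_eq_right (neg_nonpos.2 ht), h0, sub_zero, ← abs_of_nonneg hpos,
        abs_signedPow hp, abs_of_nonneg ht]
    · have hneg : signedPow p t ≤ 0 := mul_nonpos_of_nonneg_of_nonpos (by positivity) ht
      rw [max_eq_right ht, max_eq_left (neg_nonneg.2 ht), h0, zero_sub, ← abs_of_nonpos ht,
        ← abs_signedPow hp, abs_of_nonpos hneg, neg_neg]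
  rw [funext heq]
  exact ((continuous_id.max continuous_const).rpow_const fun _ => Or.inr (by linarith)).sub
    ((continuous_neg.max continuous_const).rpow_const fun _ => Or.inr (by linarith))

/-- The tangent inequality of the convex function `t ↦ |t|^p`, a form of Young's inequality. -/
theorem abs_rpow_add_signedPow_mul_le (hp : 1 < p.toReal) (a b : ℝ) :
    |b| ^ p.toReal + p.toReal * (signedPow p b * (a - b)) ≤ |a| ^ p.toReal := by
  set r := p.toReal
  have hconj : r.HolderConjugate (Real.conjExponent r) := .conjExponent hp
  have hpow : (|b| ^ (r - 1)) ^ Real.conjExponent r = |b| ^ r := by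
    rw [← Real.rpow_mul (abs_nonneg _), hconj.sub_one_mul_conj]
  have hyoung : signedPow p b * a ≤ |a| ^ r / r + |b| ^ r / Real.conjExponent r :=
    calc signedPow p b * a ≤ |a| * |b| ^ (r - 1) := by
          rw [← abs_signedPow hp b, mul_comm, ← abs_mul]
          exact le_abs_self _
      _ ≤ |a| ^ r / r + (|b| ^ (r - 1)) ^ Real.conjExponent r / Real.conjExponent r :=
          Real.young_inequality_of_nonneg (abs_nonneg _) (by positivity) hconj
      _ = |a| ^ r / r + |b| ^ r / Real.conjExponent r := by rw [hpow]
  have hdiv : |b| ^ r / Real.conjExponent r = |b| ^ r * (1 - r⁻¹) := by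
    rw [div_eq_mul_inv, ← hconj.inv_add_inv_eq_one, add_sub_cancel_left]
  have hr : 0 < r := zero_lt_one.trans hp
  have hmul : r * (signedPow p b * a) ≤ |a| ^ r + (r - 1) * |b| ^ r := by
    refine (mul_le_mul_of_nonneg_left hyoung hr.le).trans_eq ?_
    rw [hdiv]
    field_simp
  rw [mul_sub (signedPow p b), signedPow_mul_self hp b]
  linarith

theorem signedPow_sub_mul_sub_nonneg (hp : 1 < p.toReal) (a b : ℝ) :
    0 ≤ (signedPow p a - signedPow p b) * (a - b) := by
  refine nonneg_of_mul_nonneg_right (a := p.toReal) ?_ (zero_lt_one.trans hp)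
  linarith [abs_rpow_add_signedPow_mul_le hp a b, abs_rpow_add_signedPow_mul_le hp b a]

/-- Superadditivity of `t ↦ t^{r/2}` on squares, the parallelogram law, and convexity of
`t ↦ t^{r/2}`. -/
theorem clarkson_real {r : ℝ} (hr : 2 ≤ r) (a b : ℝ) :
    |2⁻¹ * (a + b)| ^ r + |2⁻¹ * (a - b)| ^ r ≤ (|a| ^ r + |b| ^ r) / 2 := by
  have hsq (t : ℝ) : |t| ^ r = (t ^ 2) ^ (r / 2) := by
    rw [← sq_abs, ← Real.rpow_two, ← Real.rpow_mul (abs_nonneg _)]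
    ring_nf
  simp only [hsq]
  have hr2 : 1 ≤ r / 2 := by linarith
  calc ((2⁻¹ * (a + b)) ^ 2) ^ (r / 2) + ((2⁻¹ * (a - b)) ^ 2) ^ (r / 2)
      ≤ ((2⁻¹ * (a + b)) ^ 2 + (2⁻¹ * (a - b)) ^ 2) ^ (r / 2) :=
        Real.add_rpow_le_rpow_add (sq_nonneg _) (sq_nonneg _) hr2
    _ = ((1 / 2 : ℝ) • a ^ 2 + (1 / 2 : ℝ) • b ^ 2) ^ (r / 2) := by
        simp only [smul_eq_mul]
        ring_nf
    _ ≤ (1 / 2 : ℝ) • (a ^ 2) ^ (r / 2) + (1 / 2 : ℝ) • (b ^ 2) ^ (r / 2) :=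
        (convexOn_rpow hr2).2 (sq_nonneg a) (sq_nonneg b) (by norm_num) (by norm_num) (by norm_num)
    _ = ((a ^ 2) ^ (r / 2) + (b ^ 2) ^ (r / 2)) / 2 := by
        simp only [smul_eq_mul]
        ring

end SignedPow

/-! ### The spaces `L^p` -/

section LpSpaces

variable {α : Type*} [MeasurableSpace α] {μ : Measure α} {p q : ℝ≥0∞}

theorem integrable_abs_rpow (hp : 1 < p.toReal) {f : α → ℝ} (hf : MemLp f p μ) :
    Integrable (fun x => |f x| ^ p.toReal) μ :=
  hf.integrable_norm_rpow (ne_zero_of_one_lt_toReal hp) (ne_top_of_one_lt_toReal hp)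

theorem norm_rpow_eq_integral (hp : 1 < p.toReal) (f : Lp ℝ p μ) :
    ‖f‖ ^ p.toReal = ∫ x, |f x| ^ p.toReal ∂μ := by
  have hnonneg : 0 ≤ ∫ x, ‖f x‖ ^ p.toReal ∂μ := integral_nonneg fun x => by positivity
  rw [Lp.norm_def, (Lp.memLp f).eLpNorm_eq_integral_rpow_norm (ne_zero_of_one_lt_toReal hp)
    (ne_top_of_one_lt_toReal hp), ENNReal.toReal_ofReal (Real.rpow_nonneg hnonneg _),
    Real.rpow_inv_rpow hnonneg (zero_lt_one.trans hp).ne']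
  rfl

theorem clarksonInequality_Lp [Fact (1 ≤ p)] (hp : 2 ≤ p.toReal) :
    ClarksonInequality (Lp ℝ p μ) p.toReal := by
  intro f g
  have hp1 : 1 < p.toReal := one_lt_two.trans_le hp
  have hint (f : Lp ℝ p μ) : Integrable (fun x => |f x| ^ p.toReal) μ :=
    integrable_abs_rpow hp1 (Lp.memLp f)
  simp only [norm_rpow_eq_integral hp1]
  rw [← integral_add (hint _) (hint _), ← integral_add (hint _) (hint _), ← integral_div]
  refine integral_mono_ae ((hint _).add (hint _)) (((hint _).add (hint _)).div_const _) ?_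
  filter_upwards [Lp.coeFn_smul (2⁻¹ : ℝ) (f + g), Lp.coeFn_smul (2⁻¹ : ℝ) (f - g),
    Lp.coeFn_add f g, Lp.coeFn_sub f g] with x h₁ h₂ h₃ h₄
  simp only [h₁, h₂, h₃, h₄, Pi.smul_apply, Pi.add_apply, Pi.sub_apply, smul_eq_mul]
  exact clarkson_real hp _ _

theorem clarksonInequality_piLp {ι : Type*} [Fintype ι] [Fact (1 ≤ p)] (hp : 0 < p.toReal)
    {X : Type*} [NormedAddCommGroup X] [NormedSpace ℝ X] (hX : ClarksonInequality X p.toReal) :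
    ClarksonInequality (PiLp p fun _ : ι => X) p.toReal := by
  have hnorm (f : PiLp p fun _ : ι => X) : ‖f‖ ^ p.toReal = ∑ i, ‖f i‖ ^ p.toReal := by
    rw [PiLp.norm_eq_sum hp, one_div, Real.rpow_inv_rpow (by positivity) hp.ne']
  intro f g
  simp only [hnorm]
  rw [← Finset.sum_add_distrib, ← Finset.sum_add_distrib, Finset.sum_div]
  exact Finset.sum_le_sum fun i _ => hX (f i) (g i)

theorem memLp_signedPow [p.HolderConjugate q] (hp : 1 < p.toReal) {f : α → ℝ} (hf : MemLp f p μ) :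
    MemLp (fun x => signedPow p (f x)) q μ := by
  have htop := ne_top_of_one_lt_toReal hp
  have hone : 1 < p := by rwa [← ENNReal.toReal_lt_toReal ENNReal.one_ne_top htop]
  have hsub : (p - 1).toReal = p.toReal - 1 := by
    rw [ENNReal.toReal_sub_of_le hone.le htop, ENNReal.toReal_one]
  have hdiv : p / (p - 1) = q := by
    rw [← ENNReal.toReal_eq_toReal_iff' (ENNReal.div_ne_top htop (tsub_pos_of_lt hone).ne')
      (conjExponent_ne_top hp), ENNReal.toReal_div, hsub,
      (holderConjugate_toReal (q := q) hp).conjugate_eq]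
  have hpow := hf.norm_rpow_div (p - 1)
  rw [hdiv, hsub] at hpow
  refine hpow.mono ((continuous_signedPow hp).comp_aestronglyMeasurable hf.1)
    (Eventually.of_forall fun x => ?_)
  rw [Real.norm_eq_abs, abs_signedPow hp]
  exact le_abs_self _

/-- The map `f ↦ |f|^{p-2} f` from `L^p` to the dual exponent space `L^q`. -/
noncomputable def powLp (q : ℝ≥0∞) [p.HolderConjugate q] (hp : 1 < p.toReal) (f : Lp ℝ p μ) :
    Lp ℝ q μ :=
  (memLp_signedPow hp (Lp.memLp f)).toLp

theorem powLp_coeFn [p.HolderConjugate q] (hp : 1 < p.toReal) (f : Lp ℝ p μ) :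
    powLp q hp f =ᵐ[μ] fun x => signedPow p (f x) :=
  MemLp.coeFn_toLp _

theorem continuous_integral_signedPow (q : ℝ≥0∞) [p.HolderConjugate q] (hp : 1 < p.toReal)
    {f v w : α → ℝ} (hf : MemLp f p μ) (hv : MemLp v p μ) (hw : MemLp w p μ) :
    Continuous fun t : ℝ => ∫ x, signedPow p (f x + t * v x) * w x ∂μ := by
  have hcont := continuous_signedPow hp
  refine continuous_iff_continuousAt.2 fun t₀ => ?_
  obtain ⟨T, hT⟩ : ∃ T, |t₀| < T := exists_gt _
  have hdom : Integrable (fun x => signedPow p (|f x| + T * |v x|) * w x) μ :=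
    (memLp_signedPow (q := q) hp (hf.abs.add (hv.abs.const_mul T))).integrable_mul hw
  have hnear : ∀ᶠ t in 𝓝 t₀, |t| < T := continuous_abs.continuousAt.eventually (gt_mem_nhds hT)
  refine continuousAt_of_dominated (Eventually.of_forall fun t => ?_)
    (hnear.mono fun t ht => Eventually.of_forall fun x => ?_) hdom.norm
    (Eventually.of_forall fun x => ?_)
  · exact (hcont.comp_aestronglyMeasurable (hf.1.add (hv.1.const_mul t))).mul hw.1
  · rw [norm_mul, norm_mul]
    refine mul_le_mul_of_nonneg_right ?_ (norm_nonneg _)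
    rw [Real.norm_eq_abs, Real.norm_eq_abs, abs_signedPow hp, abs_signedPow hp]
    refine Real.rpow_le_rpow (abs_nonneg _) ?_ (by linarith)
    calc |f x + t * v x| ≤ |f x| + |t| * |v x| := (abs_add_le _ _).trans_eq (by rw [abs_mul])
      _ ≤ |f x| + T * |v x| := by gcongr
      _ ≤ |(|f x| + T * |v x|)| := le_abs_self _
  · fun_prop

variable [Fact (1 ≤ p)] [Fact (1 ≤ q)] [p.HolderConjugate q]

/-- The pairing of `L^q` with `L^p` as a map into the dual space of `L^p`. -/
noncomputable def toDualLp (μ : Measure α) (p q : ℝ≥0∞) [Fact (1 ≤ p)] [Fact (1 ≤ q)]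
    [p.HolderConjugate q] : Lp ℝ q μ →L[ℝ] StrongDual ℝ (Lp ℝ p μ) :=
  (ContinuousLinearMap.mul ℝ ℝ).lpPairing μ q p

theorem toDualLp_apply (w : Lp ℝ q μ) (z : Lp ℝ p μ) : toDualLp μ p q w z = ∫ x, w x * z x ∂μ :=
  ContinuousLinearMap.lpPairing_eq_integral _ w z

theorem continuous_toDualLp_powLp (hp : 1 < p.toReal) (f v w : Lp ℝ p μ) :
    Continuous fun t : ℝ => toDualLp μ p q (powLp q hp (f + t • v)) w := by
  refine (continuous_integral_signedPow q hp (Lp.memLp f) (Lp.memLp v) (Lp.memLp w)).congr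
    fun t => ?_
  rw [toDualLp_apply]
  refine integral_congr_ae ?_
  filter_upwards [powLp_coeFn (q := q) hp (f + t • v), Lp.coeFn_add f (t • v),
    Lp.coeFn_smul t v] with x h₁ h₂ h₃
  rw [h₁, h₂, Pi.add_apply, h₃, Pi.smul_apply, smul_eq_mul]

theorem norm_rpow_add_toDualLp_powLp_le (hp : 1 < p.toReal) (f g : Lp ℝ p μ) :
    ‖g‖ ^ p.toReal + p.toReal * toDualLp μ p q (powLp q hp g) (f - g) ≤ ‖f‖ ^ p.toReal := by
  have hint (f : Lp ℝ p μ) : Integrable (fun x => |f x| ^ p.toReal) μ :=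
    integrable_abs_rpow hp (Lp.memLp f)
  have hmul : Integrable (fun x => p.toReal * (powLp q hp g x * (f - g) x)) μ :=
    ((Lp.memLp (powLp q hp g)).integrable_mul (Lp.memLp (f - g))).const_mul _
  rw [norm_rpow_eq_integral hp, norm_rpow_eq_integral hp, toDualLp_apply, ← integral_const_mul,
    ← integral_add (hint _) hmul]
  refine integral_mono_ae ((hint _).add hmul) (hint _) ?_
  filter_upwards [powLp_coeFn (q := q) hp g, Lp.coeFn_sub f g] with x h₁ h₂
  rw [h₁, h₂]
  exact abs_rpow_add_signedPow_mul_le hp _ _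

/-- The Euler–Lagrange equation of `‖f‖ ^ p / p - ℓ f`. -/
theorem toDualLp_powLp_eq_of_forall_le (hp : 1 < p.toReal) {ℓ : StrongDual ℝ (Lp ℝ p μ)}
    {f : Lp ℝ p μ}
    (hf : ∀ g, ‖f‖ ^ p.toReal - p.toReal * ℓ f ≤ ‖g‖ ^ p.toReal - p.toReal * ℓ g) :
    toDualLp μ p q (powLp q hp f) = ℓ := by
  have hle (v : Lp ℝ p μ) : ℓ v ≤ toDualLp μ p q (powLp q hp f) v := by
    have hlim := (continuous_toDualLp_powLp (q := q) hp f v v).tendsto 0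
    rw [zero_smul, add_zero] at hlim
    refine ge_of_tendsto (hlim.mono_left (nhdsWithin_le_nhds (s := Ioi 0))) ?_
    filter_upwards [self_mem_nhdsWithin] with t (ht : 0 < t)
    have htangent := norm_rpow_add_toDualLp_powLp_le (q := q) hp f (f + t • v)
    have hmin := hf (f + t • v)
    rw [sub_add_cancel_left, map_neg, map_smul, smul_eq_mul] at htangent
    rw [map_add, map_smul, smul_eq_mul] at hmin
    refine le_of_mul_le_mul_left ?_ (mul_pos (zero_lt_one.trans hp) ht)
    linarith
  refine ContinuousLinearMap.ext fun v => le_antisymm ?_ (hle v)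
  simpa only [map_neg, neg_le_neg_iff] using hle (-v)

theorem toDualLp_surjective (hp : 2 ≤ p.toReal) : Function.Surjective (toDualLp μ p q) := fun ℓ =>
  have hp1 : 1 < p.toReal := one_lt_two.trans_le hp
  have ⟨f, hf⟩ := (clarksonInequality_Lp hp).exists_forall_norm_rpow_sub_le hp1 ℓ
  ⟨powLp q hp1 f, toDualLp_powLp_eq_of_forall_le hp1 hf⟩

theorem exists_weaklyConverges_subseq_Lp (q : ℝ≥0∞) [Fact (1 ≤ q)] [p.HolderConjugate q]
    [SecondCountableTopology (Lp ℝ q μ)] (hp : 2 ≤ p.toReal) {z : ℕ → Lp ℝ p μ} {C : ℝ}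
    (hz : ∀ n, ‖z n‖ ≤ C) :
    ∃ (a : Lp ℝ p μ) (k : ℕ → ℕ), StrictMono k ∧ WeaklyConverges (fun n => z (k n)) a := by
  have : TopologicalSpace.SeparableSpace (StrongDual ℝ (Lp ℝ p μ)) :=
    (toDualLp_surjective (q := q) hp).denseRange.separableSpace (toDualLp μ p q).continuous
  exact (clarksonInequality_Lp hp).exists_weaklyConverges_subseq (by linarith) hz

end LpSpaces

/-! ### Operators of semi-bounded variation -/

section SemiBoundedVariation

variable {X : Type*} [NormedAddCommGroup X] [NormedSpace ℝ X]

/-- The moduli `c R` allowed in the definition of semi-bounded variation on the ball of radius `R`: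
continuous functions of `t ≥ 0` which are `o(t)` as `t → 0+`. -/
def IsModulus (c : ℝ → ℝ → ℝ) : Prop :=
  ∀ R > 0, ContinuousOn (c R) (Ici 0) ∧ Tendsto (fun t => c R t / t) (𝓝[>] 0) (𝓝 0)

/-- `Φ` has semi-bounded variation with respect to the seminorm `s` and the modulus `c`: it is
monotone up to an error controlled by the seminorm. -/
def HasSBV (s : Seminorm ℝ X) (c : ℝ → ℝ → ℝ) (Φ : X → StrongDual ℝ X) : Prop :=
  ∀ R > 0, ∀ z₁ z₂ : X, ‖z₁‖ ≤ R → ‖z₂‖ ≤ R → -c R (s (z₁ - z₂)) ≤ (Φ z₁ - Φ z₂) (z₁ - z₂)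

/-- Right continuity of `τ ↦ ⟨Φ (z + τ v), v⟩` at `τ = 0`, which is all that Minty's argument uses
of radial continuity. -/
def IsRadiallyContinuous (Φ : X → StrongDual ℝ X) : Prop :=
  ∀ z v : X, Tendsto (fun τ : ℝ => Φ (z + τ • v) v) (𝓝[>] 0) (𝓝 (Φ z v))

theorem isModulus_zero : IsModulus fun _ _ => 0 := fun _ _ => ⟨continuousOn_const, by simp⟩

theorem isCompactSeminorm_zero : IsCompactSeminorm (0 : Seminorm ℝ X) := fun ε hε =>
  ⟨{0}, finite_singleton _, fun _ _ => ⟨0, rfl, by simpa using hε⟩⟩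

theorem hasSBV_zero_of_monotone {Φ : X → StrongDual ℝ X}
    (hΦ : ∀ z₁ z₂, 0 ≤ (Φ z₁ - Φ z₂) (z₁ - z₂)) : HasSBV 0 (fun _ _ => 0) Φ :=
  fun _ _ z₁ z₂ _ _ => by simpa using hΦ z₁ z₂

variable {s : Seminorm ℝ X} {c : ℝ → ℝ → ℝ}

theorem IsModulus.apply_zero (hc : IsModulus c) {R : ℝ} (hR : 0 < R) : c R 0 = 0 := by
  obtain ⟨hcont, hdiv⟩ := hc R hR
  have hlim : Tendsto (c R) (𝓝[>] 0) (𝓝 (c R 0)) :=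
    (hcont 0 self_mem_Ici).mono_left (nhdsWithin_mono _ Ioi_subset_Ici_self)
  have hmul : Tendsto (fun t => c R t / t * t) (𝓝[>] 0) (𝓝 0) := by
    simpa only [mul_zero, id] using hdiv.mul (tendsto_nhdsWithin_of_tendsto_nhds tendsto_id)
  refine tendsto_nhds_unique hlim (hmul.congr' ?_)
  filter_upwards [self_mem_nhdsWithin] with t (ht : 0 < t)
  exact div_mul_cancel₀ _ ht.ne'

theorem IsModulus.tendsto_mul_div (hc : IsModulus c) {R a : ℝ} (hR : 0 < R) (ha : 0 ≤ a) :
    Tendsto (fun τ => c R (τ * a) / τ) (𝓝[>] 0) (𝓝 0) := by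
  rcases ha.eq_or_lt with rfl | ha
  · simp [hc.apply_zero hR]
  have hscale : Tendsto (fun τ : ℝ => τ * a) (𝓝[>] 0) (𝓝[>] 0) := by
    refine tendsto_nhdsWithin_iff.2 ⟨?_, ?_⟩
    · simpa only [zero_mul, id] using
        (tendsto_nhdsWithin_of_tendsto_nhds (a := (0 : ℝ)) tendsto_id).mul_const a
    · filter_upwards [self_mem_nhdsWithin] with τ hτ using mul_pos hτ ha
  have hmul := ((hc R hR).2.comp hscale).mul_const a
  rw [zero_mul] at hmul
  refine hmul.congr fun τ => ?_
  rw [Function.comp_apply, div_mul_eq_mul_div, mul_div_mul_right _ _ ha.ne']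

theorem IsCompactSeminorm.exists_le_mul_norm (hs : IsCompactSeminorm s) :
    ∃ K, 0 ≤ K ∧ ∀ z, s z ≤ K * ‖z‖ := by
  obtain ⟨t, ht, hcover⟩ := hs 1 one_pos
  obtain ⟨K, hK⟩ := (ht.image s).bddAbove
  have hball (z : X) (hz : ‖z‖ ≤ 1) : s z ≤ 1 + max K 0 := by
    obtain ⟨w, hw, hzw⟩ := hcover z hz
    have htri : s z ≤ s (z - w) + s w := by simpa using map_add_le_add s (z - w) w
    linarith [hK (mem_image_of_mem s hw), le_max_left K 0]
  refine ⟨1 + max K 0, by positivity, fun z => ?_⟩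
  rcases eq_or_ne z 0 with rfl | hz
  · simp
  have hz' : 0 < ‖z‖ := norm_pos_iff.2 hz
  have hunit := hball (‖z‖⁻¹ • z) (norm_smul_inv_norm (𝕜 := ℝ) hz).le
  rwa [map_smul_eq_mul, norm_inv, norm_norm, inv_mul_le_iff₀ hz', mul_comm] at hunit

theorem IsCompactSeminorm.continuous (hs : IsCompactSeminorm s) : Continuous s := by
  obtain ⟨K, hK0, hK⟩ := hs.exists_le_mul_norm
  refine Seminorm.continuous_of_le (q := K.toNNReal • normSeminorm ℝ X)
    (continuous_norm.const_smul K.toNNReal) fun z => ?_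
  simpa [NNReal.smul_def, hK0] using hK z

theorem exists_dual_eq_and_le (hs : Continuous s) (w : X) :
    ∃ ℓ : StrongDual ℝ X, ℓ w = s w ∧ ∀ z, ℓ z ≤ s z := by
  rcases eq_or_ne w 0 with rfl | hw
  · exact ⟨0, by simp, fun z => by simp⟩
  let coord : (ℝ ∙ w) →ₗ[ℝ] ℝ := (LinearEquiv.coord ℝ X w hw).toLinearMap
  have hdom (x : ℝ ∙ w) : (s w • coord) x ≤ s x := by
    calc s w * coord x ≤ ‖coord x‖ * s w :=
          (mul_comm _ _).trans_le (mul_le_mul_of_nonneg_right (le_abs_self _) (apply_nonneg s w))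
      _ = s x := by rw [← map_smul_eq_mul, LinearEquiv.coe_coe, LinearEquiv.coord_apply_smul]
  obtain ⟨ℓ, hℓ, hle⟩ :=
    Module.Dual.exists_continuous_extension_of_le_seminorm_real _ (s w • coord) hs hdom
  refine ⟨ℓ, (hℓ ⟨w, Submodule.mem_span_singleton_self w⟩).trans ?_,
    fun z => (le_abs_self _).trans (hle z)⟩
  change s w * LinearEquiv.coord ℝ X w hw ⟨w, _⟩ = s w
  rw [LinearEquiv.coord_self, mul_one]

/-- At each `z` in a finite net choose a functional `ℓ ≤ s` with `ℓ z = s z`: finitely many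
functionals control the seminorm on the unit ball. -/
theorem IsCompactSeminorm.tendsto_zero_of_norm_le_one (hs : IsCompactSeminorm s) {u : ℕ → X}
    (h : WeaklyConverges u 0) (hu : ∀ n, ‖u n‖ ≤ 1) :
    Tendsto (fun n => s (u n)) atTop (𝓝 0) := by
  choose ℓ hℓ hle using exists_dual_eq_and_le hs.continuous
  refine Metric.tendsto_atTop'.2 fun ε hε => ?_
  obtain ⟨t, ht, hcover⟩ := hs (ε / 3) (by positivity)
  have hev : ∀ᶠ n in atTop, ∀ w ∈ t, ℓ w (u n) < ε / 3 :=
    (ht.eventually_all).2 fun w _ =>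
      (h (ℓ w)).eventually (gt_mem_nhds (by rw [map_zero]; positivity))
  obtain ⟨n₀, hn₀⟩ := eventually_atTop.1 hev
  refine ⟨n₀, fun n hn => ?_⟩
  obtain ⟨w, hw, hnw⟩ := hcover _ (hu n)
  have htri : s (u n) ≤ s (u n - w) + s w := by simpa using map_add_le_add s (u n - w) w
  have hsw : s w = ℓ w (u n) + ℓ w (w - u n) := by rw [← map_add, add_sub_cancel, hℓ]
  have hdiff := hle w (w - u n)
  rw [map_sub_rev s] at hdiff
  rw [dist_zero_right, Real.norm_of_nonneg (apply_nonneg s _)]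
  linarith [hn₀ n hn.le w hw]

theorem IsCompactSeminorm.tendsto_of_weaklyConverges (hs : IsCompactSeminorm s) {u : ℕ → X} {a : X}
    (h : WeaklyConverges u a) : Tendsto (fun n => s (u n)) atTop (𝓝 (s a)) := by
  have hsub : WeaklyConverges (fun n => u n - a) 0 := by simpa using h.sub_const a
  obtain ⟨C, hC⟩ := hsub.exists_norm_le
  have hC' : 0 < max C 1 := by positivity
  have hunit : Tendsto (fun n => s ((max C 1)⁻¹ • (u n - a))) atTop (𝓝 0) := by
    refine hs.tendsto_zero_of_norm_le_one ?_ fun n => ?_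
    · simpa using hsub.map ((max C 1)⁻¹ • ContinuousLinearMap.id ℝ X)
    · rw [norm_smul, norm_inv, Real.norm_of_nonneg hC'.le, inv_mul_le_iff₀ hC', mul_one]
      exact (hC n).trans (le_max_left _ _)
  have hzero : Tendsto (fun n => s (u n - a)) atTop (𝓝 0) := by
    have hmul := hunit.const_mul (max C 1)
    simpa only [map_smul_eq_mul, norm_inv, Real.norm_of_nonneg hC'.le,
      mul_inv_cancel_left₀ hC'.ne', mul_zero] using hmul
  rw [tendsto_iff_dist_tendsto_zero]
  exact squeeze_zero (fun _ => dist_nonneg) (fun n => abs_sub_map_le_sub s (u n) a) hzero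

theorem IsModulus.tendsto_of_weaklyConverges (hc : IsModulus c) (hs : IsCompactSeminorm s) {R : ℝ}
    (hR : 0 < R) {u : ℕ → X} {a : X} (h : WeaklyConverges u a) (v : X) :
    Tendsto (fun n => c R (s (u n - v))) atTop (𝓝 (c R (s (a - v)))) :=
  ((hc R hR).1 _ (apply_nonneg s _)).tendsto.comp (tendsto_nhdsWithin_iff.2
    ⟨hs.tendsto_of_weaklyConverges (h.sub_const v), .of_forall fun _ => apply_nonneg s _⟩)

theorem IsModulus.exists_abs_le (hc : IsModulus c) (hs : IsCompactSeminorm s) {R : ℝ} (hR : 0 < R)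
    (r : ℝ) : ∃ C, ∀ z, ‖z‖ ≤ r → |c R (s z)| ≤ C := by
  obtain ⟨K, hK0, hK⟩ := hs.exists_le_mul_norm
  obtain ⟨C, hC⟩ := (isCompact_Icc (a := (0 : ℝ)) (b := K * r)).exists_bound_of_continuousOn
    ((hc R hR).1.mono fun t ht => ht.1)
  exact ⟨C, fun z hz => hC _ ⟨apply_nonneg s _, (hK z).trans (by gcongr)⟩⟩

section Sequences

variable {Φ : ℕ → X → StrongDual ℝ X} {z : ℕ → X} {z₀ : X}

theorem exists_apply_le_mul_of_hasSBV (hs : IsCompactSeminorm s) (hc : IsModulus c)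
    (hΦ : ∀ k, HasSBV s c (Φ k)) (hb : ∀ v, ∃ M, ∀ k, ‖Φ k v‖ ≤ M) {C : ℝ} (hz : ∀ k, ‖z k‖ ≤ C)
    (x : X) {a : ℕ → ℝ} (ha : ∀ k, 1 ≤ a k) (hza : ∀ k, Φ k (z k) (z k - x) ≤ a k) (v : X) :
    ∃ M, ∀ k, Φ k (z k) v ≤ M * a k := by
  have hC : 0 ≤ C := (norm_nonneg _).trans (hz 0)
  let R := C + ‖x + v‖ + 1
  have hR : 0 < R := by positivity
  have hzR (k : ℕ) : ‖z k‖ ≤ R := by linarith [hz k, norm_nonneg (x + v)]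
  have hvR : ‖x + v‖ ≤ R := by linarith
  obtain ⟨M, hM⟩ := hb (x + v)
  obtain ⟨L, hL⟩ := hc.exists_abs_le hs hR (2 * R)
  have hM0 : 0 ≤ M := (norm_nonneg _).trans (hM 0)
  have hL0 : 0 ≤ L := (abs_nonneg _).trans (hL 0 (by rw [norm_zero]; positivity))
  refine ⟨1 + (M * (2 * R) + L), fun k => ?_⟩
  have hdist : ‖z k - (x + v)‖ ≤ 2 * R := (norm_sub_le _ _).trans (by linarith [hzR k])
  have hmod := le_of_abs_le (hL _ hdist)
  have hfix : |Φ k (x + v) (z k - (x + v))| ≤ M * (2 * R) :=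
    (Φ k (x + v)).le_of_opNorm_le_of_le (hM k) hdist
  have hsplit : Φ k (z k) (z k - (x + v)) = Φ k (z k) (z k - x) - Φ k (z k) v := by
    rw [← map_sub, sub_sub]
  have hsbv := hΦ k R hR (z k) (x + v) (hzR k) hvR
  rw [sub_apply, hsplit] at hsbv
  have hgrow : M * (2 * R) + L ≤ (M * (2 * R) + L) * a k :=
    le_mul_of_one_le_right (by positivity) (ha k)
  linarith [hza k, neg_le_of_abs_le hfix]

theorem exists_norm_le_mul_of_forall_apply_le [CompleteSpace X] {ψ : ℕ → StrongDual ℝ X} {a : ℕ → ℝ}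
    (ha : ∀ k, 0 < a k) (h : ∀ v, ∃ M, ∀ k, ψ k v ≤ M * a k) : ∃ K, ∀ k, ‖ψ k‖ ≤ K * a k := by
  have hnorm (k : ℕ) : ‖(a k)⁻¹‖ = (a k)⁻¹ := Real.norm_of_nonneg (inv_nonneg.2 (ha k).le)
  obtain ⟨K, hK⟩ := banach_steinhaus (g := fun k => (a k)⁻¹ • ψ k) fun v => by
    obtain ⟨M, hM⟩ := h v
    obtain ⟨M', hM'⟩ := h (-v)
    refine ⟨max M M', fun k => ?_⟩
    rw [smul_apply, norm_smul, hnorm, inv_mul_le_iff₀ (ha k), mul_comm, Real.norm_eq_abs]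
    refine abs_le'.2 ⟨(hM k).trans ?_, (map_neg (ψ k) v).symm.trans_le ((hM' k).trans ?_)⟩
    · exact mul_le_mul_of_nonneg_right (le_max_left _ _) (ha k).le
    · exact mul_le_mul_of_nonneg_right (le_max_right _ _) (ha k).le
  refine ⟨K, fun k => ?_⟩
  have hk := hK k
  rwa [norm_smul, hnorm, inv_mul_le_iff₀ (ha k), mul_comm] at hk

/-- The weight `a` makes this usable with a bound that depends on `‖Φ k (z k)‖` itself, as in
`HasSBV.exists_norm_le_of_tendsto`. -/
theorem exists_norm_le_mul_of_hasSBV [CompleteSpace X] (hs : IsCompactSeminorm s) (hc : IsModulus c)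
    (hΦ : ∀ k, HasSBV s c (Φ k)) (hb : ∀ v, ∃ M, ∀ k, ‖Φ k v‖ ≤ M) {C : ℝ} (hz : ∀ k, ‖z k‖ ≤ C)
    (x : X) {a : ℕ → ℝ} (ha : ∀ k, 1 ≤ a k) (hza : ∀ k, Φ k (z k) (z k - x) ≤ a k) :
    ∃ K, ∀ k, ‖Φ k (z k)‖ ≤ K * a k :=
  exists_norm_le_mul_of_forall_apply_le (fun k => zero_lt_one.trans_le (ha k))
    (exists_apply_le_mul_of_hasSBV hs hc hΦ hb hz x ha hza)

/-- Minty's argument: test with `v = z₀ + τ u`, divide by `τ` and let `τ → 0+`. -/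
theorem eq_of_forall_neg_modulus_le (hc : IsModulus c) {Ψ : X → StrongDual ℝ X}
    (hrad : IsRadiallyContinuous Ψ) {φ : StrongDual ℝ X} {R : ℝ} (hR : ‖z₀‖ < R)
    (h : ∀ v, ‖v‖ ≤ R → -c R (s (z₀ - v)) ≤ (φ - Ψ v) (z₀ - v)) : φ = Ψ z₀ := by
  have hR0 : 0 < R := (norm_nonneg z₀).trans_lt hR
  have hle (u : X) : φ u ≤ Ψ z₀ u := by
    have hlim : Tendsto (fun τ : ℝ => Ψ (z₀ + τ • u) u + c R (τ * s u) / τ) (𝓝[>] 0)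
        (𝓝 (Ψ z₀ u)) := by
      simpa only [add_zero] using (hrad z₀ u).add (hc.tendsto_mul_div hR0 (apply_nonneg s u))
    have hball : ∀ᶠ τ : ℝ in 𝓝[>] 0, ‖z₀ + τ • u‖ < R := by
      have hcont : Continuous fun τ : ℝ => ‖z₀ + τ • u‖ := by fun_prop
      exact nhdsWithin_le_nhds (hcont.continuousAt.eventually (gt_mem_nhds (by simpa using hR)))
    refine ge_of_tendsto hlim ?_
    filter_upwards [hball, self_mem_nhdsWithin] with τ hτR (hτ : 0 < τ)
    have htest := h (z₀ + τ • u) hτR.le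
    rw [sub_add_cancel_left, map_neg_eq_map, map_smul_eq_mul, Real.norm_of_nonneg hτ.le, map_neg,
      map_smul, smul_eq_mul, sub_apply, neg_le_neg_iff, ← le_div_iff₀' hτ] at htest
    linarith
  refine ContinuousLinearMap.ext fun u => (hle u).antisymm ?_
  simpa only [map_neg, neg_le_neg_iff] using hle (-u)

theorem neg_modulus_le_of_hasSBV (hs : IsCompactSeminorm s) (hc : IsModulus c)
    (hΦ : ∀ k, HasSBV s c (Φ k)) (hz : WeaklyConverges z z₀) {φ ψ : StrongDual ℝ X}
    (hφ : ∀ x, Tendsto (fun k => Φ k (z k) x) atTop (𝓝 (φ x)))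
    (hlim : ∀ ε > 0, ∀ᶠ k in atTop, Φ k (z k) (z k) ≤ φ z₀ + ε) {R : ℝ} (hR : 0 < R)
    (hzR : ∀ k, ‖z k‖ ≤ R) {v : X} (hv : ‖v‖ ≤ R) (hψ : Tendsto (fun k => Φ k v) atTop (𝓝 ψ)) :
    -c R (s (z₀ - v)) ≤ (φ - ψ) (z₀ - v) := by
  refine le_of_forall_pos_le_add fun ε hε => ?_
  have hleft : Tendsto (fun k => -c R (s (z k - v))) atTop (𝓝 (-c R (s (z₀ - v)))) :=
    (hc.tendsto_of_weaklyConverges hs hR hz v).neg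
  have hright : Tendsto (fun k => φ z₀ + ε - Φ k (z k) v - Φ k v (z k - v)) atTop
      (𝓝 (φ z₀ + ε - φ v - ψ (z₀ - v))) :=
    ((hφ v).const_sub _).sub ((hz.sub_const v).tendsto_apply hψ)
  have hlimit := le_of_tendsto_of_tendsto hleft hright (by
    filter_upwards [hlim ε hε] with k hk
    have hsbv := hΦ k R hR (z k) v (hzR k) hv
    simp only [sub_apply, map_sub (Φ k (z k))] at hsbv
    linarith)
  rw [sub_apply, map_sub φ]
  linarith

theorem eq_of_hasSBV (hs : IsCompactSeminorm s) (hc : IsModulus c) (hΦ : ∀ k, HasSBV s c (Φ k))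
    {Φ₀ : X → StrongDual ℝ X} (hrad : IsRadiallyContinuous Φ₀)
    (hconv : ∀ v, Tendsto (fun k => Φ k v) atTop (𝓝 (Φ₀ v))) (hz : WeaklyConverges z z₀)
    {φ : StrongDual ℝ X} (hφ : ∀ x, Tendsto (fun k => Φ k (z k) x) atTop (𝓝 (φ x)))
    (hlim : ∀ ε > 0, ∀ᶠ k in atTop, Φ k (z k) (z k) ≤ φ z₀ + ε) : φ = Φ₀ z₀ := by
  obtain ⟨C, hC⟩ := hz.exists_norm_le
  let R := max C (‖z₀‖ + 1)
  have hzR : ‖z₀‖ < R := (lt_add_one _).trans_le (le_max_right _ _)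
  exact eq_of_forall_neg_modulus_le hc hrad hzR fun v hv =>
    neg_modulus_le_of_hasSBV hs hc hΦ hz hφ hlim ((norm_nonneg _).trans_lt hzR)
      (fun k => (hC k).trans (le_max_left _ _)) hv (hconv v)

theorem eventually_sub_le_apply_self_of_hasSBV (hs : IsCompactSeminorm s) (hc : IsModulus c)
    (hΦ : ∀ k, HasSBV s c (Φ k)) (hz : WeaklyConverges z z₀) {ψ : StrongDual ℝ X} {t : ℝ}
    (hψ : Tendsto (fun k => Φ k z₀) atTop (𝓝 ψ))
    (hφ : Tendsto (fun k => Φ k (z k) z₀) atTop (𝓝 t)) {ε : ℝ} (hε : 0 < ε) :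
    ∀ᶠ k in atTop, t - ε ≤ Φ k (z k) (z k) := by
  obtain ⟨C, hC⟩ := hz.exists_norm_le
  let R := max C (‖z₀‖ + 1)
  have hzR : ‖z₀‖ < R := (lt_add_one _).trans_le (le_max_right _ _)
  have hR : 0 < R := (norm_nonneg _).trans_lt hzR
  have hlim : Tendsto (fun k => Φ k (z k) z₀ + Φ k z₀ (z k - z₀) - c R (s (z k - z₀))) atTop
      (𝓝 t) := by
    have h := (hφ.add ((hz.sub_const z₀).tendsto_apply hψ)).sub
      (hc.tendsto_of_weaklyConverges hs hR hz z₀)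
    simpa only [sub_self, map_zero, hc.apply_zero hR, add_zero, sub_zero] using h
  filter_upwards [hlim.eventually (lt_mem_nhds (sub_lt_self t hε))] with k hk
  have hsbv := hΦ k R hR (z k) z₀ ((hC k).trans (le_max_left _ _)) hzR.le
  simp only [sub_apply, map_sub (Φ k (z k))] at hsbv
  linarith

end Sequences

variable {Φ : X → StrongDual ℝ X}

theorem HasSBV.exists_norm_le_of_tendsto [CompleteSpace X] (hΦ : HasSBV s c Φ)
    (hs : IsCompactSeminorm s) (hc : IsModulus c) {z : ℕ → X} {z₀ : X}
    (hz : Tendsto z atTop (𝓝 z₀)) : ∃ C, ∀ k, ‖Φ (z k)‖ ≤ C := by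
  obtain ⟨C, hC⟩ := (WeaklyConverges.of_tendsto hz).exists_norm_le
  obtain ⟨K, hK⟩ := exists_norm_le_mul_of_hasSBV hs hc (Φ := fun _ => Φ) (fun _ => hΦ)
    (fun v => ⟨‖Φ v‖, fun _ => le_rfl⟩) hC z₀ (a := fun k => 1 + ‖Φ (z k)‖ * ‖z k - z₀‖)
    (fun k => le_add_of_nonneg_right (by positivity))
    fun k => ((le_abs_self _).trans ((Φ (z k)).le_opNorm _)).trans (by linarith)
  have hsmall : ∀ᶠ k in atTop, K * ‖z k - z₀‖ < 1 / 2 := by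
    have hlim : Tendsto (fun k => K * ‖z k - z₀‖) atTop (𝓝 0) := by
      simpa using (tendsto_iff_norm_sub_tendsto_zero.1 hz).const_mul K
    exact hlim.eventually (gt_mem_nhds (by norm_num))
  have hbdd : IsBoundedUnder (· ≤ ·) atTop fun k => ‖Φ (z k)‖ := by
    refine isBoundedUnder_of_eventually_le (a := 2 * K) ?_
    filter_upwards [hsmall] with k hk
    nlinarith [hK k, norm_nonneg (Φ (z k))]
  exact hbdd.bddAbove_range.imp fun C hC k => hC (mem_range_self k)

theorem HasSBV.exists_tendsto_apply_subseq [CompleteSpace X] [TopologicalSpace.SeparableSpace X]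
    (hΦ : HasSBV s c Φ) (hs : IsCompactSeminorm s) (hc : IsModulus c)
    (hrad : IsRadiallyContinuous Φ) {z : ℕ → X} {z₀ : X} (hz : Tendsto z atTop (𝓝 z₀)) :
    ∃ k : ℕ → ℕ, StrictMono k ∧ ∀ v, Tendsto (fun n => Φ (z (k n)) v) atTop (𝓝 (Φ z₀ v)) := by
  obtain ⟨C, hC⟩ := hΦ.exists_norm_le_of_tendsto hs hc hz
  obtain ⟨φ, k, hk, hφ⟩ := HammersteinOCP.exists_tendsto_apply_subseq hC
  have hzk : Tendsto (fun n => z (k n)) atTop (𝓝 z₀) := hz.comp hk.tendsto_atTop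
  suffices φ = Φ z₀ from ⟨k, hk, this ▸ hφ⟩
  refine eq_of_hasSBV hs hc (Φ := fun _ => Φ) (fun _ => hΦ) hrad (fun _ => tendsto_const_nhds)
    (.of_tendsto hzk) hφ fun ε hε => ?_
  have hlim : Tendsto (fun n => Φ (z (k n)) z₀ + C * ‖z (k n) - z₀‖) atTop (𝓝 (φ z₀)) := by
    simpa using (hφ z₀).add ((tendsto_iff_norm_sub_tendsto_zero.1 hzk).const_mul C)
  filter_upwards [hlim.eventually (gt_mem_nhds (lt_add_of_pos_right _ hε))] with n hn
  have hdiff := (le_abs_self _).trans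
    ((Φ (z (k n))).le_of_opNorm_le (hC (k n)) (z (k n) - z₀))
  rw [map_sub] at hdiff
  linarith

theorem HasSBV.continuous_apply [CompleteSpace X] [TopologicalSpace.SeparableSpace X]
    (hΦ : HasSBV s c Φ) (hs : IsCompactSeminorm s) (hc : IsModulus c)
    (hrad : IsRadiallyContinuous Φ) (v : X) : Continuous fun z => Φ z v := by
  refine continuous_iff_seqContinuous.2 fun z z₀ hz => tendsto_of_subseq_tendsto fun ns hns => ?_
  obtain ⟨k, -, hk⟩ := hΦ.exists_tendsto_apply_subseq hs hc hrad (hz.comp hns)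
  exact ⟨k, hk v⟩

end SemiBoundedVariation

/-! ### Perturbations of monotone linear graphs -/

section Galerkin

variable {X E : Type*} [NormedAddCommGroup X] [NormedSpace ℝ X] [NormedAddCommGroup E]
  [NormedSpace ℝ E]

theorem exists_apply_add_mul_inner_eq_zero {G : Type*} [NormedAddCommGroup G]
    [InnerProductSpace ℝ G] [FiniteDimensional ℝ G] {Ψ : G → StrongDual ℝ G}
    (hΨ : ∀ b, Continuous fun a => Ψ a b) {M : ℝ} (hM : ∀ a, M ≤ Ψ a a) {ε : ℝ} (hε : 0 < ε) :
    ∃ a, ∀ b, Ψ a b + ε * inner ℝ a b = 0 := by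
  borelize G
  let T : G → G := fun a => (InnerProductSpace.toDual ℝ G).symm (Ψ a) + ε • a
  have hT : Continuous T :=
    ((LinearIsometryEquiv.continuous _).comp (continuous_clm_apply.2 hΨ)).add
      (continuous_const_smul ε)
  have hinner (a b : G) : inner ℝ (T a) b = Ψ a b + ε * inner ℝ a b := by
    rw [inner_add_left, InnerProductSpace.toDual_symm_apply, real_inner_smul_left]
  have hpos (a : G) (ha : √((|M| + 1) / ε) ≤ ‖a‖) : 0 < inner ℝ (T a) a := by
    have hsq := (Real.sqrt_le_left (norm_nonneg a)).1 ha
    rw [div_le_iff₀' hε] at hsq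
    rw [hinner, real_inner_self_eq_norm_sq]
    linarith [hM a, neg_abs_le M]
  obtain ⟨a, ha⟩ := exists_eq_zero_of_inner_pos hT (by positivity) hpos
  exact ⟨a, fun b => by rw [← hinner, ha, inner_zero_left]⟩

theorem HasSBV.exists_forall_le_apply_self {s : Seminorm ℝ X} {c : ℝ → ℝ → ℝ}
    {Φ : X → StrongDual ℝ X} (hΦ : HasSBV s c Φ) (hs : IsCompactSeminorm s) (hc : IsModulus c)
    {r : ℝ} (hr : 0 < r) (hcoer : ∀ z, r < ‖z‖ → 0 ≤ Φ z z) : ∃ M, ∀ z, M ≤ Φ z z := by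
  obtain ⟨C, hC⟩ := hc.exists_abs_le hs hr r
  refine ⟨min 0 (-C - ‖Φ 0‖ * r), fun z => ?_⟩
  rcases le_or_gt ‖z‖ r with hz | hz
  · refine (min_le_right _ _).trans ?_
    have hsbv := hΦ r hr z 0 hz (by simpa using hr.le)
    rw [sub_zero, sub_apply] at hsbv
    have hzero : |Φ 0 z| ≤ ‖Φ 0‖ * r := (Φ 0).le_opNorm_of_le hz
    linarith [le_of_abs_le (hC z hz), neg_le_of_abs_le hzero]
  · exact (min_le_left _ _).trans (hcoer z hz)

/-- Solve on the span of the `w i`, with the regularisation `ε * inner ℝ a b` in the space of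
coefficients: `P` may be degenerate on the span, so it is this term that makes the
finite-dimensional problem coercive. -/
theorem exists_galerkin_solution {Φ : X → StrongDual ℝ X} (hΦ : ∀ v, Continuous fun z => Φ z v)
    {M : ℝ} (hM : ∀ z, M ≤ Φ z z) {r : ℝ} (hr : 0 ≤ r) (hcoer : ∀ z, r < ‖z‖ → 0 ≤ Φ z z)
    {P : E →L[ℝ] X} {A : E →L[ℝ] StrongDual ℝ X} (hPA : ∀ ω, 0 ≤ A ω (P ω)) {ι : Type*}
    [Finite ι] (w : ι → E) {ε : ℝ} (hε : 0 < ε) :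
    ∃ z, ‖z‖ ≤ r ∧ Φ z z ≤ 0 ∧ ∀ i, -ε ≤ (A (w i) + Φ z) (P (w i) - z) := by
  classical
  have := Fintype.ofFinite ι
  let L : EuclideanSpace ℝ ι →L[ℝ] E := ∑ i, (EuclideanSpace.proj (𝕜 := ℝ) i).smulRight (w i)
  have hL (i : ι) : L (EuclideanSpace.single i 1) = w i := by
    simp [L, sum_apply, PiLp.single_apply, ite_smul]
  obtain ⟨a, ha⟩ := exists_apply_add_mul_inner_eq_zero
    (Ψ := fun a => (A (L a) + Φ (P (L a))).comp (P.comp L)) (M := M)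
    (fun b => (((A.comp L).flip (P (L b))).continuous).add ((hΦ _).comp (P.comp L).continuous))
    (fun a => by simpa using (hM _).trans (le_add_of_nonneg_left (hPA (L a)))) hε
  simp only [ContinuousLinearMap.comp_apply] at ha
  have henergy : Φ (P (L a)) (P (L a)) ≤ -(ε * ‖a‖ ^ 2) := by
    have haa := ha a
    rw [add_apply, real_inner_self_eq_norm_sq] at haa
    linarith [hPA (L a)]
  refine ⟨P (L a), ?_, henergy.trans (neg_nonpos.2 (by positivity)), fun i => ?_⟩
  · by_contra! h
    have hsq : ε * ‖a‖ ^ 2 ≤ 0 := by linarith [hcoer _ h]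
    have hzero : a = 0 := by
      simpa using le_antisymm (nonpos_of_mul_nonpos_right hsq hε) (sq_nonneg ‖a‖)
    rw [hzero, map_zero, map_zero, norm_zero] at h
    exact h.not_ge hr
  · let e : EuclideanSpace ℝ ι := EuclideanSpace.single i 1
    have htest := ha (e - a)
    rw [inner_sub_right, real_inner_self_eq_norm_sq, map_sub, hL, map_sub] at htest
    have hmono := hPA (w i - L a)
    simp only [add_apply, map_sub, sub_apply] at hmono htest ⊢
    have he : inner ℝ a e ≤ ‖a‖ := (real_inner_le_norm a e).trans_eq (by simp [e])
    have hquad : inner ℝ a e - ‖a‖ ^ 2 ≤ 1 := by nlinarith [sq_nonneg (‖a‖ - 1), norm_nonneg a]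
    nlinarith

theorem eventually_apply_self_le {z : ℕ → X} {z₀ x : X} {ψ : ℕ → StrongDual ℝ X}
    {φ a : StrongDual ℝ X} (hz : WeaklyConverges z z₀)
    (hφ : Tendsto (fun k => ψ k x) atTop (𝓝 (φ x)))
    (h : ∀ ε > 0, ∀ᶠ k in atTop, -ε ≤ (a + ψ k) (x - z k)) {ε : ℝ} (hε : 0 < ε) :
    ∀ᶠ k in atTop, ψ k (z k) ≤ φ z₀ + (a + φ) (x - z₀) + ε := by
  have hlim : Tendsto (fun k => a x - a (z k) + ψ k x) atTop (𝓝 (a x - a z₀ + φ x)) :=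
    ((hz a).const_sub _).add hφ
  filter_upwards [h (ε / 2) (half_pos hε),
    hlim.eventually (gt_mem_nhds (lt_add_of_pos_right _ (half_pos hε)))] with k hk hlt
  simp only [add_apply, map_sub] at hk ⊢
  linarith

/-- Every weak-* limit of `Φ k (z k)` satisfies the inequalities in the limit; maximality then gives
the upper bound on `Φ k (z k) (z k)` that identifies it with `Φ₀ z₀` by Minty's argument. -/
theorem forall_apply_nonneg_of_weaklyConverges [CompleteSpace X] [TopologicalSpace.SeparableSpace X]
    {s : Seminorm ℝ X} (hs : IsCompactSeminorm s) {c : ℝ → ℝ → ℝ} (hc : IsModulus c)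
    {Φ : ℕ → X → StrongDual ℝ X} (hΦ : ∀ k, HasSBV s c (Φ k)) {Φ₀ : X → StrongDual ℝ X}
    (hrad : IsRadiallyContinuous Φ₀) (hconv : ∀ v, Tendsto (fun k => Φ k v) atTop (𝓝 (Φ₀ v)))
    {P : E →L[ℝ] X} {A : E →L[ℝ] StrongDual ℝ X}
    (hmax : ∀ (z : X) (φ : StrongDual ℝ X), ∃ ω, (A ω + φ) (P ω - z) ≤ 0)
    {z : ℕ → X} {z₀ : X} (hz : WeaklyConverges z z₀) (hz0 : ∀ k, Φ k (z k) (z k) ≤ 0) {S : Set E}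
    (hS : Dense S)
    (h : ∀ ω ∈ S, ∀ ε > 0, ∀ᶠ k in atTop, -ε ≤ (A ω + Φ k (z k)) (P ω - z k)) (ω : E) :
    0 ≤ (A ω + Φ₀ z₀) (P ω - z₀) := by
  obtain ⟨C, hC⟩ := hz.exists_norm_le
  obtain ⟨K, hK⟩ := exists_norm_le_mul_of_hasSBV hs hc hΦ
    (fun v => (Metric.isBounded_range_of_tendsto _ (hconv v)).exists_norm_le.imp
      fun M hM k => hM _ (mem_range_self k))
    hC 0 (a := fun _ => 1) (fun _ => le_rfl)
    fun k => by rw [sub_zero]; exact (hz0 k).trans zero_le_one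
  obtain ⟨φ, k, hk, hφ⟩ := exists_tendsto_apply_subseq hK
  have hzk := hz.comp_strictMono hk
  have hconvk (v : X) : Tendsto (fun n => Φ (k n) v) atTop (𝓝 (Φ₀ v)) :=
    (hconv v).comp hk.tendsto_atTop
  have hcont : Continuous fun ω => (A ω + φ) (P ω - z₀) :=
    (A.continuous.add continuous_const).clm_apply (P.continuous.sub continuous_const)
  have hupper (ω : E) (hω : ω ∈ S) {ε : ℝ} (hε : 0 < ε) :
      ∀ᶠ n in atTop, Φ (k n) (z (k n)) (z (k n)) ≤ φ z₀ + (A ω + φ) (P ω - z₀) + ε :=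
    eventually_apply_self_le hzk (hφ _)
      (fun ε hε => hk.tendsto_atTop.eventually (h ω hω ε hε)) hε
  have hnonneg (ω : E) : 0 ≤ (A ω + φ) (P ω - z₀) := by
    refine closure_minimal (fun ω hω => ?_) (isClosed_le continuous_const hcont) (hS ω)
    refine le_of_forall_pos_le_add (b := (A ω + φ) (P ω - z₀)) fun ε hε => ?_
    obtain ⟨n, hle, hge⟩ := ((hupper ω hω (half_pos hε)).and
      (eventually_sub_le_apply_self_of_hasSBV hs hc (fun n => hΦ (k n)) hzk (hconvk z₀) (hφ z₀)
        (half_pos hε))).exists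
    linarith
  have hlimit : φ = Φ₀ z₀ := by
    refine eq_of_hasSBV hs hc (fun n => hΦ (k n)) hrad hconvk hzk hφ fun ε hε => ?_
    obtain ⟨ω, hω⟩ := hmax z₀ φ
    obtain ⟨η, hη, hηS⟩ := hS.inter_open_nonempty _
      (isOpen_lt hcont continuous_const) ⟨ω, hω.trans_lt (half_pos hε)⟩
    filter_upwards [hupper η hηS (half_pos hε)] with n hn
    have hη' : (A η + φ) (P η - z₀) < ε / 2 := hη
    linarith
  exact hlimit ▸ hnonneg ω

/-- Galerkin's method, with the span of the first `n` members of a dense sequence of `E`. -/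
theorem exists_forall_apply_nonneg [CompleteSpace X] [TopologicalSpace.SeparableSpace X]
    [TopologicalSpace.SeparableSpace E]
    (hX : ∀ (x : ℕ → X) (C : ℝ), (∀ n, ‖x n‖ ≤ C) →
      ∃ (a : X) (k : ℕ → ℕ), StrictMono k ∧ WeaklyConverges (fun n => x (k n)) a)
    {s : Seminorm ℝ X} (hs : IsCompactSeminorm s) {c : ℝ → ℝ → ℝ} (hc : IsModulus c)
    {Φ : X → StrongDual ℝ X} (hΦ : HasSBV s c Φ) (hrad : IsRadiallyContinuous Φ)
    {r : ℝ} (hr : 0 < r) (hcoer : ∀ z, r < ‖z‖ → 0 ≤ Φ z z)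
    {P : E →L[ℝ] X} {A : E →L[ℝ] StrongDual ℝ X} (hPA : ∀ ω, 0 ≤ A ω (P ω))
    (hmax : ∀ (z : X) (φ : StrongDual ℝ X), ∃ ω, (A ω + φ) (P ω - z) ≤ 0) :
    ∃ z, ∀ ω, 0 ≤ (A ω + Φ z) (P ω - z) := by
  obtain ⟨M, hM⟩ := hΦ.exists_forall_le_apply_self hs hc hr hcoer
  let w : ℕ → E := TopologicalSpace.denseSeq E
  choose z hzr hz0 hzw using fun n : ℕ =>
    exists_galerkin_solution (hΦ.continuous_apply hs hc hrad) hM hr.le hcoer hPA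
      (fun j : Fin n => w j) (ε := 1 / ((n : ℝ) + 1)) Nat.one_div_pos_of_nat
  obtain ⟨z₀, k, hk, hzk⟩ := hX z r hzr
  refine ⟨z₀, forall_apply_nonneg_of_weaklyConverges hs hc (Φ := fun _ => Φ) (fun _ => hΦ) hrad
    (fun _ => tendsto_const_nhds) hmax hzk (fun n => hz0 (k n))
    (TopologicalSpace.denseRange_denseSeq E) ?_⟩
  rintro _ ⟨j, rfl⟩ ε hε
  filter_upwards [hk.tendsto_atTop.eventually_gt_atTop j,
    (tendsto_one_div_add_atTop_nhds_zero_nat.comp hk.tendsto_atTop).eventually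
      (gt_mem_nhds hε)] with n hn hlt
  exact (neg_le_neg hlt.le).trans (hzw (k n) ⟨j, hn⟩)

/-- The Browder–Minty theorem. -/
theorem exists_eq_zero_of_monotone [CompleteSpace X] [TopologicalSpace.SeparableSpace X]
    (hX : ∀ (x : ℕ → X) (C : ℝ), (∀ n, ‖x n‖ ≤ C) →
      ∃ (a : X) (k : ℕ → ℕ), StrictMono k ∧ WeaklyConverges (fun n => x (k n)) a)
    {Φ : X → StrongDual ℝ X} (hmono : ∀ z₁ z₂, 0 ≤ (Φ z₁ - Φ z₂) (z₁ - z₂))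
    (hrad : IsRadiallyContinuous Φ) {r : ℝ} (hr : 0 < r) (hcoer : ∀ z, r < ‖z‖ → 0 ≤ Φ z z) :
    ∃ z, Φ z = 0 := by
  obtain ⟨z, hz⟩ := exists_forall_apply_nonneg hX isCompactSeminorm_zero isModulus_zero
    (hasSBV_zero_of_monotone hmono) hrad hr hcoer (P := ContinuousLinearMap.id ℝ X) (A := 0)
    (fun ω => by simp) fun z φ => ⟨z, by simp⟩
  have hle (u : X) : 0 ≤ Φ z u := by simpa using hz (z + u)
  refine ⟨z, ContinuousLinearMap.ext fun u => (hle u).antisymm' ?_⟩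
  simpa using hle (-u)

/-- Testing with `ω = t • η - w` gives a nonnegative quadratic polynomial in `t` without constant
term. -/
theorem eq_neg_of_forall_nonneg {A : E →L[ℝ] StrongDual ℝ X} (hA : Function.Surjective A)
    {B : E →L[ℝ] X} {w : E} {z : X} (h : ∀ ω, 0 ≤ (A ω + A w) (B ω - z)) : z = -B w := by
  rw [eq_neg_iff_add_eq_zero]
  refine SeparatingDual.eq_zero_of_forall_dual_eq_zero (R := ℝ) fun ℓ => ?_
  obtain ⟨η, rfl⟩ := hA ℓ
  have hquad (t : ℝ) : 0 ≤ A η (B η) * (t * t) + -A η (z + B w) * t + 0 := by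
    have ht := h (t • η - w)
    simp only [map_sub, map_smul, sub_add_cancel, smul_apply, smul_eq_mul, map_add] at ht ⊢
    linarith
  have hdiscrim := discrim_le_zero hquad
  rw [discrim, mul_zero, sub_zero, neg_sq] at hdiscrim
  exact pow_eq_zero_iff two_ne_zero |>.1 (hdiscrim.antisymm (sq_nonneg _))

/-- The graph of the positive operator `B` is maximal monotone, so the limit inequalities pin down
the limit equation. -/
theorem eq_neg_of_weaklyConverges [CompleteSpace X] [TopologicalSpace.SeparableSpace X]
    {A : E →L[ℝ] StrongDual ℝ X} (hA : Function.Surjective A) {B : E →L[ℝ] X}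
    (hB : ∀ w, 0 ≤ A w (B w)) {s : Seminorm ℝ X} (hs : IsCompactSeminorm s) {c : ℝ → ℝ → ℝ}
    (hc : IsModulus c) {G : ℕ → X → E} {G₀ : X → E} (hG : ∀ k, HasSBV s c fun z => A (G k z))
    (hrad : IsRadiallyContinuous fun z => A (G₀ z))
    (hconv : ∀ v, Tendsto (fun k => G k v) atTop (𝓝 (G₀ v))) {z : ℕ → X} {z₀ : X}
    (hz : WeaklyConverges z z₀) (hsol : ∀ k, z k = -B (G k (z k))) : z₀ = -B (G₀ z₀) := by
  refine eq_neg_of_forall_nonneg hA (forall_apply_nonneg_of_weaklyConverges hs hc hG hrad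
    (fun v => (A.continuous.tendsto _).comp (hconv v)) ?_ hz (fun k => ?_) dense_univ ?_)
  · intro z φ
    obtain ⟨w, rfl⟩ := hA φ
    exact ⟨-w, by simp⟩
  · have hself : A (G k (z k)) (z k) = -A (G k (z k)) (B (G k (z k))) := by rw [← map_neg, ← hsol]
    exact hself.trans_le (neg_nonpos.2 (hB _))
  · refine fun ω _ ε hε => .of_forall fun k => (neg_nonpos.2 hε.le).trans ?_
    have hpos := hB (ω + G k (z k))
    rwa [map_add, map_add, ← neg_neg (B (G k (z k))), ← hsol, ← sub_eq_add_neg] at hpos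

end Galerkin

/-! ### The spaces `W_0^{1,p}(Ω)` -/

section Sobolev

variable {N : ℕ} {p : ℝ≥0∞} [Fact (1 ≤ p)] {Ω D S : Set (Space N)} {φ : Space N → ℝ}

instance completeSpace_W0 : CompleteSpace (W0 p Ω) :=
  (Submodule.isClosed_topologicalClosure (testJets p Ω)).completeSpace_coe

theorem separableSpace_W0 (hp : p ≠ ∞) : TopologicalSpace.SeparableSpace (W0 p Ω) := by
  have : Fact (p ≠ ∞) := ⟨hp⟩
  have : SecondCountableTopology (JetSpace N p) :=
    (PiLp.continuousLinearEquiv p ℝ fun _ : Option (Fin N) =>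
      Lp ℝ p (volume : Measure (Space N))).toHomeomorph.secondCountableTopology
  have : SecondCountableTopology (W0 p Ω) := TopologicalSpace.Subtype.secondCountableTopology _
  infer_instance

/-- The component with index `o` of the jet `(y, ∇y)` of `y ∈ W_0^{1,p}(Ω)`, as a function on the
whole space. -/
noncomputable def jetL (Ω : Set (Space N)) (o : Option (Fin N)) :
    W0 p Ω →L[ℝ] Lp ℝ p (volume : Measure (Space N)) :=
  (PiLp.proj p (fun _ => Lp ℝ p volume) o).comp (W0 p Ω).subtypeL

theorem jetL_none (y : W0 p Ω) : (jetL Ω none y : Space N → ℝ) = stateFun y := rfl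

theorem jetL_some (y : W0 p Ω) (i : Fin N) :
    (jetL Ω (some i) y : Space N → ℝ) = stateGrad y i := rfl

/-- The component with index `o` of the jet of `y ∈ W_0^{1,p}(Ω)`, restricted to a set `S`. -/
noncomputable def jetOn (Ω S : Set (Space N)) (o : Option (Fin N)) : W0 p Ω →L[ℝ] LpOn p S :=
  (LpToLpRestrictCLM (Space N) ℝ ℝ volume p S).comp (jetL Ω o)

theorem jetOn_coeFn (S : Set (Space N)) (o : Option (Fin N)) (y : W0 p Ω) :
    jetOn Ω S o y =ᵐ[volume.restrict S] jetL Ω o y :=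
  LpToLpRestrictCLM_coeFn ℝ S _

/-- Extension by zero as a continuous linear map `W_0^{1,p}(Ω) → W_0^{1,p}(D)`. -/
noncomputable def inclusionW0 (hΩD : Ω ⊆ D) : W0 p Ω →L[ℝ] W0 p D :=
  (W0 p Ω).subtypeL.codRestrict (W0 p D) fun y => W0_mono p hΩD y.2

theorem exists_eq_sum_toDualLp {q : ℝ≥0∞} [Fact (1 ≤ q)] [p.HolderConjugate q]
    (hp : 2 ≤ p.toReal) (ℓ : WDual p Ω) :
    ∃ w : Option (Fin N) → Lp ℝ q (volume : Measure (Space N)),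
      ℓ = ∑ o, (toDualLp volume p q (w o)).comp (jetL Ω o) := by
  obtain ⟨g, hg, -⟩ := exists_extension_norm_eq (W0 p Ω) ℓ
  let e := PiLp.continuousLinearEquiv p ℝ
    fun _ : Option (Fin N) => Lp ℝ p (volume : Measure (Space N))
  choose w hw using fun o => toDualLp_surjective (q := q) hp
    ((g.comp e.symm.toContinuousLinearMap).comp (ContinuousLinearMap.single ℝ
      (fun _ : Option (Fin N) => Lp ℝ p (volume : Measure (Space N))) o))
  refine ⟨w, ContinuousLinearMap.ext fun y => ?_⟩
  have hy : (y : JetSpace N p) = ∑ o, e.symm (Pi.single o (jetL Ω o y)) := by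
    rw [← map_sum, Finset.univ_sum_single]
    rfl
  rw [← hg y, hy, map_sum, sum_apply]
  simp only [hw]
  rfl

theorem separableSpace_WDual (hp : 2 ≤ p.toReal) :
    TopologicalSpace.SeparableSpace (WDual p Ω) := by
  let q := p.conjExponent
  have : Fact (1 ≤ q) := ⟨ENNReal.HolderConjugate.one_le q p⟩
  have : Fact (q ≠ ∞) := ⟨conjExponent_ne_top (p := p) (one_lt_two.trans_le hp)⟩
  have hc : Continuous fun w : Option (Fin N) → Lp ℝ q (volume : Measure (Space N)) =>
      ∑ o, (toDualLp volume p q (w o)).comp (jetL Ω o) :=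
    continuous_finsetSum _ fun o _ =>
      ((toDualLp volume p q).continuous.comp (continuous_apply o)).clm_comp continuous_const
  refine Function.Surjective.denseRange (fun ℓ => ?_) |>.separableSpace hc
  obtain ⟨w, hw⟩ := exists_eq_sum_toDualLp (q := q) hp ℓ
  exact ⟨w, hw.symm⟩

theorem exists_weaklyConverges_subseq_W0 (hp : 2 ≤ p.toReal) {y : ℕ → W0 p Ω} {C : ℝ}
    (hy : ∀ n, ‖y n‖ ≤ C) :
    ∃ (a : W0 p Ω) (k : ℕ → ℕ), StrictMono k ∧ WeaklyConverges (fun n => y (k n)) a := by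
  have := separableSpace_WDual (Ω := Ω) hp
  have hp₀ : 0 < p.toReal := two_pos.trans_le hp
  exact ((clarksonInequality_piLp hp₀ (clarksonInequality_Lp hp)).submodule
    (W0 p Ω)).exists_weaklyConverges_subseq hp₀ hy

theorem partialDeriv_eq_zero {x : Space N} (hx : x ∉ tsupport φ) (i : Fin N) :
    partialDeriv i φ x = 0 := by
  simp [partialDeriv, fderiv_of_notMem_tsupport ℝ hx]

theorem jetL_ae_eq_zero (hΩ : MeasurableSet Ω) (y : W0 p Ω) (o : Option (Fin N)) :
    ∀ᵐ x, x ∉ Ω → jetL Ω o y x = 0 := by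
  let L : JetSpace N p →L[ℝ] LpOn p Ωᶜ :=
    (LpToLpRestrictCLM (Space N) ℝ ℝ volume p Ωᶜ).comp (PiLp.proj p (fun _ => Lp ℝ p volume) o)
  have test_le : (testJets p Ω : Set (JetSpace N p)) ⊆ L ⁻¹' {0} := by
    rintro w ⟨φ, hφ, hw, hgrad⟩
    refine Lp.eq_zero_iff_ae_eq_zero.2 ((LpToLpRestrictCLM_coeFn ℝ Ωᶜ (w o)).trans ?_)
    cases o with
    | none =>
      filter_upwards [ae_restrict_mem hΩ.compl, ae_restrict_of_ae hw] with x hx hwx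
      exact hwx.trans (image_eq_zero_of_notMem_tsupport fun h => hx (hφ.support h))
    | some i =>
      filter_upwards [ae_restrict_mem hΩ.compl, ae_restrict_of_ae (hgrad i)] with x hx hwx
      exact hwx.trans (partialDeriv_eq_zero (fun h => hx (hφ.support h)) i)
  have hL : L y = 0 := closure_minimal test_le (isClosed_singleton.preimage L.continuous) y.2
  exact (ae_restrict_iff' hΩ.compl).1
    ((LpToLpRestrictCLM_coeFn ℝ Ωᶜ _).symm.trans (Lp.eq_zero_iff_ae_eq_zero.1 hL))

theorem norm_rpow_W0 (hp : 1 < p.toReal) (hΩ : MeasurableSet Ω) (y : W0 p Ω) :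
    ‖y‖ ^ p.toReal = ∑ o, ‖jetOn Ω Ω o y‖ ^ p.toReal := by
  have hp₀ : 0 < p.toReal := one_pos.trans hp
  have norm_jet : ‖y‖ ^ p.toReal = ∑ o, ‖jetL Ω o y‖ ^ p.toReal := by
    change ‖(y : JetSpace N p)‖ ^ p.toReal = ∑ o, ‖(y : JetSpace N p) o‖ ^ p.toReal
    rw [PiLp.norm_eq_sum hp₀, one_div, Real.rpow_inv_rpow (by positivity) hp₀.ne']
  refine norm_jet.trans (Finset.sum_congr rfl fun o _ => ?_)
  rw [norm_rpow_eq_integral hp, norm_rpow_eq_integral hp,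
    ← setIntegral_eq_integral_of_ae_compl_eq_zero (s := Ω)]
  · refine integral_congr_ae ?_
    filter_upwards [jetOn_coeFn Ω o y] with x hx
    rw [hx]
  · filter_upwards [jetL_ae_eq_zero hΩ y o] with x hx hxΩ
    rw [hx hxΩ, abs_zero, Real.zero_rpow hp₀.ne']

namespace IsTestFunction

theorem memLp (hφ : IsTestFunction S φ) (r : ℝ≥0∞) : MemLp φ r (volume : Measure (Space N)) :=
  hφ.smooth.continuous.memLp_of_hasCompactSupport hφ.compact

theorem continuous_partialDeriv (hφ : IsTestFunction S φ) (i : Fin N) :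
    Continuous (partialDeriv i φ) :=
  (hφ.smooth.continuous_fderiv (by simp)).clm_apply continuous_const

theorem memLp_partialDeriv (hφ : IsTestFunction S φ) (i : Fin N) (r : ℝ≥0∞) :
    MemLp (partialDeriv i φ) r (volume : Measure (Space N)) :=
  (hφ.continuous_partialDeriv i).memLp_of_hasCompactSupport
    (hφ.compact.fderiv_apply (𝕜 := ℝ) (EuclideanSpace.single i 1))

theorem mul {T : Set (Space N)} {ψ : Space N → ℝ} (hφ : IsTestFunction S φ)
    (hψ : IsTestFunction T ψ) : IsTestFunction T (φ * ψ) :=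
  ⟨hφ.smooth.mul hψ.smooth, hψ.compact.mul_left,
    (tsupport_mul_subset_right (f := φ) (g := ψ)).trans hψ.support⟩

end IsTestFunction

/-- Multiplication by a bounded function on `L^p`. -/
noncomputable def mulLp {α : Type*} [MeasurableSpace α] {μ : Measure α} (a : Lp ℝ ∞ μ) :
    Lp ℝ p μ →L[ℝ] Lp ℝ p μ :=
  (ContinuousLinearMap.mul ℝ ℝ).holderL μ ∞ p p a

theorem mulLp_coeFn {α : Type*} [MeasurableSpace α] {μ : Measure α} (a : Lp ℝ ∞ μ) (f : Lp ℝ p μ) :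
    mulLp a f =ᵐ[μ] fun x => a x * f x :=
  ContinuousLinearMap.coeFn_holder (r := p) (ContinuousLinearMap.mul ℝ ℝ) a f

/-- Multiplication of jets by a test function, by the product rule
`(y, v) ↦ (φ y, φ v + (∇φ) y)`. -/
noncomputable def mulJet (hφ : IsTestFunction S φ) : JetSpace N p →L[ℝ] JetSpace N p :=
  (PiLp.continuousLinearEquiv p ℝ fun _ : Option (Fin N) =>
    Lp ℝ p (volume : Measure (Space N))).symm.toContinuousLinearMap.comp
    (ContinuousLinearMap.pi fun o =>
      (mulLp (hφ.memLp ∞).toLp).comp (PiLp.proj p (fun _ => Lp ℝ p volume) o) +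
      o.elim 0 fun i => (mulLp (hφ.memLp_partialDeriv i ∞).toLp).comp
        (PiLp.proj p (fun _ => Lp ℝ p volume) none))

theorem mulJet_none (hφ : IsTestFunction S φ) (w : JetSpace N p) :
    mulJet hφ w none =ᵐ[volume] fun x => φ x * w none x := by
  have : mulJet hφ w none = mulLp (hφ.memLp ∞).toLp (w none) := by simp [mulJet]
  rw [this]
  filter_upwards [mulLp_coeFn (hφ.memLp ∞).toLp (w none), (hφ.memLp ∞).coeFn_toLp] with x hmul hφx
  rw [hmul, hφx]

theorem mulJet_some (hφ : IsTestFunction S φ) (w : JetSpace N p) (i : Fin N) :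
    mulJet hφ w (some i) =ᵐ[volume]
      fun x => φ x * w (some i) x + partialDeriv i φ x * w none x := by
  have : mulJet hφ w (some i) = mulLp (hφ.memLp ∞).toLp (w (some i)) +
      mulLp (hφ.memLp_partialDeriv i ∞).toLp (w none) := by simp [mulJet]
  rw [this]
  filter_upwards [Lp.coeFn_add (mulLp (hφ.memLp ∞).toLp (w (some i)))
      (mulLp (hφ.memLp_partialDeriv i ∞).toLp (w none)),
    mulLp_coeFn (hφ.memLp ∞).toLp (w (some i)), (hφ.memLp ∞).coeFn_toLp,
    mulLp_coeFn (hφ.memLp_partialDeriv i ∞).toLp (w none),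
    (hφ.memLp_partialDeriv i ∞).coeFn_toLp] with x hadd hmul hφx hmul' hdφx
  rw [hadd, Pi.add_apply, hmul, hφx, hmul', hdφx]

theorem mulJet_mem (hφ : IsTestFunction S φ) {w : JetSpace N p} (hw : w ∈ W0 p Ω) :
    mulJet hφ w ∈ W0 p Ω := by
  refine map_mem_closure (mulJet hφ).continuous hw ?_
  rintro w ⟨ψ, hψ, hfun, hgrad⟩
  refine ⟨φ * ψ, hφ.mul hψ, ?_, fun i => ?_⟩
  · filter_upwards [mulJet_none hφ w, hfun] with x hx hwx
    rw [hx, hwx, Pi.mul_apply]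
  · filter_upwards [mulJet_some hφ w i, hfun, hgrad i] with x hx hwx hdwx
    rw [hx, hwx, hdwx]
    simp only [partialDeriv]
    rw [fderiv_mul (hφ.smooth.differentiable (by simp) x) (hψ.smooth.differentiable (by simp) x)]
    simp [mul_comm]

/-- Multiplication by a test function on `W_0^{1,p}(Ω)`. -/
noncomputable def mulTest (hφ : IsTestFunction S φ) : W0 p Ω →L[ℝ] W0 p Ω :=
  ((mulJet hφ).comp (W0 p Ω).subtypeL).codRestrict (W0 p Ω) fun y => mulJet_mem hφ y.2

theorem stateGrad_mulTest (hφ : IsTestFunction S φ) (y : W0 p Ω) (i : Fin N) :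
    stateGrad (mulTest hφ y) i =ᵐ[volume]
      fun x => φ x * stateGrad y i x + partialDeriv i φ x * stateFun y x :=
  mulJet_some hφ (y : JetSpace N p) i

end Sobolev

/-! ### Rellich's theorem -/

section Rellich

variable {N : ℕ} {φ : Space N → ℝ}

theorem enorm_fderiv_apply_le (φ : Space N → ℝ) (x t : Space N) :
    ‖fderiv ℝ φ x t‖ₑ ≤ ‖t‖ₑ * ∑ i, ‖partialDeriv i φ x‖ₑ := by
  have expand : fderiv ℝ φ x t = ∑ i, t i * partialDeriv i φ x := by
    conv_lhs => rw [← (EuclideanSpace.basisFun (Fin N) ℝ).sum_repr t]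
    simp [partialDeriv]
  rw [expand, Finset.mul_sum]
  refine (enorm_sum_le _ _).trans (Finset.sum_le_sum fun i _ => ?_)
  rw [enorm_mul]
  gcongr
  exact enorm_le_iff_norm_le.2 (PiLp.norm_apply_le t i)

theorem enorm_translate_sub_le_lintegral (hφ : ContDiff ℝ 1 φ) (x t : Space N) :
    ‖φ (x + t) - φ x‖ₑ ≤
      ∫⁻ s in Ioc (0 : ℝ) 1, ‖t‖ₑ * ∑ i, ‖partialDeriv i φ (x + s • t)‖ₑ := by
  have hderiv (s : ℝ) :
      HasDerivAt (fun s : ℝ => φ (x + s • t)) (fderiv ℝ φ (x + s • t) t) s := by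
    have hline : HasDerivAt (fun s : ℝ => x + s • t) t s := by
      simpa using ((hasDerivAt_id s).smul_const t).const_add x
    exact (hφ.differentiable one_ne_zero _).hasFDerivAt.comp_hasDerivAt s hline
  have hcont : Continuous fun s : ℝ => fderiv ℝ φ (x + s • t) t :=
    ((hφ.continuous_fderiv one_ne_zero).comp (by fun_prop)).clm_apply continuous_const
  have ftc : ∫ s in Ioc (0 : ℝ) 1, fderiv ℝ φ (x + s • t) t = φ (x + t) - φ x := by
    rw [← intervalIntegral.integral_of_le zero_le_one,
      intervalIntegral.integral_eq_sub_of_hasDerivAt (fun s _ => hderiv s)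
        (hcont.intervalIntegrable 0 1), one_smul, zero_smul, add_zero]
  rw [← ftc]
  exact (enorm_integral_le_lintegral_enorm _).trans
    (lintegral_mono fun s => enorm_fderiv_apply_le φ _ t)

theorem lintegral_enorm_translate_sub_le (hφ : ContDiff ℝ 1 φ) (t : Space N) :
    ∫⁻ x, ‖φ (x + t) - φ x‖ₑ ≤ ‖t‖ₑ * ∫⁻ x, ∑ i, ‖partialDeriv i φ x‖ₑ := by
  have hcont (i : Fin N) : Continuous (partialDeriv i φ) :=
    (hφ.continuous_fderiv one_ne_zero).clm_apply continuous_const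
  have hmeas : Measurable fun z : Space N × ℝ =>
      ‖t‖ₑ * ∑ i, ‖partialDeriv i φ (z.1 + z.2 • t)‖ₑ :=
    (Finset.measurable_fun_sum _ fun i _ =>
      ((hcont i).comp (by fun_prop)).enorm.measurable).const_mul _
  calc ∫⁻ x, ‖φ (x + t) - φ x‖ₑ
      ≤ ∫⁻ x, ∫⁻ s in Ioc (0 : ℝ) 1, ‖t‖ₑ * ∑ i, ‖partialDeriv i φ (x + s • t)‖ₑ :=
        lintegral_mono fun x => enorm_translate_sub_le_lintegral hφ x t
    _ = ∫⁻ s in Ioc (0 : ℝ) 1, ∫⁻ x, ‖t‖ₑ * ∑ i, ‖partialDeriv i φ (x + s • t)‖ₑ :=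
        lintegral_lintegral_swap hmeas.aemeasurable
    _ = ∫⁻ _ in Ioc (0 : ℝ) 1, ‖t‖ₑ * ∫⁻ x, ∑ i, ‖partialDeriv i φ x‖ₑ := by
        refine lintegral_congr fun s => ?_
        rw [lintegral_add_right_eq_self (μ := (volume : Measure (Space N)))
          (fun x => ‖t‖ₑ * ∑ i, ‖partialDeriv i φ x‖ₑ) (s • t), lintegral_const_mul]
        exact Finset.measurable_fun_sum _ fun i _ => (hcont i).enorm.measurable
    _ = ‖t‖ₑ * ∫⁻ x, ∑ i, ‖partialDeriv i φ x‖ₑ := by simp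

theorem measure_mul_enorm_le (hφ : Integrable φ) {B : Set (Space N)} (hB : volume B ≠ ∞)
    (x : Space N) :
    volume B * ‖φ x‖ₑ ≤ (∫⁻ t in B, ‖φ (x + t) - φ x‖ₑ) + ‖∫ t in B, φ (x + t)‖ₑ := by
  have hsub : ∫ _ in B, φ x = (∫ t in B, φ (x + t)) - ∫ t in B, (φ (x + t) - φ x) := by
    rw [integral_sub (hφ.comp_add_left x).integrableOn (integrableOn_const hB), sub_sub_cancel]
  have hconst : ‖∫ _ in B, φ x‖ₑ = volume B * ‖φ x‖ₑ := by
    rw [setIntegral_const, enorm_smul, measureReal_def, Real.enorm_eq_ofReal ENNReal.toReal_nonneg,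
      ENNReal.ofReal_toReal hB]
  rw [← hconst, hsub, add_comm]
  exact enorm_sub_le.trans (add_le_add le_rfl (enorm_integral_le_lintegral_enorm _))

theorem measure_ball_mul_lintegral_le (hφ : ContDiff ℝ 1 φ) (hc : HasCompactSupport φ) {δ : ℝ} :
    volume (Metric.ball (0 : Space N) δ) * ∫⁻ x, ‖φ x‖ₑ ≤
      volume (Metric.ball (0 : Space N) δ) *
        (ENNReal.ofReal δ * ∫⁻ x, ∑ i, ‖partialDeriv i φ x‖ₑ) +
      ∫⁻ x, ‖∫ t in Metric.ball (0 : Space N) δ, φ (x + t)‖ₑ := by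
  have hcont : Continuous φ := hφ.continuous
  have hm : Measurable fun z : Space N × Space N => ‖φ (z.1 + z.2) - φ z.1‖ₑ :=
    ((hcont.comp (by fun_prop)).sub (hcont.comp continuous_fst)).enorm.measurable
  rw [← lintegral_const_mul _ hcont.enorm.measurable]
  refine (lintegral_mono fun x => measure_mul_enorm_le
    (hcont.integrable_of_hasCompactSupport hc) measure_ball_lt_top.ne x).trans ?_
  rw [lintegral_add_left hm.lintegral_prod_right']
  refine add_le_add ?_ le_rfl
  rw [lintegral_lintegral_swap hm.aemeasurable, mul_comm (volume _), ← setLIntegral_const]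
  refine setLIntegral_mono' Metric.isOpen_ball.measurableSet fun t ht => ?_
  refine (lintegral_enorm_translate_sub_le hφ t).trans (mul_le_mul_left ?_ _)
  rw [← ofReal_norm]
  exact ENNReal.ofReal_le_ofReal (mem_ball_zero_iff.1 ht).le

theorem setIntegral_ball_zero_translate (φ : Space N → ℝ) (x : Space N) (δ : ℝ) :
    ∫ t in Metric.ball (0 : Space N) δ, φ (x + t) = ∫ t in Metric.ball x δ, φ t := by
  rw [← (measurePreserving_add_left (volume : Measure (Space N)) x).setIntegral_preimage_emb
    (MeasurableEquiv.addLeft x).measurableEmbedding φ (Metric.ball x δ), preimage_add_ball,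
    sub_self]

section Sequences

variable {Ω : Set (Space N)} {φ : ℕ → Space N → ℝ} {C : ℝ≥0∞}

theorem enorm_setIntegral_ball_le_indicator {φ : Space N → ℝ} (hφ : tsupport φ ⊆ Ω) (x : Space N)
    (δ : ℝ) : ‖∫ t in Metric.ball x δ, φ t‖ₑ ≤
      (Metric.thickening δ Ω).indicator (fun _ => ∫⁻ t, ‖φ t‖ₑ) x := by
  by_cases hx : x ∈ Metric.thickening δ Ω
  · rw [indicator_of_mem hx]
    exact (enorm_integral_le_lintegral_enorm _).trans (setLIntegral_le_lintegral _ _)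
  · rw [indicator_of_notMem hx, setIntegral_eq_zero_of_forall_eq_zero, enorm_zero]
    exact fun t ht => image_eq_zero_of_notMem_tsupport fun h =>
      hx (Metric.mem_thickening_iff.2 ⟨t, hφ h, by rwa [dist_comm]⟩)

theorem tendsto_lintegral_enorm_setIntegral_ball (hΩ : Bornology.IsBounded Ω)
    (hφ : ∀ k, IsTestFunction Ω (φ k)) (hC : C ≠ ∞) (hφC : ∀ k, ∫⁻ x, ‖φ k x‖ₑ ≤ C) {δ : ℝ}
    (hball : ∀ x, Tendsto (fun k => ∫ t in Metric.ball x δ, φ k t) atTop (𝓝 0)) :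
    Tendsto (fun k => ∫⁻ x, ‖∫ t in Metric.ball (0 : Space N) δ, φ k (x + t)‖ₑ) atTop (𝓝 0) := by
  have hmeas (k : ℕ) : Measurable fun x => ‖∫ t in Metric.ball (0 : Space N) δ, φ k (x + t)‖ₑ := by
    have : Continuous fun z : Space N × Space N => φ k (z.1 + z.2) :=
      (hφ k).smooth.continuous.comp (by fun_prop)
    exact this.stronglyMeasurable.integral_prod_right'.enorm
  have hbound (k : ℕ) (x : Space N) : ‖∫ t in Metric.ball (0 : Space N) δ, φ k (x + t)‖ₑ ≤
      (Metric.thickening δ Ω).indicator (fun _ => C) x := by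
    rw [setIntegral_ball_zero_translate]
    exact (enorm_setIntegral_ball_le_indicator (hφ k).support x δ).trans
      (indicator_le_indicator (hφC k))
  have hfin : ∫⁻ x, (Metric.thickening δ Ω).indicator (fun _ => C) x ≠ ∞ := by
    rw [lintegral_indicator Metric.isOpen_thickening.measurableSet, setLIntegral_const]
    exact ENNReal.mul_ne_top hC hΩ.thickening.measure_lt_top.ne
  have hlim (x : Space N) : Tendsto
      (fun k => ‖∫ t in Metric.ball (0 : Space N) δ, φ k (x + t)‖ₑ) atTop (𝓝 0) := by
    simpa only [setIntegral_ball_zero_translate, enorm_zero] using (hball x).enorm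
  simpa only [lintegral_zero] using tendsto_lintegral_of_dominated_convergence
    ((Metric.thickening δ Ω).indicator fun _ => C) hmeas (fun k => ae_of_all _ (hbound k)) hfin
    (ae_of_all _ hlim)

theorem tendsto_lintegral_of_isTestFunction (hΩ : Bornology.IsBounded Ω)
    (hφ : ∀ k, IsTestFunction Ω (φ k)) (hC : C ≠ ∞) (hφC : ∀ k, ∫⁻ x, ‖φ k x‖ₑ ≤ C)
    {G : ℝ≥0∞} (hG : G ≠ ∞) (hφG : ∀ k, ∫⁻ x, ∑ i, ‖partialDeriv i (φ k) x‖ₑ ≤ G)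
    (hball : ∀ x δ, Tendsto (fun k => ∫ t in Metric.ball x δ, φ k t) atTop (𝓝 0)) :
    Tendsto (fun k => ∫⁻ x, ‖φ k x‖ₑ) atTop (𝓝 0) := by
  refine ENNReal.tendsto_nhds_zero.2 fun ε hε => ?_
  have hε₂ : 0 < ε / 2 := ENNReal.half_pos hε.ne'
  obtain ⟨δ, hδG, hδ⟩ : ∃ δ : ℝ, ENNReal.ofReal δ * G ≤ ε / 2 ∧ 0 < δ := by
    have : Tendsto (fun δ : ℝ => ENNReal.ofReal δ * G) (𝓝[>] 0) (𝓝 0) := by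
      simpa using (ENNReal.Tendsto.mul_const (ENNReal.continuous_ofReal.tendsto 0)
        (Or.inr hG)).mono_left nhdsWithin_le_nhds
    exact ((ENNReal.tendsto_nhds_zero.1 this _ hε₂).and self_mem_nhdsWithin).exists
  set B := Metric.ball (0 : Space N) δ
  have hB₀ : volume B ≠ 0 := (Metric.measure_ball_pos _ _ hδ).ne'
  have hmean := tendsto_lintegral_enorm_setIntegral_ball hΩ hφ hC hφC fun x => hball x δ
  filter_upwards [ENNReal.tendsto_nhds_zero.1 hmean _ (ENNReal.mul_pos hB₀ hε₂.ne')] with k hk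
  refine (ENNReal.mul_le_mul_iff_right hB₀ measure_ball_lt_top.ne).1 ?_
  calc volume B * ∫⁻ x, ‖φ k x‖ₑ
      ≤ volume B * (ENNReal.ofReal δ * ∫⁻ x, ∑ i, ‖partialDeriv i (φ k) x‖ₑ) +
          ∫⁻ x, ‖∫ t in B, φ k (x + t)‖ₑ :=
        measure_ball_mul_lintegral_le ((hφ k).smooth.of_le (by exact_mod_cast le_top))
          (hφ k).compact
    _ ≤ volume B * (ε / 2) + volume B * (ε / 2) := by
        gcongr
        exact (mul_le_mul_right (hφG k) _).trans hδG
    _ = volume B * ε := by rw [← mul_add, ENNReal.add_halves]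

end Sequences

variable {p : ℝ≥0∞} [Fact (1 ≤ p)] {Ω : Set (Space N)}

theorem exists_lintegral_enorm_jetL_le (hΩ : MeasurableSet Ω) (hΩb : Bornology.IsBounded Ω) :
    ∃ V : ℝ≥0∞, V ≠ ∞ ∧ ∀ (y : W0 p Ω) (o : Option (Fin N)),
      ∫⁻ x, ‖jetL Ω o y x‖ₑ ≤ ‖y‖ₑ * V := by
  have hexp : 0 ≤ 1 / (1 : ℝ≥0∞).toReal - 1 / p.toReal := by
    rw [ENNReal.toReal_one, div_one, sub_nonneg]
    rcases eq_or_ne p ∞ with rfl | hp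
    · simp
    · have : 1 ≤ p.toReal := by simpa using ENNReal.toReal_mono hp (Fact.out : 1 ≤ p)
      exact div_le_one_of_le₀ this (by positivity)
  refine ⟨volume Ω ^ (1 / (1 : ℝ≥0∞).toReal - 1 / p.toReal),
    ENNReal.rpow_ne_top_of_nonneg hexp hΩb.measure_lt_top.ne, fun y o => ?_⟩
  have hsupp : (fun x => ‖jetL Ω o y x‖ₑ) =ᵐ[volume] Ω.indicator fun x => ‖jetL Ω o y x‖ₑ := by
    filter_upwards [jetL_ae_eq_zero hΩ y o] with x hx
    by_cases hxΩ : x ∈ Ω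
    · rw [indicator_of_mem hxΩ]
    · rw [indicator_of_notMem hxΩ, hx hxΩ, enorm_zero]
  have hnorm : eLpNorm (jetL Ω o y) p (volume.restrict Ω) ≤ ‖y‖ₑ := by
    refine (eLpNorm_mono_measure _ Measure.restrict_le_self).trans ?_
    rw [← Lp.enorm_def, enorm_le_iff_norm_le]
    exact PiLp.norm_apply_le (y : JetSpace N p) o
  have hHolder := eLpNorm_le_eLpNorm_mul_rpow_measure_univ (μ := volume.restrict Ω) (p := 1)
    (q := p) Fact.out (Lp.aestronglyMeasurable (jetL Ω o y)).restrict
  rw [eLpNorm_one_eq_lintegral_enorm, Measure.restrict_apply_univ] at hHolder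
  rw [lintegral_congr_ae hsupp, lintegral_indicator hΩ]
  exact hHolder.trans (mul_le_mul_left hnorm _)

theorem tendsto_setIntegral_jetL {u : ℕ → W0 p Ω} {a : W0 p Ω} (hu : WeaklyConverges u a)
    (o : Option (Fin N)) {A : Set (Space N)} (hA : MeasurableSet A) (hAfin : volume A ≠ ∞) :
    Tendsto (fun k => ∫ x in A, jetL Ω o (u k) x) atTop (𝓝 (∫ x in A, jetL Ω o a x)) := by
  let q := p.conjExponent
  have : Fact (1 ≤ q) := ⟨ENNReal.HolderConjugate.one_le q p⟩
  let χ : Lp ℝ q (volume : Measure (Space N)) := indicatorConstLp q hA hAfin 1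
  have hχ (y : W0 p Ω) :
      (toDualLp volume p q χ).comp (jetL Ω o) y = ∫ x in A, jetL Ω o y x := by
    rw [ContinuousLinearMap.comp_apply, toDualLp_apply, ← integral_indicator hA]
    refine integral_congr_ae ?_
    filter_upwards [indicatorConstLp_coeFn (p := q) (hs := hA) (hμs := hAfin) (c := (1 : ℝ))]
      with x hx
    rw [hx]
    by_cases hxA : x ∈ A <;> simp [hxA]
  simpa only [hχ] using hu ((toDualLp volume p q χ).comp (jetL Ω o))

theorem tendsto_lintegral_of_mem_testJets (hΩ : MeasurableSet Ω) (hΩb : Bornology.IsBounded Ω)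
    {ψ : ℕ → W0 p Ω} (htest : ∀ k, (ψ k : JetSpace N p) ∈ testJets p Ω)
    (hψ : WeaklyConverges ψ 0) :
    Tendsto (fun k => ∫⁻ x, ‖jetL Ω none (ψ k) x‖ₑ) atTop (𝓝 0) := by
  choose φ hφ hfun hgrad using htest
  obtain ⟨V, hV, hle⟩ := exists_lintegral_enorm_jetL_le (p := p) hΩ hΩb
  obtain ⟨K, hK⟩ := hψ.exists_norm_le
  let C : ℝ≥0∞ := ENNReal.ofReal K * V
  have hC : C ≠ ∞ := ENNReal.mul_ne_top ENNReal.ofReal_ne_top hV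
  have hjet (k : ℕ) (o : Option (Fin N)) : ∫⁻ x, ‖jetL Ω o (ψ k) x‖ₑ ≤ C := by
    refine (hle (ψ k) o).trans (mul_le_mul_left ?_ V)
    rw [← ofReal_norm]
    exact ENNReal.ofReal_le_ofReal (hK k)
  have hfun' (k : ℕ) : ∫⁻ x, ‖jetL Ω none (ψ k) x‖ₑ = ∫⁻ x, ‖φ k x‖ₑ :=
    lintegral_congr_ae ((hfun k).fun_comp (‖·‖ₑ))
  have hgrad' (k : ℕ) (i : Fin N) :
      ∫⁻ x, ‖jetL Ω (some i) (ψ k) x‖ₑ = ∫⁻ x, ‖partialDeriv i (φ k) x‖ₑ :=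
    lintegral_congr_ae ((hgrad k i).fun_comp (‖·‖ₑ))
  simp only [hfun']
  refine tendsto_lintegral_of_isTestFunction hΩb hφ hC (fun k => hfun' k ▸ hjet k none)
    (G := ∑ _i : Fin N, C) (by simp [ENNReal.mul_eq_top, hC]) (fun k => ?_) fun x δ => ?_
  · rw [lintegral_finsetSum _ fun i _ => ((hφ k).continuous_partialDeriv i).enorm.measurable]
    exact Finset.sum_le_sum fun i _ => hgrad' k i ▸ hjet k (some i)
  · have hlim := tendsto_setIntegral_jetL hψ none (measurableSet_ball (x := x) (ε := δ))
      measure_ball_lt_top.ne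
    have hzero : ∫ t in Metric.ball x δ, jetL Ω none (0 : W0 p Ω) t = 0 := by
      rw [map_zero, integral_congr_ae (ae_restrict_of_ae (Lp.coeFn_zero ℝ p volume))]
      simp
    rw [hzero] at hlim
    exact hlim.congr fun k => integral_congr_ae (ae_restrict_of_ae (hfun k))

theorem exists_tendsto_sub_mem_testJets (u : ℕ → W0 p Ω) :
    ∃ ψ : ℕ → W0 p Ω, (∀ k, (ψ k : JetSpace N p) ∈ testJets p Ω) ∧
      Tendsto (fun k => u k - ψ k) atTop (𝓝 0) := by
  have happrox (k : ℕ) : ∃ w ∈ testJets p Ω, dist (u k : JetSpace N p) w < 1 / ((k : ℝ) + 1) :=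
    Metric.mem_closure_iff.1 (u k).2 _ (by positivity)
  choose w hw hdist using happrox
  refine ⟨fun k => ⟨w k, subset_closure (hw k)⟩, hw, ?_⟩
  refine squeeze_zero_norm (fun k => ?_) (tendsto_one_div_add_atTop_nhds_zero_nat (𝕜 := ℝ))
  have := (hdist k).le
  rwa [dist_eq_norm] at this

theorem tendsto_lintegral_of_weaklyConverges_zero (hΩ : MeasurableSet Ω)
    (hΩb : Bornology.IsBounded Ω) {u : ℕ → W0 p Ω} (hu : WeaklyConverges u 0) :
    Tendsto (fun k => ∫⁻ x, ‖jetL Ω none (u k) x‖ₑ) atTop (𝓝 0) := by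
  obtain ⟨ψ, htest, hsub⟩ := exists_tendsto_sub_mem_testJets u
  have hψ : WeaklyConverges ψ 0 := fun ℓ => by
    simpa using (hu ℓ).sub (WeaklyConverges.of_tendsto hsub ℓ)
  obtain ⟨V, hV, hle⟩ := exists_lintegral_enorm_jetL_le (p := p) hΩ hΩb
  have hrem : Tendsto (fun k => ‖u k - ψ k‖ₑ * V) atTop (𝓝 0) := by
    have := ENNReal.Tendsto.mul_const (tendsto_zero_iff_enorm_tendsto_zero.1 hsub) (Or.inr hV)
    rwa [zero_mul] at this
  have hsum := hrem.add (tendsto_lintegral_of_mem_testJets hΩ hΩb htest hψ)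
  rw [add_zero] at hsum
  refine tendsto_of_tendsto_of_tendsto_of_le_of_le tendsto_const_nhds hsum (fun _ => zero_le)
    fun k => le_trans ?_ (add_le_add (hle (u k - ψ k) none) le_rfl)
  rw [← lintegral_add_right' _ (Lp.aestronglyMeasurable _).enorm, map_sub]
  refine lintegral_mono_ae ?_
  filter_upwards [Lp.coeFn_sub (jetL Ω none (u k)) (jetL Ω none (ψ k))] with x hx
  rw [hx, Pi.sub_apply]
  simpa only [sub_add_cancel] using
    enorm_add_le (jetL Ω none (u k) x - jetL Ω none (ψ k) x) (jetL Ω none (ψ k) x)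

theorem tendsto_lintegral_of_weaklyConverges (hΩ : MeasurableSet Ω) (hΩb : Bornology.IsBounded Ω)
    {y : ℕ → W0 p Ω} {y₀ : W0 p Ω} (hy : WeaklyConverges y y₀) :
    Tendsto (fun k => ∫⁻ x, ‖stateFun (y k) x - stateFun y₀ x‖ₑ) atTop (𝓝 0) := by
  have hzero : WeaklyConverges (fun k => y k - y₀) 0 := by simpa using hy.sub_const y₀
  refine (tendsto_lintegral_of_weaklyConverges_zero hΩ hΩb hzero).congr fun k => ?_
  rw [map_sub]
  exact lintegral_congr_ae ((Lp.coeFn_sub _ _).fun_comp (‖·‖ₑ))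

end Rellich

/-! ### Compactness of the set of admissible controls -/

section ConvergesAgainst

/-- Convergence of `∫ u k * w` to `∫ v * w` for all `w` in `L^q`. For bounded sequences in `L^∞` and
finite `q` on a finite measure space, this stands for weak-* convergence. -/
def ConvergesAgainst {α : Type*} [MeasurableSpace α] (μ : Measure α) (q : ℝ≥0∞) (u : ℕ → α → ℝ)
    (v : α → ℝ) : Prop :=
  ∀ w : α → ℝ, MemLp w q μ →
    Tendsto (fun k => ∫ x, u k x * w x ∂μ) atTop (𝓝 (∫ x, v x * w x ∂μ))

namespace ConvergesAgainst

variable {α : Type*} [MeasurableSpace α] {μ : Measure α} {p q : ℝ≥0∞} {u : ℕ → α → ℝ} {v : α → ℝ}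

theorem comp_strictMono (h : ConvergesAgainst μ q u v) {k : ℕ → ℕ} (hk : StrictMono k) :
    ConvergesAgainst μ q (fun n => u (k n)) v :=
  fun w hw => (h w hw).comp hk.tendsto_atTop

theorem congr_ae (h : ConvergesAgainst μ q u v) {u' : ℕ → α → ℝ} {v' : α → ℝ}
    (hu : ∀ k, u k =ᵐ[μ] u' k) (hv : v =ᵐ[μ] v') : ConvergesAgainst μ q u' v' := by
  intro w hw
  have hint {f g : α → ℝ} (hfg : f =ᵐ[μ] g) : ∫ x, f x * w x ∂μ = ∫ x, g x * w x ∂μ :=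
    integral_congr_ae (hfg.mul (ae_eq_refl w))
  rw [← hint hv]
  exact (h w hw).congr fun k => hint (hu k)

theorem neg (h : ConvergesAgainst μ q u v) :
    ConvergesAgainst μ q (fun k x => -u k x) fun x => -v x := by
  intro w hw
  simp only [neg_mul, integral_neg]
  exact (h w hw).neg

theorem of_weaklyConverges [Fact (1 ≤ p)] [Fact (1 ≤ q)] [p.HolderConjugate q] {z : ℕ → Lp ℝ p μ}
    {a : Lp ℝ p μ} (hz : WeaklyConverges z a) : ConvergesAgainst μ q (fun k => z k) a := by
  intro w hw
  have hpair (f : Lp ℝ p μ) : toDualLp μ p q hw.toLp f = ∫ x, f x * w x ∂μ := by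
    rw [toDualLp_apply]
    refine integral_congr_ae ?_
    filter_upwards [hw.coeFn_toLp] with x hx
    rw [hx, mul_comm]
  simpa only [hpair] using hz (toDualLp μ p q hw.toLp)

variable [IsFiniteMeasure μ]

theorem tendsto_setIntegral (h : ConvergesAgainst μ q u v) {s : Set α} (hs : MeasurableSet s) :
    Tendsto (fun k => ∫ x in s, u k x ∂μ) atTop (𝓝 (∫ x in s, v x ∂μ)) := by
  have hset (f : α → ℝ) : ∫ x, f x * s.indicator (fun _ => (1 : ℝ)) x ∂μ = ∫ x in s, f x ∂μ := by
    simp_rw [← integral_indicator hs, ← indicator_mul_right, mul_one]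
  simpa only [hset] using
    h _ (memLp_indicator_const q hs (1 : ℝ) (Or.inr (measure_ne_top μ s)))

theorem ae_eq (h : ConvergesAgainst μ q u v) {v' : α → ℝ} (h' : ConvergesAgainst μ q u v')
    (hv : Integrable v μ) (hv' : Integrable v' μ) : v =ᵐ[μ] v' :=
  hv.ae_eq_of_forall_setIntegral_eq _ _ hv' fun _ hs _ =>
    tendsto_nhds_unique (h.tendsto_setIntegral hs) (h'.tendsto_setIntegral hs)

end ConvergesAgainst

variable {α : Type*} [MeasurableSpace α] {μ : Measure α} [IsFiniteMeasure μ] {p q : ℝ≥0∞}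
  {h : α → ℝ}

theorem ae_le_sum_of_convergesAgainst {ι : Type*} [Fintype ι] {u : ι → ℕ → α → ℝ} {v : ι → α → ℝ}
    (hu : ∀ a k, Integrable (u a k) μ) (hv : ∀ a, Integrable (v a) μ)
    (hconv : ∀ a, ConvergesAgainst μ q (u a) (v a)) (c : ι → ℝ) (hh : Integrable h μ)
    (hle : ∀ k, ∀ᵐ x ∂μ, h x ≤ ∑ a, u a k x * c a) : ∀ᵐ x ∂μ, h x ≤ ∑ a, v a x * c a := by
  have hsum {f : ι → α → ℝ} (hf : ∀ a, Integrable (f a) μ) :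
      Integrable (fun x => ∑ a, f a x * c a) μ :=
    integrable_finsetSum _ fun a _ => (hf a).mul_const _
  have hset {f : ι → α → ℝ} (hf : ∀ a, Integrable (f a) μ) (s : Set α) :
      ∫ x in s, ∑ a, f a x * c a ∂μ = ∑ a, (∫ x in s, f a x ∂μ) * c a := by
    rw [integral_finsetSum _ fun a _ => ((hf a).mul_const _).integrableOn]
    exact Finset.sum_congr rfl fun a _ => integral_mul_const _ _
  refine ae_le_of_forall_setIntegral_le hh (hsum hv) fun s hs _ => ?_
  rw [hset hv]
  refine ge_of_tendsto' (tendsto_finsetSum _ fun a _ =>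
    ((hconv a).tendsto_setIntegral hs).mul_const (c a)) fun k => ?_
  rw [← hset (fun a => hu a k)]
  exact setIntegral_mono_ae hh.integrableOn (hsum fun a => hu a k).integrableOn (hle k)

theorem ae_le_bilin_of_convergesAgainst {ι : Type*} [Fintype ι] {u : ι → ι → ℕ → α → ℝ}
    {v : ι → ι → α → ℝ} (hu : ∀ i j k, Integrable (u i j k) μ) (hv : ∀ i j, Integrable (v i j) μ)
    (hconv : ∀ i j, ConvergesAgainst μ q (u i j) (v i j)) (a b : ι → ℝ) (hh : Integrable h μ)
    (hle : ∀ k, ∀ᵐ x ∂μ, h x ≤ ∑ i, ∑ j, u i j k x * a j * b i) :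
    ∀ᵐ x ∂μ, h x ≤ ∑ i, ∑ j, v i j x * a j * b i := by
  filter_upwards [ae_le_sum_of_convergesAgainst (ι := ι × ι) (fun e => hu e.1 e.2)
    (fun e => hv e.1 e.2) (fun e => hconv e.1 e.2) (fun e => a e.2 * b e.1) hh fun k =>
      (hle k).mono fun x hx => by simpa only [Fintype.sum_prod_type, mul_assoc] using hx] with x hx
  simpa only [Fintype.sum_prod_type, mul_assoc] using hx

theorem ae_le_of_convergesAgainst {u : ℕ → α → ℝ} {v : α → ℝ} (hu : ∀ k, Integrable (u k) μ)
    (hv : Integrable v μ) (hconv : ConvergesAgainst μ q u v) (hh : Integrable h μ)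
    (hle : ∀ k, h ≤ᵐ[μ] u k) : h ≤ᵐ[μ] v := by
  filter_upwards [ae_le_sum_of_convergesAgainst (ι := Unit) (fun _ => hu) (fun _ => hv)
    (fun _ => hconv) (fun _ => 1) hh fun k => (hle k).mono fun x hx => by simpa using hx] with x hx
  simpa using hx

theorem le_ae_of_convergesAgainst {u : ℕ → α → ℝ} {v : α → ℝ} (hu : ∀ k, Integrable (u k) μ)
    (hv : Integrable v μ) (hconv : ConvergesAgainst μ q u v) (hh : Integrable h μ)
    (hle : ∀ k, u k ≤ᵐ[μ] h) : v ≤ᵐ[μ] h := by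
  filter_upwards [ae_le_of_convergesAgainst (fun k => (hu k).neg) hv.neg hconv.neg hh.neg
    fun k => (hle k).mono fun x hx => neg_le_neg hx] with x hx
  exact neg_le_neg_iff.1 hx

theorem ae_abs_le_of_convergesAgainst {u : ℕ → α → ℝ} {v : α → ℝ} {β : ℝ}
    (hu : ∀ k, Integrable (u k) μ) (hv : Integrable v μ) (hconv : ConvergesAgainst μ q u v)
    (hle : ∀ k, ∀ᵐ x ∂μ, |u k x| ≤ β) : ∀ᵐ x ∂μ, |v x| ≤ β := by
  filter_upwards [
    ae_le_of_convergesAgainst hu hv hconv (integrable_const (-β)) fun k =>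
      (hle k).mono fun _ hx => (abs_le.1 hx).1,
    le_ae_of_convergesAgainst hu hv hconv (integrable_const β) fun k =>
      (hle k).mono fun _ hx => (abs_le.1 hx).2] with x hlower hupper
  exact abs_le.2 ⟨hlower, hupper⟩

theorem exists_convergesAgainst_subseq [Fact (1 ≤ p)] [Fact (1 ≤ q)] [p.HolderConjugate q]
    [MeasurableSpace.CountablyGenerated α] (hp : 2 ≤ p.toReal) {u : ℕ → Lp ℝ ∞ μ} {β : ℝ}
    (hu : ∀ k, ∀ᵐ x ∂μ, |u k x| ≤ β) :
    ∃ (v : Lp ℝ ∞ μ) (k : ℕ → ℕ), StrictMono k ∧ ConvergesAgainst μ q (fun n => u (k n)) v := by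
  have hp₁ : 1 < p.toReal := by linarith
  have : Fact (q ≠ ∞) := ⟨conjExponent_ne_top (p := p) hp₁⟩
  have hmem (k : ℕ) : MemLp (u k) p μ := (Lp.memLp (u k)).mono_exponent le_top
  have hbound (n : ℕ) : ‖(hmem n).toLp‖ ≤ (μ univ).toReal ^ p.toReal⁻¹ * max β 0 := by
    refine Lp.norm_le_of_ae_bound (le_max_right β 0) ?_
    filter_upwards [hu n, (hmem n).coeFn_toLp] with x hx hcoe
    rw [hcoe]
    exact hx.trans (le_max_left _ _)
  obtain ⟨a, k, hk, ha⟩ := exists_weaklyConverges_subseq_Lp q hp hbound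
  have hconv : ConvergesAgainst μ q (fun n => u (k n)) a :=
    (ConvergesAgainst.of_weaklyConverges ha).congr_ae (fun n => (hmem (k n)).coeFn_toLp)
      (ae_eq_refl _)
  have hab : ∀ᵐ x ∂μ, |a x| ≤ β :=
    ae_abs_le_of_convergesAgainst (fun n => (hmem (k n)).integrable Fact.out)
      ((Lp.memLp a).integrable Fact.out) hconv fun n => hu (k n)
  have htop : MemLp a ∞ μ := memLp_top_of_bound (Lp.aestronglyMeasurable a) β hab
  exact ⟨htop.toLp, k, hk, hconv.congr_ae (fun _ => ae_eq_refl _) htop.coeFn_toLp.symm⟩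

end ConvergesAgainst

section Controls

theorem exists_strictMono_forall {ι : Type*} [Finite ι] (R : ι → (ℕ → ℕ) → Prop)
    (hmono : ∀ i (k m : ℕ → ℕ), R i k → StrictMono m → R i (k ∘ m))
    (hex : ∀ i (k : ℕ → ℕ), StrictMono k → ∃ m : ℕ → ℕ, StrictMono m ∧ R i (k ∘ m)) :
    ∃ k : ℕ → ℕ, StrictMono k ∧ ∀ i, R i k := by
  classical
  cases nonempty_fintype ι
  suffices h : ∀ s : Finset ι, ∃ k : ℕ → ℕ, StrictMono k ∧ ∀ i ∈ s, R i k by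
    simpa using h Finset.univ
  intro s
  induction s using Finset.induction_on with
  | empty => exact ⟨id, strictMono_id, by simp⟩
  | insert a s ha ih =>
    obtain ⟨k, hk, hks⟩ := ih
    obtain ⟨m, hm, hma⟩ := hex a k hk
    refine ⟨k ∘ m, hk.comp hm, fun i hi => ?_⟩
    rcases Finset.mem_insert.1 hi with rfl | hi
    · exact hma
    · exact hmono i k m (hks i hi) hm

theorem exists_tendsto_subseq_pi {ι X : Type*} [Countable ι] [PseudoMetricSpace X] {Q : ι → Set X}
    (hQ : ∀ i, IsCompact (Q i)) {x : ℕ → ι → X} (hx : ∀ n i, x n i ∈ Q i) :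
    ∃ a : ι → X, (∀ i, a i ∈ Q i) ∧ ∃ k : ℕ → ℕ, StrictMono k ∧
      ∀ i, Tendsto (fun n => x (k n) i) atTop (𝓝 (a i)) := by
  obtain ⟨a, ha, k, hk, hlim⟩ :=
    (isCompact_univ_pi hQ).tendsto_subseq fun n => mem_univ_pi.2 (hx n)
  exact ⟨a, mem_univ_pi.1 ha, k, hk, tendsto_pi_nhds.1 hlim⟩

theorem ae_forall_le_of_forall_ae_le {α E : Type*} [MeasurableSpace α] {μ : Measure α}
    [TopologicalSpace E] [TopologicalSpace.SeparableSpace E] {F G : α → E → ℝ}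
    (hF : ∀ x, Continuous (F x)) (hG : ∀ x, Continuous (G x))
    (h : ∀ e, ∀ᵐ x ∂μ, F x e ≤ G x e) : ∀ᵐ x ∂μ, ∀ e, F x e ≤ G x e := by
  obtain ⟨s, hs, hd⟩ := TopologicalSpace.exists_countable_dense E
  filter_upwards [(ae_ball_iff hs).2 fun e _ => h e] with x hx e
  exact (isClosed_le (hF x) (hG x)).closure_subset_iff.2 hx (hd e)

theorem conjExponent_le {p q : ℝ≥0∞} [p.HolderConjugate q] (hp : 2 ≤ p.toReal) : q ≤ p := by
  have hp₁ : 1 < p.toReal := by linarith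
  rw [← ENNReal.toReal_le_toReal (conjExponent_ne_top hp₁) (ne_top_of_one_lt_toReal hp₁)]
  have hconj := (holderConjugate_toReal (q := q) hp₁).mul_eq_add
  nlinarith [ENNReal.toReal_nonneg (a := q)]

variable {N : ℕ} {p q : ℝ≥0∞} {D : Set (Space N)} {α β : ℝ} {ξ₁ ξ₂ : LpOn ∞ D}

theorem MemM.of_convergesAgainst (hp : 1 < p.toReal) (hD : volume D ≠ ∞) {U : ℕ → Control D}
    {V : Control D} (hU : ∀ k, MemM p α β (U k))
    (hconv : ∀ i j, ConvergesAgainst (volume.restrict D) q (fun k => U k i j) (V i j)) :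
    MemM p α β V := by
  have : IsFiniteMeasure (volume.restrict D) := isFiniteMeasure_restrict.2 hD
  have hsc := continuous_signedPow hp
  have hint (f : LpOn ∞ D) : Integrable f (volume.restrict D) := (Lp.memLp f).integrable le_top
  have hbilin (a b : Fin N → ℝ) {h : Space N → ℝ} (hh : Integrable h (volume.restrict D))
      (hle : ∀ k, ∀ᵐ x ∂(volume.restrict D), h x ≤ ∑ i, ∑ j, U k i j x * a j * b i) :
      ∀ᵐ x ∂(volume.restrict D), h x ≤ ∑ i, ∑ j, V i j x * a j * b i :=
    ae_le_bilin_of_convergesAgainst (fun i j k => hint (U k i j)) (fun i j => hint (V i j)) hconv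
      a b hh hle
  refine ⟨?_, fun i j => ?_, ?_, ?_⟩
  · ext1 i j
    have hconv' : ConvergesAgainst (volume.restrict D) q (fun k => U k i j) (V j i) := by
      simpa only [(hU _).symm.apply] using hconv j i
    exact Lp.ext (hconv'.ae_eq (hconv i j) (hint _) (hint _))
  · exact ae_abs_le_of_convergesAgainst (fun _ => hint _) (hint _) (hconv i j)
      fun k => (hU k).growth i j
  · suffices h : ∀ᵐ x ∂(volume.restrict D), ∀ e : (Fin N → ℝ) × (Fin N → ℝ), 0 ≤ ∑ i, ∑ j,
        V i j x * (signedPow p (e.1 j) - signedPow p (e.2 j)) * (e.1 i - e.2 i) from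
      h.mono fun x hx ζ η => hx (ζ, η)
    refine ae_forall_le_of_forall_ae_le (by fun_prop) (by fun_prop) fun e => ?_
    exact hbilin _ _ (integrable_const 0) fun k => (hU k).monotone.mono fun x hx => hx e.1 e.2
  · refine ae_forall_le_of_forall_ae_le (fun _ => ?_) (by fun_prop) fun ζ => ?_
    · exact continuous_const.mul (continuous_finsetSum _ fun k _ =>
        (continuous_apply k).abs.rpow_const fun _ => Or.inr (by linarith))
    · exact hbilin _ _ (integrable_const _) fun k => (hU k).coercive.mono fun x hx => hx ζ

theorem mem_Ub_of_convergesAgainst (hp : 1 < p.toReal) (hD : volume D ≠ ∞) {U : ℕ → Control D}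
    {V : Control D} (hU : ∀ k, U k ∈ Ub p α β ξ₁ ξ₂)
    (hconv : ∀ i j, ConvergesAgainst (volume.restrict D) q (fun k => U k i j) (V i j)) :
    V ∈ Ub p α β ξ₁ ξ₂ := by
  have : IsFiniteMeasure (volume.restrict D) := isFiniteMeasure_restrict.2 hD
  have hint (f : LpOn ∞ D) : Integrable f (volume.restrict D) := (Lp.memLp f).integrable le_top
  refine ⟨.of_convergesAgainst hp hD (fun k => (hU k).1) hconv, fun i j => ?_⟩
  exact (ae_le_of_convergesAgainst (fun _ => hint _) (hint _) (hconv i j) (hint ξ₁)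
    fun k => ((hU k).2 i j).mono fun _ hx => hx.1).and
    (le_ae_of_convergesAgainst (fun _ => hint _) (hint _) (hconv i j) (hint ξ₂)
    fun k => ((hU k).2 i j).mono fun _ hx => hx.2)

variable [Fact (1 ≤ p)] [p.HolderConjugate q]

theorem isDivergence_of_convergesAgainst (hp : 2 ≤ p.toReal) (hD : volume D ≠ ∞)
    {u : ℕ → Fin N → LpOn ∞ D} {v : Fin N → LpOn ∞ D} {ℓ : ℕ → WDual p D} {ℓ₀ : WDual p D}
    (hconv : ∀ i, ConvergesAgainst (volume.restrict D) q (fun k => u k i) (v i))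
    (hu : ∀ k, IsDivergence (u k) (ℓ k)) (hℓ : Tendsto ℓ atTop (𝓝 ℓ₀)) : IsDivergence v ℓ₀ := by
  have : IsFiniteMeasure (volume.restrict D) := isFiniteMeasure_restrict.2 hD
  intro φ
  have hgrad (i : Fin N) : MemLp (stateGrad φ i) q (volume.restrict D) :=
    ((Lp.memLp (jetL D (some i) φ)).restrict D).mono_exponent (conjExponent_le hp)
  have hsum (w : Fin N → LpOn ∞ D) : ∫ x in D, ∑ k, w k x * stateGrad φ k x =
      ∑ k, ∫ x in D, w k x * stateGrad φ k x :=
    integral_finsetSum _ fun k _ =>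
      ((Lp.memLp (w k)).mono_exponent (p := p) le_top).integrable_mul (hgrad k)
  have hlim : Tendsto (fun k => ℓ k φ) atTop (𝓝 (ℓ₀ φ)) :=
    ((ContinuousLinearMap.apply ℝ ℝ φ).continuous.tendsto _).comp hℓ
  refine tendsto_nhds_unique hlim ?_
  rw [hsum]
  refine (tendsto_finsetSum _ fun i _ => hconv i _ (hgrad i)).neg.congr fun k => ?_
  rw [hu k φ, hsum]

variable [Fact (1 ≤ q)]

theorem exists_convergesAgainst_subseq_of_mem_Ub (hp : 2 ≤ p.toReal) (hD : volume D ≠ ∞)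
    {U : ℕ → Control D} (hU : ∀ k, U k ∈ Ub p α β ξ₁ ξ₂) :
    ∃ V ∈ Ub p α β ξ₁ ξ₂, ∃ k : ℕ → ℕ, StrictMono k ∧
      ∀ i j, ConvergesAgainst (volume.restrict D) q (fun n => U (k n) i j) (V i j) := by
  have : IsFiniteMeasure (volume.restrict D) := isFiniteMeasure_restrict.2 hD
  obtain ⟨k, hk, hlim⟩ := exists_strictMono_forall
    (fun (e : Fin N × Fin N) k => ∃ v : LpOn ∞ D,
      ConvergesAgainst (volume.restrict D) q (fun n => U (k n) e.1 e.2) v)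
    (fun _ _ _ ⟨v, hv⟩ hm => ⟨v, hv.comp_strictMono hm⟩)
    fun e k _ => by
      obtain ⟨v, m, hm, hv⟩ := exists_convergesAgainst_subseq (p := p) (q := q) hp
        (u := fun n => U (k n) e.1 e.2) fun n => (hU (k n)).1.growth e.1 e.2
      exact ⟨m, hm, v, hv⟩
  choose V hV using fun i j => hlim (i, j)
  exact ⟨V, mem_Ub_of_convergesAgainst (by linarith) hD (fun n => hU (k n)) hV, k, hk, hV⟩

theorem exists_convergesAgainst_subseq_of_mem_Usol (hp : 2 ≤ p.toReal) (hD : volume D ≠ ∞)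
    {Q : Fin N → Set (WDual p D)} (hQ : ∀ i, IsCompact (Q i)) {U : ℕ → Control D}
    (hU : ∀ k, U k ∈ Ub p α β ξ₁ ξ₂ ∩ Usol p α β Q) :
    ∃ V ∈ Ub p α β ξ₁ ξ₂ ∩ Usol p α β Q, ∃ k : ℕ → ℕ, StrictMono k ∧
      (∀ i j, ConvergesAgainst (volume.restrict D) q (fun n => U (k n) i j) (V i j)) ∧
      ∀ i, ∃ (ℓ : ℕ → WDual p D) (ℓ₀ : WDual p D), Tendsto ℓ atTop (𝓝 ℓ₀) ∧
        (∀ n, IsDivergence (fun a => U (k n) a i) (ℓ n)) ∧ IsDivergence (fun a => V a i) ℓ₀ := by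
  choose ℓ hℓQ hℓ using fun k => (hU k).2.2
  obtain ⟨V, hVb, k, hk, hV⟩ :=
    exists_convergesAgainst_subseq_of_mem_Ub (q := q) hp hD fun n => (hU n).1
  obtain ⟨ℓ₀, hℓ₀Q, m, hm, hℓ₀⟩ := exists_tendsto_subseq_pi hQ fun n => hℓQ (k n)
  have hconv (i j : Fin N) := (hV i j).comp_strictMono hm
  have hdiv (i : Fin N) : IsDivergence (fun a => V a i) (ℓ₀ i) :=
    isDivergence_of_convergesAgainst hp hD (fun a => hconv a i) (fun n => hℓ _ i) (hℓ₀ i)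
  exact ⟨V, ⟨hVb, hVb.1, fun i => ⟨ℓ₀ i, hℓ₀Q i, hdiv i⟩⟩, fun n => k (m n), hk.comp hm, hconv,
    fun i => ⟨fun n => ℓ (k (m n)) i, ℓ₀ i, hℓ₀ i, fun n => hℓ _ i, hdiv i⟩⟩

end Controls

/-! ### The div-curl lemma -/

section DivCurl

theorem tendsto_integral_mul_of_tendsto_lintegral {α : Type*} [MeasurableSpace α] {μ : Measure α}
    {w f : ℕ → α → ℝ} {K : ℝ} (hw : ∀ k, ∀ᵐ x ∂μ, |w k x| ≤ K)
    (hf : Tendsto (fun k => ∫⁻ x, ‖f k x‖ₑ ∂μ) atTop (𝓝 0)) :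
    Tendsto (fun k => ∫ x, w k x * f k x ∂μ) atTop (𝓝 0) := by
  rw [tendsto_zero_iff_enorm_tendsto_zero]
  have hlim := ENNReal.Tendsto.const_mul (a := ENNReal.ofReal K) hf (Or.inr ENNReal.ofReal_ne_top)
  rw [mul_zero] at hlim
  refine tendsto_of_tendsto_of_tendsto_of_le_of_le tendsto_const_nhds hlim
    (fun _ => zero_le) fun k => (enorm_integral_le_lintegral_enorm _).trans ?_
  rw [← lintegral_const_mul' _ _ ENNReal.ofReal_ne_top]
  refine lintegral_mono_ae ?_
  filter_upwards [hw k] with x hx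
  rw [enorm_mul, Real.enorm_eq_ofReal_abs]
  gcongr

variable {N : ℕ} {p : ℝ≥0∞} {Ω D S : Set (Space N)} {φ : Space N → ℝ}

theorem IsTestFunction.eq_zero (hφ : IsTestFunction Ω φ) {x : Space N} (hx : x ∉ Ω) : φ x = 0 :=
  image_eq_zero_of_notMem_tsupport fun h => hx (hφ.support h)

theorem IsTestFunction.setIntegral_mul_eq (hφ : IsTestFunction Ω φ) (hΩ : MeasurableSet Ω)
    (hΩD : Ω ⊆ D) (f : Space N → ℝ) : ∫ x in Ω, f x * φ x = ∫ x in D, f x * φ x := by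
  rw [← setIntegral_eq_integral_of_forall_compl_eq_zero (s := Ω) (μ := volume.restrict D)
    fun x hx => by rw [hφ.eq_zero hx, mul_zero], Measure.restrict_restrict hΩ,
    inter_eq_left.2 hΩD]

theorem restrictLp_coeFn {r : ℝ≥0∞} (hΩD : Ω ⊆ D) (g : LpOn r D) :
    restrictLp hΩD g =ᵐ[volume.restrict Ω] g :=
  MemLp.coeFn_toLp _

variable [Fact (1 ≤ p)]

theorem eq_of_forall_integral_mul_eq (hΩ : IsOpen Ω) {a b : LpOn p Ω}
    (h : ∀ φ : Space N → ℝ, IsTestFunction Ω φ → ∫ x in Ω, a x * φ x = ∫ x in Ω, b x * φ x) :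
    a = b := by
  have hloc (c : LpOn p Ω) : LocallyIntegrable c (volume.restrict Ω) :=
    (Lp.memLp c).locallyIntegrable Fact.out
  have hzero : ∀ᵐ x, x ∈ Ω → a x - b x = 0 := by
    refine hΩ.ae_eq_zero_of_integral_contDiff_smul_eq_zero
      (locallyIntegrableOn_of_locallyIntegrable_restrict ((hloc a).sub (hloc b)))
      fun φ hsmooth hcompact hsupport => ?_
    have hφ : IsTestFunction Ω φ := ⟨hsmooth, hcompact, hsupport⟩
    have hint (c : LpOn p Ω) : Integrable (fun x => φ x • c x) (volume.restrict Ω) :=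
      (hloc c).integrable_smul_left_of_hasCompactSupport hsmooth.continuous hcompact
    rw [← setIntegral_eq_integral_of_forall_compl_eq_zero (s := Ω)
      fun x hx => by rw [hφ.eq_zero hx, zero_smul]]
    simp_rw [smul_sub]
    rw [integral_sub (hint a) (hint b), sub_eq_zero]
    simpa only [smul_eq_mul, mul_comm] using h φ hφ
  refine Lp.ext ?_
  filter_upwards [(ae_restrict_iff' hΩ.measurableSet).2 hzero] with x hx
  exact sub_eq_zero.1 hx

theorem weaklyConverges_of_tendsto_integral_mul (hp : 2 ≤ p.toReal) (hΩ : IsOpen Ω)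
    {z : ℕ → LpOn p Ω} {a : LpOn p Ω} {C : ℝ} (hz : ∀ n, ‖z n‖ ≤ C)
    (h : ∀ φ : Space N → ℝ, IsTestFunction Ω φ →
      Tendsto (fun k => ∫ x in Ω, z k x * φ x) atTop (𝓝 (∫ x in Ω, a x * φ x))) :
    WeaklyConverges z a := by
  have : Fact (1 ≤ p.conjExponent) := ⟨ENNReal.HolderConjugate.one_le p.conjExponent p⟩
  have : Fact (p.conjExponent ≠ ∞) := ⟨conjExponent_ne_top (p := p) (by linarith)⟩
  refine WeaklyConverges.of_subseq fun k hk => ?_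
  obtain ⟨b, m, hm, hb⟩ :=
    exists_weaklyConverges_subseq_Lp p.conjExponent hp fun n => hz (k n)
  refine ⟨m, hm, ?_⟩
  suffices b = a by rwa [← this]
  refine eq_of_forall_integral_mul_eq hΩ fun φ hφ => ?_
  exact tendsto_nhds_unique
    (ConvergesAgainst.of_weaklyConverges hb φ ((hφ.memLp p.conjExponent).restrict Ω))
    ((h φ hφ).comp (hk.comp hm).tendsto_atTop)

/-- The bounded operator `y ↦ (u, ∇y)` from `W_0^{1,p}(Ω)` to `L^p(Ω)`, for a bounded vector
field `u`. -/
noncomputable def gradAlong (hΩD : Ω ⊆ D) (u : Fin N → LpOn ∞ D) : W0 p Ω →L[ℝ] LpOn p Ω :=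
  ∑ i, (mulLp (restrictLp hΩD (u i))).comp (jetOn Ω Ω (some i))

theorem gradAlong_coeFn (hΩD : Ω ⊆ D) (u : Fin N → LpOn ∞ D) (y : W0 p Ω) :
    gradAlong hΩD u y =ᵐ[volume.restrict Ω] fun x => ∑ i, u i x * stateGrad y i x := by
  have hterm (i : Fin N) : mulLp (restrictLp hΩD (u i)) (jetOn Ω Ω (some i) y)
      =ᵐ[volume.restrict Ω] fun x => u i x * stateGrad y i x := by
    filter_upwards [mulLp_coeFn (restrictLp hΩD (u i)) (jetOn Ω Ω (some i) y),
      restrictLp_coeFn hΩD (u i), jetOn_coeFn Ω (some i) y] with x hmul hres hjet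
    rw [hmul, hres, hjet, jetL_some]
  rw [gradAlong, sum_apply]
  filter_upwards [Lp.coeFn_finsetSum Finset.univ
    (fun i => ((mulLp (restrictLp hΩD (u i))).comp (jetOn Ω Ω (some i))) y),
    ae_all_iff.2 hterm] with x hsum hx
  rw [hsum, Finset.sum_apply]
  exact Finset.sum_congr rfl fun i _ => hx i

theorem exists_norm_gradAlong_le (hΩD : Ω ⊆ D) {β : ℝ} (hβ : 0 ≤ β) :
    ∃ K, ∀ (u : Fin N → LpOn ∞ D) (y : W0 p Ω),
      (∀ i, ∀ᵐ x ∂(volume.restrict D), |u i x| ≤ β) → ‖gradAlong hΩD u y‖ ≤ K * ‖y‖ := by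
  refine ⟨∑ i, β * ‖(jetOn Ω Ω (some i) : W0 p Ω →L[ℝ] LpOn p Ω)‖, fun u y hu => ?_⟩
  rw [gradAlong, sum_apply, Finset.sum_mul]
  refine norm_sum_le_of_le _ fun i _ => ?_
  rw [mul_assoc]
  refine le_trans ?_ (mul_le_mul_of_nonneg_left (ContinuousLinearMap.le_opNorm _ y) hβ)
  refine Lp.norm_le_mul_norm_of_ae_le_mul ?_
  filter_upwards [mulLp_coeFn (restrictLp hΩD (u i)) (jetOn Ω Ω (some i) y),
    restrictLp_coeFn hΩD (u i), ae_restrict_of_ae_restrict_of_subset hΩD (hu i)]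
    with x hmul hres hx
  rw [ContinuousLinearMap.comp_apply, hmul, norm_mul, hres]
  exact mul_le_mul_of_nonneg_right hx (norm_nonneg _)

section ConjugateExponent

variable {q : ℝ≥0∞} [p.HolderConjugate q]

theorem memLp_partialDeriv_mul_stateFun (hp : 2 ≤ p.toReal) (hD : volume D ≠ ∞)
    (hφ : IsTestFunction S φ) (y : W0 p Ω) (i : Fin N) :
    MemLp (fun x => partialDeriv i φ x * stateFun y x) q (volume.restrict D) := by
  have : IsFiniteMeasure (volume.restrict D) := isFiniteMeasure_restrict.2 hD
  have hy : MemLp (stateFun y) p volume := Lp.memLp (jetL Ω none y)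
  exact ((hy.mul (p := ∞) (hφ.memLp_partialDeriv i ∞)).restrict D).mono_exponent
    (conjExponent_le hp)

theorem memLp_mul_stateGrad (hp : 2 ≤ p.toReal) (hD : volume D ≠ ∞)
    (hφ : IsTestFunction S φ) (y : W0 p Ω) (i : Fin N) :
    MemLp (fun x => φ x * stateGrad y i x) q (volume.restrict D) := by
  have : IsFiniteMeasure (volume.restrict D) := isFiniteMeasure_restrict.2 hD
  have hy : MemLp (stateGrad y i) p volume := Lp.memLp (jetL Ω (some i) y)
  exact ((hy.mul (p := ∞) (hφ.memLp ∞)).restrict D).mono_exponent (conjExponent_le hp)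

end ConjugateExponent

/-- Integration by parts: `(u, ∇y) φ = (u, ∇(φ y)) - (u, ∇φ) y`. -/
theorem integral_gradAlong_mul (hp : 2 ≤ p.toReal) (hΩ : MeasurableSet Ω) (hD : volume D ≠ ∞)
    (hΩD : Ω ⊆ D) {u : Fin N → LpOn ∞ D} {ℓ : WDual p D} (hu : IsDivergence u ℓ)
    (hφ : IsTestFunction Ω φ) (y : W0 p Ω) :
    ∫ x in Ω, gradAlong hΩD u y x * φ x = -ℓ (inclusionW0 hΩD (mulTest hφ y)) -
      ∑ i, ∫ x in D, u i x * (partialDeriv i φ x * stateFun y x) := by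
  have : IsFiniteMeasure (volume.restrict D) := isFiniteMeasure_restrict.2 hD
  have hui (i : Fin N) : MemLp (u i) p (volume.restrict D) := (Lp.memLp (u i)).mono_exponent le_top
  have hint_fun (i : Fin N) : Integrable (fun x => u i x * (partialDeriv i φ x * stateFun y x))
      (volume.restrict D) :=
    (hui i).integrable_mul (memLp_partialDeriv_mul_stateFun (q := p.conjExponent) hp hD hφ y i)
  have hint_grad (i : Fin N) : Integrable (fun x => u i x * (φ x * stateGrad y i x))
      (volume.restrict D) :=
    (hui i).integrable_mul (memLp_mul_stateGrad (q := p.conjExponent) hp hD hφ y i)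
  have hleft : ∫ x in Ω, gradAlong hΩD u y x * φ x =
      ∫ x in D, ∑ i, u i x * (φ x * stateGrad y i x) := by
    calc ∫ x in Ω, gradAlong hΩD u y x * φ x
        = ∫ x in Ω, (∑ i, u i x * stateGrad y i x) * φ x :=
          integral_congr_ae ((gradAlong_coeFn hΩD u y).mul (ae_eq_refl φ))
      _ = ∫ x in D, (∑ i, u i x * stateGrad y i x) * φ x := hφ.setIntegral_mul_eq hΩ hΩD _
      _ = ∫ x in D, ∑ i, u i x * (φ x * stateGrad y i x) := by
          simp only [Finset.sum_mul, mul_assoc, mul_comm (φ _)]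
  rw [hu, neg_neg, hleft, ← integral_finsetSum _ fun i _ => hint_fun i, eq_sub_iff_add_eq,
    ← integral_add (integrable_finsetSum _ fun i _ => hint_grad i)
      (integrable_finsetSum _ fun i _ => hint_fun i)]
  refine integral_congr_ae ?_
  filter_upwards [ae_all_iff.2 fun i => ae_restrict_of_ae (s := D) (stateGrad_mulTest hφ y i)]
    with x hx
  rw [← Finset.sum_add_distrib]
  refine Finset.sum_congr rfl fun i _ => ?_
  change _ = u i x * stateGrad (mulTest hφ y) i x
  rw [hx i, mul_add]

variable {q : ℝ≥0∞} [p.HolderConjugate q]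

theorem tendsto_integral_mul_partialDeriv (hp : 2 ≤ p.toReal)
    (hΩ : MeasurableSet Ω) (hΩb : Bornology.IsBounded Ω) (hD : volume D ≠ ∞)
    {u : ℕ → LpOn ∞ D} {v : LpOn ∞ D} {β : ℝ}
    (hub : ∀ k, ∀ᵐ x ∂(volume.restrict D), |u k x| ≤ β)
    (hu : ConvergesAgainst (volume.restrict D) q (fun k => u k) v)
    (hφ : IsTestFunction S φ) (i : Fin N) {y : ℕ → W0 p Ω} {y₀ : W0 p Ω}
    (hy : WeaklyConverges y y₀) :
    Tendsto (fun k => ∫ x in D, u k x * (partialDeriv i φ x * stateFun (y k) x)) atTop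
      (𝓝 (∫ x in D, v x * (partialDeriv i φ x * stateFun y₀ x))) := by
  have : IsFiniteMeasure (volume.restrict D) := isFiniteMeasure_restrict.2 hD
  have hint (k : ℕ) (z : W0 p Ω) : Integrable
      (fun x => u k x * (partialDeriv i φ x * stateFun z x)) (volume.restrict D) :=
    ((Lp.memLp (u k)).mono_exponent (p := p) le_top).integrable_mul
      (memLp_partialDeriv_mul_stateFun (q := q) hp hD hφ z i)
  obtain ⟨M, hM⟩ := (hφ.continuous_partialDeriv i).bounded_above_of_compact_support
    (hφ.compact.fderiv_apply (𝕜 := ℝ) (EuclideanSpace.single i 1))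
  have hrellich : Tendsto (fun k => ∫⁻ x in D, ‖stateFun (y k) x - stateFun y₀ x‖ₑ) atTop (𝓝 0) :=
    tendsto_of_tendsto_of_tendsto_of_le_of_le tendsto_const_nhds
      (tendsto_lintegral_of_weaklyConverges hΩ hΩb hy) (fun _ => zero_le)
      fun _ => setLIntegral_le_lintegral D _
  have hdiff := tendsto_integral_mul_of_tendsto_lintegral (K := β * M)
    (w := fun k x => u k x * partialDeriv i φ x) (fun k => by
      filter_upwards [hub k] with x hx
      rw [abs_mul]
      exact mul_le_mul hx (hM x) (abs_nonneg _) ((abs_nonneg _).trans hx)) hrellich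
  have hlim := hdiff.add (hu _ (memLp_partialDeriv_mul_stateFun (q := q) hp hD hφ y₀ i))
  rw [zero_add] at hlim
  refine hlim.congr fun k => ?_
  rw [← eq_sub_iff_add_eq, ← integral_sub (hint k _) (hint k _)]
  exact integral_congr_ae (Eventually.of_forall fun x => by ring)

/-- The product `(u k, ∇y k)` of two weakly convergent sequences passes to the limit because the
divergences of `u k` converge strongly. -/
theorem weaklyConverges_gradAlong (hp : 2 ≤ p.toReal) (hΩ : IsOpen Ω)
    (hΩb : Bornology.IsBounded Ω) (hD : volume D ≠ ∞) (hΩD : Ω ⊆ D)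
    {u : ℕ → Fin N → LpOn ∞ D} {v : Fin N → LpOn ∞ D} {β : ℝ}
    (hub : ∀ k i, ∀ᵐ x ∂(volume.restrict D), |u k i x| ≤ β)
    (hu : ∀ i, ConvergesAgainst (volume.restrict D) q (fun k => u k i) (v i))
    {ℓ : ℕ → WDual p D} {ℓ₀ : WDual p D} (hℓ : Tendsto ℓ atTop (𝓝 ℓ₀))
    (hdiv : ∀ k, IsDivergence (u k) (ℓ k)) (hdiv₀ : IsDivergence v ℓ₀)
    {y : ℕ → W0 p Ω} {y₀ : W0 p Ω} (hy : WeaklyConverges y y₀) :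
    WeaklyConverges (fun k => gradAlong hΩD (u k) (y k)) (gradAlong hΩD v y₀) := by
  obtain ⟨K, hK⟩ := exists_norm_gradAlong_le (p := p) (Ω := Ω) hΩD (le_max_right β 0)
  obtain ⟨C, hC⟩ := hy.exists_norm_le
  have hbound (k : ℕ) : ‖gradAlong hΩD (u k) (y k)‖ ≤ |K| * C :=
    (hK _ _ fun i => (hub k i).mono fun _ hx => hx.trans (le_max_left β 0)).trans
      (mul_le_mul (le_abs_self K) (hC k) (norm_nonneg _) (abs_nonneg K))
  refine weaklyConverges_of_tendsto_integral_mul hp hΩ hbound fun φ hφ => ?_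
  simp only [integral_gradAlong_mul hp hΩ.measurableSet hD hΩD hdiv₀ hφ,
    fun k => integral_gradAlong_mul hp hΩ.measurableSet hD hΩD (hdiv k) hφ]
  exact ((hy.map (mulTest hφ)).map (inclusionW0 hΩD) |>.tendsto_apply hℓ).neg.sub
    (tendsto_finsetSum _ fun i _ => tendsto_integral_mul_partialDeriv hp hΩ.measurableSet
      hΩb hD (fun k => hub k i) (hu i) hφ i hy)

end DivCurl

/-! ### The elliptic equation -/

section Elliptic

variable {N : ℕ} {p q : ℝ≥0∞} [Fact (1 ≤ p)] {Ω D : Set (Space N)}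

theorem sum_mul_gradAlong_ae_eq (hΩD : Ω ⊆ D) (U : Control D) (w : Fin N → LpOn q Ω)
    (v : W0 p Ω) : (fun x => ∑ j, w j x * gradAlong hΩD (fun i => U i j) v x)
      =ᵐ[volume.restrict Ω] fun x => ∑ i, ∑ j, U i j x * w j x * stateGrad v i x := by
  filter_upwards [ae_all_iff.2 fun j => gradAlong_coeFn hΩD (fun i => U i j) v] with x hx
  rw [Finset.sum_comm]
  refine Finset.sum_congr rfl fun j _ => ?_
  rw [hx j, Finset.mul_sum]
  exact Finset.sum_congr rfl fun i _ => by ring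

variable [p.HolderConjugate q]

theorem integrable_mul_gradAlong (hΩD : Ω ⊆ D) (u : Fin N → LpOn ∞ D) (w : LpOn q Ω) (v : W0 p Ω) :
    Integrable (fun x => w x * gradAlong hΩD u v x) (volume.restrict Ω) :=
  MemLp.integrable_mul (p := q) (q := p) (Lp.memLp w) (Lp.memLp _)

theorem integrable_sum_mul_stateGrad (hΩD : Ω ⊆ D) (U : Control D) (w : Fin N → LpOn q Ω)
    (v : W0 p Ω) : Integrable (fun x => ∑ i, ∑ j, U i j x * w j x * stateGrad v i x)
      (volume.restrict Ω) :=
  (integrable_finsetSum _ fun j _ => integrable_mul_gradAlong hΩD _ (w j) v).congr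
    (sum_mul_gradAlong_ae_eq hΩD U w v)

theorem powLp_jetOn_coeFn (hp : 1 < p.toReal) (y : W0 p Ω) (o : Option (Fin N)) :
    powLp q hp (jetOn Ω Ω o y) =ᵐ[volume.restrict Ω] fun x => signedPow p (jetL Ω o y x) := by
  filter_upwards [powLp_coeFn (q := q) hp (jetOn Ω Ω o y), jetOn_coeFn Ω o y] with x hpow hjet
  rw [hpow, hjet]

variable [Fact (1 ≤ q)]

theorem sum_toDualLp_gradAlong (hΩD : Ω ⊆ D) (U : Control D) (w : Fin N → LpOn q Ω)
    (v : W0 p Ω) :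
    ∑ j, toDualLp (volume.restrict Ω) p q (w j) (gradAlong hΩD (fun i => U i j) v) =
      ∫ x in Ω, ∑ i, ∑ j, U i j x * w j x * stateGrad v i x := by
  rw [← integral_congr_ae (sum_mul_gradAlong_ae_eq hΩD U w v),
    integral_finsetSum _ fun j _ => integrable_mul_gradAlong hΩD _ (w j) v]
  exact Finset.sum_congr rfl fun j _ => toDualLp_apply _ _

/-- The operator `y ↦ -div(U [(∇y)^{p-2}] ∇y) + |y|^{p-2} y` from `W_0^{1,p}(Ω)` to its dual. -/
noncomputable def ellipticOp (q : ℝ≥0∞) [Fact (1 ≤ q)] [p.HolderConjugate q] (hp : 1 < p.toReal)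
    (hΩD : Ω ⊆ D) (U : Control D) (y : W0 p Ω) : WDual p Ω :=
  ∑ j, (toDualLp (volume.restrict Ω) p q (powLp q hp (jetOn Ω Ω (some j) y))).comp
      (gradAlong hΩD fun i => U i j) +
    (toDualLp (volume.restrict Ω) p q (powLp q hp (jetOn Ω Ω none y))).comp (jetOn Ω Ω none)

theorem ellipticOp_apply (hp : 1 < p.toReal) (hΩD : Ω ⊆ D) (U : Control D) (y v : W0 p Ω) :
    ellipticOp q hp hΩD U y v =
      ∑ j, toDualLp (volume.restrict Ω) p q (powLp q hp (jetOn Ω Ω (some j) y))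
        (gradAlong hΩD (fun i => U i j) v) +
      toDualLp (volume.restrict Ω) p q (powLp q hp (jetOn Ω Ω none y)) (jetOn Ω Ω none v) := by
  simp only [ellipticOp, add_apply, sum_apply, ContinuousLinearMap.comp_apply]

theorem isWeakSolution_iff (hp : 1 < p.toReal) (hΩD : Ω ⊆ D) (f : WDual p D) (U : Control D)
    (y : W0 p Ω) :
    IsWeakSolution hΩD f U y ↔ ellipticOp q hp hΩD U y = f.comp (inclusionW0 hΩD) := by
  rw [ContinuousLinearMap.ext_iff]
  refine forall_congr' fun v => ?_
  have hgrad : ∫ x in Ω, ∑ i, ∑ j, U i j x * powLp q hp (jetOn Ω Ω (some j) y) x * stateGrad v i x =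
      ∫ x in Ω, ∑ i, ∑ j, U i j x * signedPow p (stateGrad y j x) * stateGrad v i x := by
    refine integral_congr_ae ?_
    filter_upwards [ae_all_iff.2 fun j => powLp_jetOn_coeFn (q := q) hp y (some j)] with x hx
    simp only [hx, jetL_some]
  have hfun : ∫ x in Ω, powLp q hp (jetOn Ω Ω none y) x * jetOn Ω Ω none v x =
      ∫ x in Ω, signedPow p (stateFun y x) * stateFun v x := by
    refine integral_congr_ae ?_
    filter_upwards [powLp_jetOn_coeFn (q := q) hp y none, jetOn_coeFn Ω none v] with x hpow hjet
    rw [hpow, hjet, jetL_none, jetL_none]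
  rw [ellipticOp_apply, sum_toDualLp_gradAlong, toDualLp_apply, hgrad, hfun]
  rfl

variable {α β : ℝ} {U : Control D}

theorem sum_toDualLp_sub_gradAlong_nonneg (hp : 1 < p.toReal) (hΩD : Ω ⊆ D) (hU : MemM p α β U)
    (y z : W0 p Ω) :
    0 ≤ ∑ j, toDualLp (volume.restrict Ω) p q
      (powLp q hp (jetOn Ω Ω (some j) y) - powLp q hp (jetOn Ω Ω (some j) z))
      (gradAlong hΩD (fun i => U i j) (y - z)) := by
  rw [sum_toDualLp_gradAlong]
  refine integral_nonneg_of_ae ?_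
  have hpow (j : Fin N) : (powLp q hp (jetOn Ω Ω (some j) y) - powLp q hp (jetOn Ω Ω (some j) z) :
      LpOn q Ω) =ᵐ[volume.restrict Ω]
      fun x => signedPow p (stateGrad y j x) - signedPow p (stateGrad z j x) :=
    (Lp.coeFn_sub _ _).trans
      ((powLp_jetOn_coeFn hp y (some j)).sub (powLp_jetOn_coeFn hp z (some j)))
  have hgrad (i : Fin N) : stateGrad (y - z) i =ᵐ[volume.restrict Ω]
      fun x => stateGrad y i x - stateGrad z i x :=
    ae_restrict_of_ae (Lp.coeFn_sub (jetL Ω (some i) y) (jetL Ω (some i) z))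
  filter_upwards [ae_all_iff.2 hpow, ae_all_iff.2 hgrad,
    ae_restrict_of_ae_restrict_of_subset hΩD hU.monotone] with x hpow hgrad hmono
  simp only [hpow, hgrad]
  exact hmono (fun i => stateGrad y i x) fun i => stateGrad z i x

theorem toDualLp_powLp_sub_apply_sub_nonneg {X : Type*} [MeasurableSpace X] {μ : Measure X}
    (hp : 1 < p.toReal) (f g : Lp ℝ p μ) :
    0 ≤ toDualLp μ p q (powLp q hp f - powLp q hp g) (f - g) := by
  rw [toDualLp_apply]
  refine integral_nonneg_of_ae ?_
  filter_upwards [Lp.coeFn_sub (powLp q hp f) (powLp q hp g), powLp_coeFn (q := q) hp f,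
    powLp_coeFn (q := q) hp g, Lp.coeFn_sub f g] with x hpow hf hg hsub
  rw [hpow, hsub, Pi.sub_apply, Pi.sub_apply, hf, hg]
  exact signedPow_sub_mul_sub_nonneg hp _ _

theorem ellipticOp_sub_apply_sub_nonneg (hp : 1 < p.toReal) (hΩD : Ω ⊆ D) (hU : MemM p α β U)
    (y z : W0 p Ω) :
    0 ≤ (ellipticOp q hp hΩD U y - ellipticOp q hp hΩD U z) (y - z) := by
  rw [sub_apply, ellipticOp_apply, ellipticOp_apply, add_sub_add_comm, ← Finset.sum_sub_distrib]
  simp only [← sub_apply, ← map_sub]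
  refine add_nonneg (sum_toDualLp_sub_gradAlong_nonneg hp hΩD hU y z) ?_
  rw [(jetOn Ω Ω none).map_sub]
  exact toDualLp_powLp_sub_apply_sub_nonneg hp _ _

theorem toDualLp_powLp_apply_self {X : Type*} [MeasurableSpace X] {μ : Measure X}
    (hp : 1 < p.toReal) (f : Lp ℝ p μ) : toDualLp μ p q (powLp q hp f) f = ‖f‖ ^ p.toReal := by
  rw [norm_rpow_eq_integral hp, toDualLp_apply]
  refine integral_congr_ae ?_
  filter_upwards [powLp_coeFn (q := q) hp f] with x hx
  rw [hx, signedPow_mul_self hp]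

theorem mul_sum_norm_rpow_le_sum_toDualLp_gradAlong (hp : 1 < p.toReal) (hΩD : Ω ⊆ D)
    (hU : MemM p α β U) (y : W0 p Ω) :
    α * ∑ k, ‖jetOn Ω Ω (some k) y‖ ^ p.toReal ≤
      ∑ j, toDualLp (volume.restrict Ω) p q (powLp q hp (jetOn Ω Ω (some j) y))
        (gradAlong hΩD (fun i => U i j) y) := by
  have hint (k : Fin N) :
      Integrable (fun x => |jetOn Ω Ω (some k) y x| ^ p.toReal) (volume.restrict Ω) :=
    integrable_abs_rpow hp (Lp.memLp _)
  calc α * ∑ k, ‖jetOn Ω Ω (some k) y‖ ^ p.toReal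
      = ∫ x in Ω, α * ∑ k, |jetOn Ω Ω (some k) y x| ^ p.toReal := by
        rw [integral_const_mul, integral_finsetSum _ fun k _ => hint k]
        simp only [norm_rpow_eq_integral hp]
    _ ≤ ∫ x in Ω, ∑ i, ∑ j, U i j x * powLp q hp (jetOn Ω Ω (some j) y) x * stateGrad y i x := by
        refine integral_mono_ae ((integrable_finsetSum _ fun k _ => hint k).const_mul α)
          (integrable_sum_mul_stateGrad hΩD U _ y) ?_
        filter_upwards [ae_all_iff.2 fun j => powLp_jetOn_coeFn (q := q) hp y (some j),
          ae_all_iff.2 fun j => jetOn_coeFn Ω (some j) y,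
          ae_restrict_of_ae_restrict_of_subset hΩD hU.coercive] with x hpow hjet hcoer
        simp only [hpow, hjet]
        exact hcoer fun i => stateGrad y i x
    _ = _ := (sum_toDualLp_gradAlong hΩD U _ y).symm

theorem mul_norm_rpow_le_ellipticOp_apply_self (hp : 1 < p.toReal) (hΩ : MeasurableSet Ω)
    (hΩD : Ω ⊆ D) (hU : MemM p α β U) (y : W0 p Ω) :
    min α 1 * ‖y‖ ^ p.toReal ≤ ellipticOp q hp hΩD U y y := by
  rw [ellipticOp_apply, norm_rpow_W0 hp hΩ, Fintype.sum_option, mul_add, add_comm (min α 1 * _)]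
  refine add_le_add ?_ ?_
  · exact (mul_le_mul_of_nonneg_right (min_le_left α 1) (by positivity)).trans
      (mul_sum_norm_rpow_le_sum_toDualLp_gradAlong hp hΩD hU y)
  · rw [toDualLp_powLp_apply_self]
    exact mul_le_of_le_one_left (by positivity) (min_le_right α 1)

theorem continuous_ellipticOp (hp : 1 < p.toReal) (hΩD : Ω ⊆ D) (U : Control D) (y v w : W0 p Ω) :
    Continuous fun t : ℝ => ellipticOp q hp hΩD U (y + t • v) w := by
  simp only [ellipticOp_apply, map_add, map_smul]
  exact (continuous_finsetSum _ fun j _ => continuous_toDualLp_powLp hp _ _ _).add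
    (continuous_toDualLp_powLp hp _ _ _)

theorem isRadiallyContinuous_ellipticOp_sub (hp : 1 < p.toReal) (hΩD : Ω ⊆ D) (U : Control D)
    (f : WDual p Ω) : IsRadiallyContinuous fun y => ellipticOp q hp hΩD U y - f := fun y v => by
  have hcont : Continuous fun t : ℝ => ellipticOp q hp hΩD U (y + t • v) v - f v :=
    (continuous_ellipticOp hp hΩD U y v v).sub continuous_const
  have hlim := hcont.tendsto 0
  rw [zero_smul, add_zero] at hlim
  exact hlim.mono_left nhdsWithin_le_nhds

theorem apply_lt_ellipticOp_apply_self (hp : 2 ≤ p.toReal) (hΩ : MeasurableSet Ω) (hΩD : Ω ⊆ D)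
    (hα : 0 < α) (hU : MemM p α β U) (f : WDual p Ω) {y : W0 p Ω}
    (hy : max 1 (‖f‖ / min α 1) < ‖y‖) :
    f y < ellipticOp q (one_lt_two.trans_le hp) hΩD U y y := by
  have hmin : 0 < min α 1 := lt_min hα one_pos
  obtain ⟨hy₁, hyf⟩ := max_lt_iff.1 hy
  rw [div_lt_iff₀ hmin] at hyf
  have hpow : ‖y‖ ^ 2 ≤ ‖y‖ ^ p.toReal := by
    rw [← Real.rpow_two]
    exact Real.rpow_le_rpow_of_exponent_le hy₁.le hp
  calc f y ≤ ‖f‖ * ‖y‖ := (le_abs_self _).trans (f.le_opNorm y)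
    _ < ‖y‖ * min α 1 * ‖y‖ := by gcongr
    _ = min α 1 * ‖y‖ ^ 2 := by ring
    _ ≤ min α 1 * ‖y‖ ^ p.toReal := by gcongr
    _ ≤ _ := mul_norm_rpow_le_ellipticOp_apply_self _ hΩ hΩD hU y

variable (f : WDual p D)

include q in
theorem exists_isWeakSolution (hp : 2 ≤ p.toReal) (hΩ : MeasurableSet Ω) (hΩD : Ω ⊆ D)
    (hα : 0 < α) (hU : MemM p α β U) : ∃ y : W0 p Ω, IsWeakSolution hΩD f U y := by
  have hp₁ : 1 < p.toReal := one_lt_two.trans_le hp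
  have := separableSpace_W0 (Ω := Ω) (ne_top_of_one_lt_toReal hp₁)
  obtain ⟨y, hy⟩ := exists_eq_zero_of_monotone
    (fun y C hy => exists_weaklyConverges_subseq_W0 (Ω := Ω) hp hy)
    (fun y z => by simpa only [sub_sub_sub_cancel_right] using
      ellipticOp_sub_apply_sub_nonneg (q := q) hp₁ hΩD hU y z)
    (isRadiallyContinuous_ellipticOp_sub hp₁ hΩD U (f.comp (inclusionW0 hΩD)))
    (lt_max_of_lt_left one_pos)
    (fun y hy => sub_nonneg.2 (apply_lt_ellipticOp_apply_self hp hΩ hΩD hα hU _ hy).le)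
  exact ⟨y, (isWeakSolution_iff hp₁ hΩD f U y).2 (sub_eq_zero.1 hy)⟩

include q in
theorem IsWeakSolution.norm_le (hp : 2 ≤ p.toReal) (hΩ : MeasurableSet Ω) {hΩD : Ω ⊆ D}
    (hα : 0 < α) (hU : MemM p α β U) {y : W0 p Ω} (hy : IsWeakSolution hΩD f U y) :
    ‖y‖ ≤ max 1 (‖f.comp (inclusionW0 hΩD)‖ / min α 1) := by
  by_contra! h
  have hlt := apply_lt_ellipticOp_apply_self (q := q) hp hΩ hΩD hα hU _ h
  rw [(isWeakSolution_iff (q := q) _ hΩD f U y).1 hy] at hlt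
  exact lt_irrefl _ hlt

theorem isWeakSolution_of_weaklyConverges (hp : 2 ≤ p.toReal) (hΩ : IsOpen Ω)
    (hΩb : Bornology.IsBounded Ω) (hD : volume D ≠ ∞) {hΩD : Ω ⊆ D} {U : ℕ → Control D}
    {V : Control D} (hU : ∀ k, MemM p α β (U k))
    (hconv : ∀ i j, ConvergesAgainst (volume.restrict D) q (fun n => U n i j) (V i j))
    (hdiv : ∀ i, ∃ (ℓ : ℕ → WDual p D) (ℓ₀ : WDual p D), Tendsto ℓ atTop (𝓝 ℓ₀) ∧
      (∀ n, IsDivergence (fun a => U n a i) (ℓ n)) ∧ IsDivergence (fun a => V a i) ℓ₀)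
    {y : ℕ → W0 p Ω} {y₀ : W0 p Ω} (hsol : ∀ k, IsWeakSolution hΩD f (U k) (y k))
    (hy : WeaklyConverges y y₀) : IsWeakSolution hΩD f V y₀ := by
  have hp₁ : 1 < p.toReal := one_lt_two.trans_le hp
  set f' : WDual p Ω := f.comp (inclusionW0 hΩD) with hf'
  have hlim (v : W0 p Ω) : Tendsto (fun k => (f' - ellipticOp q hp₁ hΩD (U k) v) (y k - v)) atTop
      (𝓝 ((f' - ellipticOp q hp₁ hΩD V v) (y₀ - v))) := by
    have hyv := hy.sub_const v
    simp only [sub_apply, ellipticOp_apply]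
    refine (hyv f').sub (.add (tendsto_finsetSum _ fun j _ => ?_) (hyv.map (jetOn Ω Ω none) _))
    obtain ⟨ℓ, ℓ₀, hℓ, hdivU, hdivV⟩ := hdiv j
    exact weaklyConverges_gradAlong hp hΩ hΩb hD hΩD (u := fun k i => U k i j)
      (fun k i => (hU k).growth i j) (fun i => hconv i j) hℓ hdivU hdivV hyv _
  have hvar (v : W0 p Ω) : 0 ≤ (f' - ellipticOp q hp₁ hΩD V v) (y₀ - v) :=
    ge_of_tendsto' (hlim v) fun k => by
      rw [hf', ← (isWeakSolution_iff (q := q) hp₁ hΩD f (U k) (y k)).1 (hsol k)]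
      exact ellipticOp_sub_apply_sub_nonneg hp₁ hΩD (hU k) (y k) v
  refine (isWeakSolution_iff (q := q) hp₁ hΩD f V y₀).2 (Eq.symm ?_)
  have hrad := isRadiallyContinuous_ellipticOp_sub (q := q) hp₁ hΩD V 0
  simp only [sub_zero] at hrad
  exact eq_of_forall_neg_modulus_le (s := 0) isModulus_zero hrad (lt_add_one ‖y₀‖)
    fun v _ => by simpa only [neg_zero] using hvar v

end Elliptic

/-! ### The Hammerstein equation -/

section Hammerstein

variable {N : ℕ} {p q : ℝ≥0∞} [Fact (1 ≤ p)] [Fact (1 ≤ q)] {Ω D : Set (Space N)}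

theorem separableSpace_LpOn (hp : p ≠ ∞) : TopologicalSpace.SeparableSpace (LpOn p Ω) := by
  have : Fact (p ≠ ∞) := ⟨hp⟩
  infer_instance

variable [p.HolderConjugate q]

theorem toDualLp_eq_pairing (w : LpOn q Ω) (z : LpOn p Ω) :
    toDualLp (volume.restrict Ω) p q w z = pairing w z :=
  toDualLp_apply w z

theorem solvesHammerstein_iff (hΩ : IsOpen Ω) (hΩD : Ω ⊆ D) (B : LpOn q Ω →L[ℝ] LpOn p Ω)
    (F : W0 p Ω → LpOn p Ω → LpOn q Ω) (g : LpOn p D) (y : W0 p Ω) (z : LpOn p Ω) :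
    SolvesHammerstein B F g y z ↔ z + B (F y z) = restrictLp hΩD g := by
  have hadd (φ : Space N → ℝ) (hφ : IsTestFunction Ω φ) :
      ∫ x in Ω, (z + B (F y z) : LpOn p Ω) x * φ x =
        (∫ x in Ω, z x * φ x) + ∫ x in Ω, B (F y z) x * φ x := by
    have hint (c : LpOn p Ω) : Integrable (fun x => c x * φ x) (volume.restrict Ω) :=
      (Lp.memLp c).integrable_mul ((hφ.memLp q).restrict Ω)
    rw [← integral_add (hint _) (hint _)]
    refine integral_congr_ae ?_
    filter_upwards [Lp.coeFn_add z (B (F y z))] with x hx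
    rw [hx, Pi.add_apply, add_mul]
  have hg (φ : Space N → ℝ) : ∫ x in Ω, restrictLp hΩD g x * φ x = ∫ x in Ω, g x * φ x := by
    refine integral_congr_ae ?_
    filter_upwards [restrictLp_coeFn hΩD g] with x hx
    rw [hx]
  refine ⟨fun h => eq_of_forall_integral_mul_eq hΩ fun φ hφ => ?_, fun h φ hφ => ?_⟩
  · rw [hadd φ hφ, hg, h φ hφ]
  · rw [← hadd φ hφ, ← hg, h]

theorem isRadiallyContinuous_sub {G : LpOn p Ω → LpOn q Ω} (hG : RadiallyContinuous G)
    (h : LpOn q Ω) :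
    IsRadiallyContinuous fun z => toDualLp (volume.restrict Ω) p q (G z - h) := fun z v => by
  obtain ⟨ε, hε, hcont⟩ := hG z v
  have hlim : Tendsto (fun τ : ℝ => pairing (G (z + τ • v)) v) (𝓝[>] 0) (𝓝 (pairing (G z) v)) := by
    have h0 := hcont 0 (left_mem_Icc.2 hε.le)
    rw [ContinuousWithinAt, zero_smul, add_zero] at h0
    exact h0.mono_left (nhdsWithin_le_of_mem (Icc_mem_nhdsGT hε))
  simp only [map_sub, sub_apply, toDualLp_eq_pairing]
  exact hlim.sub_const _

variable {F : W0 p Ω → LpOn p Ω → LpOn q Ω}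

theorem HasUSBV.exists_hasSBV (hF : HasUSBV F) {Y₀ : Set (W0 p Ω)} (hY : Bornology.IsBounded Y₀)
    (hne : Y₀.Nonempty) (h : LpOn q Ω) :
    ∃ (s : Seminorm ℝ (LpOn p Ω)) (c : ℝ → ℝ → ℝ), IsCompactSeminorm s ∧ IsModulus c ∧
      ∀ y ∈ Y₀, HasSBV s c fun z => toDualLp (volume.restrict Ω) p q (F y z - h) := by
  obtain ⟨s, C, hs, hC, hle⟩ := hF Y₀ hY
  obtain ⟨y₀, hy₀⟩ := hne
  refine ⟨s, C y₀, hs, fun R hR => ⟨?_, (hC y₀ hy₀).2 R hR⟩, fun y hy R hR z₁ z₂ hz₁ hz₂ => ?_⟩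
  · exact (hC y₀ hy₀).1.comp (f := fun t : ℝ => (R, t)) (by fun_prop) fun t ht => ⟨hR.le, ht⟩
  · refine (hle R hR z₁ z₂ hz₁ hz₂ y hy y₀ hy₀).trans_eq ?_
    rw [← map_sub, sub_sub_sub_cancel_right, toDualLp_eq_pairing]

variable {B : LpOn q Ω →L[ℝ] LpOn p Ω} (hp : 2 ≤ p.toReal) (hB : ∀ w, 0 ≤ pairing w (B w))
  (hF : HasUSBV F)

include hp hB hF

theorem exists_add_apply_eq {y : W0 p Ω} (hrad : RadiallyContinuous (F y)) {h : LpOn q Ω} {r : ℝ}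
    (hcoer : ∀ z : LpOn p Ω, r < ‖z‖ → 0 ≤ pairing (F y z - h) z) : ∃ z, z + B (F y z) = B h := by
  have hp₁ : 1 < p.toReal := one_lt_two.trans_le hp
  have : Fact (p ≠ ∞) := ⟨ne_top_of_one_lt_toReal hp₁⟩
  have : Fact (q ≠ ∞) := ⟨conjExponent_ne_top (p := p) hp₁⟩
  have hA : Function.Surjective (toDualLp (volume.restrict Ω) p q) := toDualLp_surjective hp
  obtain ⟨s, c, hs, hc, hsbv⟩ :=
    hF.exists_hasSBV Bornology.isBounded_singleton (singleton_nonempty y) h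
  obtain ⟨z, hz⟩ := exists_forall_apply_nonneg
    (fun z C hz => exists_weaklyConverges_subseq_Lp q hp hz) hs hc (hsbv y rfl)
    (isRadiallyContinuous_sub hrad h) (lt_max_of_lt_left one_pos)
    (fun z hz => (hcoer z ((le_max_right 1 r).trans_lt hz)).trans_eq
      (toDualLp_eq_pairing _ z).symm)
    (fun w => (hB w).trans_eq (toDualLp_eq_pairing w (B w)).symm) fun z φ => by
      obtain ⟨w, hw⟩ := hA (-φ)
      exact ⟨w, by rw [hw, neg_add_cancel, zero_apply]⟩
  have heq : z = -B (F y z - h) := eq_neg_of_forall_nonneg hA hz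
  rw [map_sub, neg_sub, eq_sub_iff_add_eq] at heq
  exact ⟨z, heq⟩

theorem add_apply_eq_of_weaklyConverges (hrad : ∀ y, RadiallyContinuous (F y))
    (hcomp : CompactInState F) {h : LpOn q Ω} {y : ℕ → W0 p Ω} {y₀ : W0 p Ω} {z : ℕ → LpOn p Ω}
    {z₀ : LpOn p Ω} (hy : WeaklyConverges y y₀) (hz : WeaklyConverges z z₀)
    (hsol : ∀ k, z k + B (F (y k) (z k)) = B h) : z₀ + B (F y₀ z₀) = B h := by
  have := separableSpace_LpOn (Ω := Ω) (ne_top_of_one_lt_toReal (one_lt_two.trans_le hp))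
  obtain ⟨C, hC⟩ := hy.exists_norm_le
  obtain ⟨s, c, hs, hc, hsbv⟩ := hF.exists_hasSBV
    (isBounded_iff_forall_norm_le.2 ⟨C, forall_mem_range.2 hC⟩) (range_nonempty y) h
  have heq : z₀ = -B (F y₀ z₀ - h) :=
    eq_neg_of_weaklyConverges (toDualLp_surjective hp)
      (fun w => (hB w).trans_eq (toDualLp_eq_pairing w (B w)).symm) hs hc
      (G := fun k v => F (y k) v - h) (G₀ := fun v => F y₀ v - h)
      (fun k => hsbv _ (mem_range_self k)) (isRadiallyContinuous_sub (hrad y₀) h)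
      (fun v => (hcomp v y y₀ hy).sub_const h) hz
      fun k => by rw [map_sub, neg_sub, eq_sub_iff_add_eq, hsol]
  rwa [map_sub, neg_sub, eq_sub_iff_add_eq] at heq

end Hammerstein

/-! ### The optimal control problem -/

section OptimalControl

theorem exists_isMinOn_norm_sub {T X : Type*} [NormedAddCommGroup X] [NormedSpace ℝ X] {S : Set T}
    {Z : T → X} (hne : S.Nonempty)
    (hS : ∀ t : ℕ → T, (∀ n, t n ∈ S) → ∀ C, (∀ n, ‖Z (t n)‖ ≤ C) →
      ∃ t₀ ∈ S, ∃ k : ℕ → ℕ, StrictMono k ∧ WeaklyConverges (fun n => Z (t (k n))) (Z t₀)) (b : X) :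
    ∃ t₀ ∈ S, IsMinOn (fun t => ‖Z t - b‖) S t₀ := by
  have hbdd : BddBelow ((fun t => ‖Z t - b‖) '' S) :=
    ⟨0, forall_mem_image.2 fun t _ => norm_nonneg (Z t - b)⟩
  obtain ⟨r, hr_anti, hr, hr_mem⟩ := exists_seq_tendsto_sInf (hne.image _) hbdd
  choose t ht htr using hr_mem
  obtain ⟨t₀, ht₀, k, hk, hweak⟩ := hS t ht (r 0 + ‖b‖) fun n =>
    (norm_le_norm_sub_add _ b).trans
      (add_le_add_left ((htr n).le.trans (hr_anti (Nat.zero_le n))) _)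
  have hmin : ‖Z t₀ - b‖ ≤ sInf ((fun t => ‖Z t - b‖) '' S) :=
    (hweak.sub_const b).norm_le_of_tendsto (fun n => (htr _).le) (hr.comp hk.tendsto_atTop)
  exact ⟨t₀, ht₀, fun t ht => hmin.trans (csInf_le hbdd (mem_image_of_mem _ ht))⟩

variable {N : ℕ} {p q : ℝ≥0∞} [Fact (1 ≤ p)] {Ω D : Set (Space N)}

theorem cost_eq_norm_rpow (hp : 1 < p.toReal) (hΩD : Ω ⊆ D) (zd : LpOn p D)
    (t : Control D × W0 p Ω × LpOn p Ω) :
    cost zd t = ‖t.2.2 - restrictLp hΩD zd‖ ^ p.toReal := by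
  rw [norm_rpow_eq_integral hp, cost]
  refine integral_congr_ae ?_
  filter_upwards [Lp.coeFn_sub t.2.2 (restrictLp hΩD zd), restrictLp_coeFn hΩD zd] with x hsub hres
  rw [hsub, Pi.sub_apply, hres]

variable [Fact (1 ≤ q)] [p.HolderConjugate q] {α β : ℝ} {f : WDual p D} {g : LpOn p D}
  {B : LpOn q Ω →L[ℝ] LpOn p Ω} {F : W0 p Ω → LpOn p Ω → LpOn q Ω} {h : LpOn q Ω}

theorem admissible_nonempty (hp : 2 ≤ p.toReal) (hΩ : IsOpen Ω) {hΩD : Ω ⊆ D} (hα : 0 < α)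
    {Uad : Set (Control D)} {U : Control D} (hU : U ∈ Uad) (hUM : MemM p α β U)
    (hB : ∀ w, 0 ≤ pairing w (B w)) (hBh : B h = restrictLp hΩD g) (hF : HasUSBV F)
    (hrad : ∀ y, RadiallyContinuous (F y))
    (hcoer : ∀ y, ∃ r : ℝ, ∀ z : LpOn p Ω, r < ‖z‖ → 0 ≤ pairing (F y z - h) z) :
    (admissible hΩD Uad B F f g).Nonempty := by
  obtain ⟨y, hy⟩ := exists_isWeakSolution (q := q) f hp hΩ.measurableSet hΩD hα hUM
  obtain ⟨r, hr⟩ := hcoer y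
  obtain ⟨z, hz⟩ := exists_add_apply_eq hp hB hF (hrad y) hr
  exact ⟨(U, y, z), hU, hy, (solvesHammerstein_iff hΩ hΩD B F g y z).2 (hz.trans hBh)⟩

theorem exists_mem_admissible_weaklyConverges_subseq (hp : 2 ≤ p.toReal) (hΩ : IsOpen Ω)
    (hΩb : Bornology.IsBounded Ω) (hD : volume D ≠ ∞) {hΩD : Ω ⊆ D} (hα : 0 < α)
    {ξ₁ ξ₂ : LpOn ∞ D} {Q : Fin N → Set (WDual p D)} (hQ : ∀ i, IsCompact (Q i))
    (hB : ∀ w, 0 ≤ pairing w (B w)) (hBh : B h = restrictLp hΩD g) (hF : HasUSBV F)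
    (hrad : ∀ y, RadiallyContinuous (F y)) (hcomp : CompactInState F)
    {t : ℕ → Control D × W0 p Ω × LpOn p Ω}
    (ht : ∀ n, t n ∈ admissible hΩD (Ub p α β ξ₁ ξ₂ ∩ Usol p α β Q) B F f g) {C : ℝ}
    (hC : ∀ n, ‖(t n).2.2‖ ≤ C) :
    ∃ t₀ ∈ admissible hΩD (Ub p α β ξ₁ ξ₂ ∩ Usol p α β Q) B F f g, ∃ k : ℕ → ℕ, StrictMono k ∧
      WeaklyConverges (fun n => (t (k n)).2.2) t₀.2.2 := by
  have hq := conjExponent_ne_top (p := p) (q := q) (one_lt_two.trans_le hp)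
  have : Fact (q ≠ ∞) := ⟨hq⟩
  obtain ⟨V, hV, k₁, hk₁, hVconv, hVdiv⟩ :=
    exists_convergesAgainst_subseq_of_mem_Usol (q := q) hp hD hQ fun n => (ht n).1
  obtain ⟨y₀, k₂, hk₂, hy₀⟩ := exists_weaklyConverges_subseq_W0 hp fun n =>
    IsWeakSolution.norm_le (q := q) f hp hΩ.measurableSet hα (ht (k₁ n)).1.1.1 (ht (k₁ n)).2.1
  obtain ⟨z₀, k₃, hk₃, hz₀⟩ :=
    exists_weaklyConverges_subseq_Lp q hp fun n => hC (k₁ (k₂ n))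
  have hy := hy₀.comp_strictMono hk₃
  have hk : StrictMono fun n => k₂ (k₃ n) := hk₂.comp hk₃
  have hdiv (i : Fin N) : ∃ (ℓ : ℕ → WDual p D) (ℓ₀ : WDual p D), Tendsto ℓ atTop (𝓝 ℓ₀) ∧
      (∀ n, IsDivergence (fun a => (t (k₁ (k₂ (k₃ n)))).1 a i) (ℓ n)) ∧
      IsDivergence (fun a => V a i) ℓ₀ := by
    obtain ⟨ℓ, ℓ₀, hℓ, hℓdiv, hℓ₀div⟩ := hVdiv i
    exact ⟨_, ℓ₀, hℓ.comp hk.tendsto_atTop, fun n => hℓdiv _, hℓ₀div⟩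
  have hstate : IsWeakSolution hΩD f V y₀ :=
    isWeakSolution_of_weaklyConverges f hp hΩ hΩb hD (fun n => (ht _).1.1.1)
      (fun i j => (hVconv i j).comp_strictMono hk) hdiv (fun n => (ht _).2.1) hy
  have hham : z₀ + B (F y₀ z₀) = B h :=
    add_apply_eq_of_weaklyConverges hp hB hF hrad hcomp hy hz₀ fun n =>
      ((solvesHammerstein_iff hΩ hΩD B F g _ _).1 (ht _).2.2).trans hBh.symm
  exact ⟨(V, y₀, z₀), ⟨hV, hstate, (solvesHammerstein_iff hΩ hΩD B F g y₀ z₀).2 (hham.trans hBh)⟩,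
    _, hk₁.comp hk, hz₀⟩

end OptimalControl

end HammersteinOCP

open HammersteinOCP in
theorem mainTheorem1_general {N : ℕ} {p q : ℝ≥0∞} [Fact (1 ≤ p)] [Fact (1 ≤ q)]
    [p.HolderConjugate q] (hp : 2 ≤ p.toReal) {Ω D : Set (Space N)} (hΩ : IsOpen Ω)
    (hΩb : Bornology.IsBounded Ω) (hD : volume D ≠ ∞) (hΩD : Ω ⊆ D) {α β : ℝ} (hα : 0 < α)
    {ξ₁ ξ₂ : LpOn ∞ D} {Q : Fin N → Set (WDual p D)} (hQ : ∀ i, IsCompact (Q i))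
    (hUad : (Ub p α β ξ₁ ξ₂ ∩ Usol p α β Q).Nonempty) (f : WDual p D) {g : LpOn p D}
    (zd : LpOn p D) {B : LpOn q Ω →L[ℝ] LpOn p Ω} (hB : ∀ w, 0 ≤ pairing w (B w)) {h : LpOn q Ω}
    (hBh : B h = restrictLp hΩD g) {F : W0 p Ω → LpOn p Ω → LpOn q Ω} (hF : HasUSBV F)
    (hrad : ∀ y, RadiallyContinuous (F y))
    (hcoer : ∀ y, ∃ r : ℝ, ∀ z : LpOn p Ω, r < ‖z‖ → 0 ≤ pairing (F y z - h) z)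
    (hcomp : CompactInState F) :
    ∃ t ∈ admissible hΩD (Ub p α β ξ₁ ξ₂ ∩ Usol p α β Q) B F f g,
      IsMinOn (cost zd) (admissible hΩD (Ub p α β ξ₁ ξ₂ ∩ Usol p α β Q) B F f g) t := by
  obtain ⟨U, hU⟩ := hUad
  obtain ⟨t, ht, hmin⟩ := exists_isMinOn_norm_sub
    (admissible_nonempty hp hΩ hα hU hU.1.1 hB hBh hF hrad hcoer)
    (fun t ht C hC => exists_mem_admissible_weaklyConverges_subseq hp hΩ hΩb hD hα hQ hB hBh hF
      hrad hcomp ht hC)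
    (restrictLp hΩD zd)
  refine ⟨t, ht, fun t' ht' => ?_⟩
  change cost zd t ≤ cost zd t'
  simp only [cost_eq_norm_rpow (one_lt_two.trans_le hp) hΩD]
  exact Real.rpow_le_rpow (norm_nonneg _) (hmin ht') ENNReal.toReal_nonneg

open HammersteinOCP in
theorem mainTheorem1
    -- the exponents: `2 ≤ p < ∞` and `1/p + 1/q = 1`
    {N : ℕ} (hN : 1 ≤ N) {p q : ℝ≥0∞} [Fact (1 ≤ p)] [Fact (1 ≤ q)] [p.HolderConjugate q]
    (hp2 : 2 ≤ p) (hp : p ≠ ∞)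
    -- bounded open sets `Ω ⊂⊂ D` (`hΩD` only names a consequence of `hcl`)
    {Ω D : Set (Space N)} (hΩo : IsOpen Ω) (hDo : IsOpen D) (hDb : Bornology.IsBounded D)
    (hcl : closure Ω ⊆ D) (hΩD : Ω ⊆ D)
    -- the data of the set of admissible controls
    {α β : ℝ} (hα : 0 < α) (hαβ : α ≤ β)
    (ξ₁ ξ₂ : LpOn ∞ D) (hξ : ∀ᵐ x ∂(volume.restrict D), 0 ≤ ξ₁ x ∧ ξ₁ x ≤ ξ₂ x)
    (Q : Fin N → Set (WDual p D))
    (hQ : ∀ i, (Q i).Nonempty ∧ IsCompact (Q i) ∧ Convex ℝ (Q i))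
    (hUad : (Ub p α β ξ₁ ξ₂ ∩ Usol p α β Q).Nonempty)
    -- the distributions `f`, `g`, `z_d`
    (f : WDual p D) (g zd : LpOn p D)
    -- `B` is linear, continuous and positive, with a right inverse `Br` on a set `T` containing `g`
    (B : LpOn q Ω →L[ℝ] LpOn p Ω) (hB : ∀ w, 0 ≤ pairing w (B w))
    (T : Set (LpOn p Ω)) (Br : LpOn p Ω → LpOn q Ω) (hBr : T.RightInvOn Br B)
    (hgT : restrictLp hΩD g ∈ T)
    -- the conditions on `F`
    (F : W0 p Ω → LpOn p Ω → LpOn q Ω)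
    (hF_usbv : HasUSBV F)
    (hF_rad : ∀ y, RadiallyContinuous (F y))
    (hF_coer : ∀ Y₀ : Set (W0 p Ω), Bornology.IsBounded Y₀ → ∃ lam > (0 : ℝ), ∀ y ∈ Y₀,
      ∀ z : LpOn p Ω, lam < ‖z‖ → 0 ≤ pairing (F y z - Br (restrictLp hΩD g)) z)
    (hF_comp : CompactInState F) :
    ∃ t ∈ admissible hΩD (Ub p α β ξ₁ ξ₂ ∩ Usol p α β Q) B F f g,
      IsMinOn (cost zd) (admissible hΩD (Ub p α β ξ₁ ξ₂ ∩ Usol p α β Q) B F f g) t := by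
  exact mainTheorem1_general (by simpa using ENNReal.toReal_mono hp hp2) hΩo (hDb.subset hΩD)
    hDb.measure_lt_top.ne hΩD hα (fun i => (hQ i).2.1) hUad f zd hB (hBr hgT) hF_usbv hF_rad
    (fun y => (hF_coer {y} Bornology.isBounded_singleton).imp fun _ hlam => hlam.2 y rfl) hF_comp
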